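/- **Notation.** Let $n\ge 1$, $0<a<1$, $s\ge 0$, write $x=(x',x_n)\in\mathbb R^{n}$, $\mathbb R^n_+=\{x: x_n>0\}$, $\langle\xi\rangle=(1+|\xi|^2)^{1/2}$, and $\operatorname{Op}(p)u=\mathcal F^{-1}(p\,\mathcal Fu)$ for complex-valued tempered distributions $u$, where $\mathcal Fu(\xi)=\int e^{-ix\cdot\xi}u(x)\,dx$. Let $r^+$ denote restriction from $\mathbb R^n$ to $\mathbb R^n_+$ and $e^+$ extension by zero from $\mathbb R^n_+$ to $\mathbb R^n$. Let $H^s(\mathbb R^n)=\{u\in\mathcal S'(\mathbb R^n):\langle\xi\rangle^s\hat u\in L_2\}$, and let $\overline H^s(\mathbb R^n_+)=r^+H^s(\mathbb R^n)$ with the quotient norm. Put $\Xi_+^{\tau}=\operatorname{Op}((\langle\xi'\rangle+i\xi_n)^{\tau})$ for $\tau\in\mathbb R$ (principal branch) and $(1-\Delta)^a=\operatorname{Op}((1+|\xi|^2)^a)$. For $t\ge a-1$ let $$H^{(a-1)(t)}(\overline{\mathbb R}^n_+)=\Xi_+^{1-a}\,e^+\,\overline H^{\,t-a+1}(\mathbb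 R^n_+),$$ with the norm of $u=\Xi_+^{1-a}e^+g$ being the norm of $g$ in $\overline H^{\,t-a+1}(\mathbb R^n_+)$. For $t>a-\tfrac12$ the map $u\mapsto\gamma_0(u/x_n^{a-1})$ is defined on $H^{(a-1)(t)}(\overline{\mathbb R}^n_+)$, with values in $H^{t-a+\frac12}(\mathbb R^{n-1})$, as the extension by continuity of the map $e^+x_n^{a-1}w\mapsto w(\cdot,0)$, where $w$ runs through the restrictions to $\overline{\mathbb R}^n_+$ of functions in $\mathcal S(\mathbb R^n)$. (For $n=1$, $\mathbb R^{0}$ is a point.) **Theorem 2.2.** For every $f\in\overline H^s(\mathbb R^n_+)$ and every $\varphi\in H^{s+a+\frac12}(\mathbb R^{n-1})$, the nonhomogeneous Dirichlet problem $$r^+(1-\Delta)^au=f\ \text{ in }\mathbb R^n_+,\qquad \gamma_0(u/x_n^{a-1})=\varphi\ \text{ on }\mathbb R^{n-1},\qquad \operatorname{supp}u\subset\overline{\mathbb R}^n_+,$$ has one and only one solution $u\in H^{(a-1)(s+2a)}(\overline{\mathbb R}^n_+)$. -/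

import Mathlib

open MeasureTheory Filter Topology TemperedDistribution
open scoped SchwartzMap Distributions ENNReal

noncomputable section

namespace HalfSpaceDirichlet

/-! ### Restriction of tempered distributions to an open set -/

section Restriction

variable {E : Type*} [NormedAddCommGroup E] [NormedSpace ℝ E]

/-- A real test function on `Ω`, regarded as a complex-valued Schwartz function. -/
def testToSchwartz {Ω : TopologicalSpace.Opens E} (φ : 𝓓(Ω, ℝ)) : 𝓢(E, ℂ) :=
  HasCompactSupport.toSchwartzMap (f := fun x => (φ x : ℂ))
    (φ.hasCompactSupport.comp_left (g := fun r : ℝ => (r : ℂ)) Complex.ofReal_zero)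
    (Complex.ofRealCLM.contDiff.comp φ.contDiff)

@[simp]
theorem testToSchwartz_apply {Ω : TopologicalSpace.Opens E} (φ : 𝓓(Ω, ℝ)) (x : E) :
    testToSchwartz φ x = (φ x : ℂ) := rfl

/-- The inclusion `𝓓(Ω) → 𝓢` is continuous. -/
def testToSchwartzCLM (Ω : TopologicalSpace.Opens E) : 𝓓(Ω, ℝ) →L[ℝ] 𝓢(E, ℂ) :=
  TestFunction.mkCLM ℝ testToSchwartz
    (fun f g => by ext x; simp)
    (fun c f => by ext x; simp)
    (fun K hK => by
      let Φ : 𝓓^{⊤}_{K}(E, ℝ) →ₗ[ℝ] 𝓢(E, ℂ) :=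
        { toFun := fun f => testToSchwartz (TestFunction.ofSupportedIn hK f)
          map_add' := fun f g => by ext x; simp
          map_smul' := fun c f => by ext x; simp }
      change Continuous Φ
      refine WithSeminorms.continuous_of_isBounded (ContDiffMapSupportedIn.withSeminorms ℝ E ℝ ⊤ K)
        (schwartz_withSeminorms ℝ E ℂ) Φ (Seminorm.IsBounded.of_real ?_)
      rintro ⟨k, n⟩
      obtain ⟨R, hR⟩ := K.isCompact.isBounded.exists_norm_le
      refine ⟨{n}, (max R 0) ^ k, fun f => ?_⟩
      simp only [Finset.sup_singleton]
      refine SchwartzMap.seminorm_le_bound ℝ k n _ (by positivity) fun x => ?_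
      have h1 : ‖iteratedFDeriv ℝ n (Φ f) x‖ = ‖iteratedFDeriv ℝ n f x‖ :=
        Complex.ofRealLI.norm_iteratedFDeriv_comp_left (f := f)
          (f.contDiff.contDiffAt) (mod_cast le_top)
      rw [h1]
      by_cases hx : x ∈ K
      · have h2 : ‖x‖ ≤ max R 0 := (hR x hx).trans (le_max_left _ _)
        gcongr
        exact ContDiffMapSupportedIn.norm_iteratedFDeriv_apply_le_seminorm_top ℝ
      · have h3 : iteratedFDeriv ℝ n f x = 0 := by
          by_contra h
          exact hx (f.tsupport_subset (support_iteratedFDeriv_subset n h))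
        rw [h3, norm_zero, mul_zero]
        positivity)

/-- The restriction `r⁺U` of a tempered distribution `U` to the open set `Ω`. -/
def restr (Ω : TopologicalSpace.Opens E) (U : 𝓢'(E, ℂ)) : 𝓓'(Ω, ℂ) :=
  ((U : 𝓢(E, ℂ) →L[ℂ] ℂ).restrictScalars ℝ).comp (testToSchwartzCLM Ω)

@[simp]
theorem restr_apply (Ω : TopologicalSpace.Opens E) (U : 𝓢'(E, ℂ)) (φ : 𝓓(Ω, ℝ)) :
    restr Ω U φ = U (testToSchwartz φ) := rfl

end Restriction

/-! ### Sobolev spaces on the whole space and their restrictions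

`MemSobolev s 2 U` is Mathlib's `U ∈ H^s`. The norms below are computed with Mathlib's Bessel
potential, whose symbol is `(1 + |ξ|²)^{s/2}` for the Fourier transform with kernel `e^{-2πi x·ξ}`;
for the kernel `e^{-i x·ξ}` one gets the same space with an equivalent norm. -/

section Sobolev

variable {E : Type*} [NormedAddCommGroup E] [InnerProductSpace ℝ E] [FiniteDimensional ℝ E]
  [MeasurableSpace E] [BorelSpace E]

/-- The norm of `U` in `H^s`, equal to `∞` if `U ∉ H^s`. -/
def sobolevENorm (s : ℝ) (U : 𝓢'(E, ℂ)) : ℝ≥0∞ :=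
  ⨅ (h : Lp ℂ 2 (volume : Measure E)) (_ : besselPotential E ℂ s U = h), ‖h‖ₑ

/-- The restricted Sobolev space `H̄^s(Ω) = r⁺ H^s`. -/
def MemSobolevRestr (Ω : TopologicalSpace.Opens E) (s : ℝ) (g : 𝓓'(Ω, ℂ)) : Prop :=
  ∃ G : 𝓢'(E, ℂ), MemSobolev s 2 G ∧ restr Ω G = g

/-- The quotient norm of `H̄^s(Ω)`: the infimum of the `H^s`-norms of all extensions of `g`. -/
def sobolevRestrENorm (Ω : TopologicalSpace.Opens E) (s : ℝ) (g : 𝓓'(Ω, ℂ)) : ℝ≥0∞ :=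
  ⨅ (G : 𝓢'(E, ℂ)) (_ : restr Ω G = g), sobolevENorm s G

/-- `v = e⁺g` for `g ∈ L₂(Ω)`: `v` is an `L₂`-function vanishing almost everywhere outside `Ω`
whose restriction to `Ω` is `g`. -/
def IsZeroExtension (Ω : TopologicalSpace.Opens E) (g : 𝓓'(Ω, ℂ)) (v : 𝓢'(E, ℂ)) : Prop :=
  ∃ h : Lp ℂ 2 (volume : Measure E),
    v = h ∧ (∀ᵐ x, x ∉ Ω → h x = 0) ∧ restr Ω v = g

/-- The operator `Op(p) = F⁻¹ p(ξ) F` for the Fourier transform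
`(F u)(ξ) = ∫ e^{-i x·ξ} u(x) dx`; Mathlib's transform has the kernel `e^{-2πi x·ξ}`,
so the symbol is dilated by `2π`. -/
def op (p : E → ℂ) : 𝓢'(E, ℂ) →L[ℂ] 𝓢'(E, ℂ) :=
  fourierMultiplierCLM ℂ (fun ξ => p ((2 * Real.pi) • ξ))

/-- `(1 - Δ)^a = Op((1 + |ξ|²)^a)`. -/
def oneSubLaplacianPow (a : ℝ) : 𝓢'(E, ℂ) →L[ℂ] 𝓢'(E, ℂ) :=
  op (fun ξ => (((1 + ‖ξ‖ ^ 2) ^ a : ℝ) : ℂ))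

end Sobolev

/-! ### The half-space `ℝⁿ₊`, with `n = d + 1`; the last coordinate is `x_n` -/

/-- `ℝⁿ₊ = {x ∈ ℝⁿ : x_n > 0}`. -/
def halfSpace (d : ℕ) : TopologicalSpace.Opens (EuclideanSpace ℝ (Fin (d + 1))) where
  carrier := {x | 0 < x (Fin.last d)}
  is_open' := isOpen_lt continuous_const (by fun_prop)

/-- `⟨ξ'⟩ = (1 + |ξ'|²)^{1/2}`, where `ξ'` are the first `d = n - 1` coordinates of `ξ`. -/
def japTangential {d : ℕ} (ξ : EuclideanSpace ℝ (Fin (d + 1))) : ℝ :=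
  Real.sqrt (1 + ∑ i : Fin d, ξ i.castSucc ^ 2)

/-- The order-reducing operator `Ξ₊^t = Op((⟨ξ'⟩ + i ξ_n)^t)`. -/
def xiPlus (d : ℕ) (t : ℝ) :
    𝓢'(EuclideanSpace ℝ (Fin (d + 1)), ℂ) →L[ℂ] 𝓢'(EuclideanSpace ℝ (Fin (d + 1)), ℂ) :=
  op (fun ξ => ((japTangential ξ : ℂ) + Complex.I * (ξ (Fin.last d) : ℂ)) ^ (t : ℂ))

/-- The `μ`-transmission space `H^{μ(t)} = Ξ₊^{-μ} e⁺ H̄^{t-μ}(ℝⁿ₊)`, for `t ≥ μ`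
(so that `H̄^{t-μ}(ℝⁿ₊) ⊆ L₂(ℝⁿ₊)`). -/
def transmissionSpace (d : ℕ) (μ t : ℝ) : Set 𝓢'(EuclideanSpace ℝ (Fin (d + 1)), ℂ) :=
  {u | ∃ g v, MemSobolevRestr (halfSpace d) (t - μ) g ∧ IsZeroExtension (halfSpace d) g v ∧
    u = xiPlus d (-μ) v}

/-- The norm of `u = Ξ₊^{-μ} e⁺ g` in `H^{μ(t)}`, i.e. the norm of `g = r⁺ Ξ₊^μ u` in
`H̄^{t-μ}(ℝⁿ₊)`. -/
def transmissionENorm (d : ℕ) (μ t : ℝ) (u : 𝓢'(EuclideanSpace ℝ (Fin (d + 1)), ℂ)) : ℝ≥0∞ :=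
  sobolevRestrENorm (halfSpace d) (t - μ) (restr (halfSpace d) (xiPlus d μ u))

/-- The function equal to `x_n^μ w(x)` for `x_n > 0` and to `0` for `x_n ≤ 0`. -/
def powMulFun {d : ℕ} (μ : ℝ) (w : 𝓢(EuclideanSpace ℝ (Fin (d + 1)), ℂ)) :
    EuclideanSpace ℝ (Fin (d + 1)) → ℂ :=
  (halfSpace d : Set (EuclideanSpace ℝ (Fin (d + 1)))).indicator
    (fun x => ((x (Fin.last d) ^ μ : ℝ) : ℂ) * w x)

open Classical in
/-- `e⁺ x_n^μ w` as a tempered distribution; the function is integrable on `ℝⁿ` for `μ > -1`. -/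
def powMul {d : ℕ} (μ : ℝ) (w : 𝓢(EuclideanSpace ℝ (Fin (d + 1)), ℂ)) :
    𝓢'(EuclideanSpace ℝ (Fin (d + 1)), ℂ) :=
  if h : Integrable (powMulFun μ w) volume then (h.toL1 (powMulFun μ w)) else 0

/-- The embedding `x' ↦ (x', 0)` of `ℝ^{n-1}` into `ℝⁿ`. -/
def boundaryEmb (d : ℕ) : EuclideanSpace ℝ (Fin d) →ₗᵢ[ℝ] EuclideanSpace ℝ (Fin (d + 1)) where
  toFun x := WithLp.toLp 2 (Fin.snoc (α := fun _ => ℝ) (fun i => x i) 0)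
  map_add' x y := by
    ext i
    refine Fin.lastCases ?_ (fun j => ?_) i <;> simp
  map_smul' c x := by
    ext i
    refine Fin.lastCases ?_ (fun j => ?_) i <;> simp
  norm_map' x := by
    simp [EuclideanSpace.norm_eq, Fin.sum_univ_castSucc]

/-- The boundary value `γ₀ w = w(·, 0)` of a Schwartz function. -/
def boundaryValue {d : ℕ} (w : 𝓢(EuclideanSpace ℝ (Fin (d + 1)), ℂ)) :
    𝓢(EuclideanSpace ℝ (Fin d), ℂ) :=
  SchwartzMap.compCLMOfAntilipschitz ℂ (boundaryEmb d).toContinuousLinearMap.hasTemperateGrowth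
    (boundaryEmb d).antilipschitz w

/-- `γ₀(u / x_n^μ) = φ` for `u ∈ H^{μ(t)}`, where `u ↦ γ₀(u / x_n^μ)` is the extension by
continuity, from `H^{μ(t)}` to `H^{t-μ-1/2}(ℝ^{n-1})`, of the map `e⁺ x_n^μ w ↦ γ₀ w`
(`w` the restriction of a Schwartz function): some sequence `e⁺ x_n^μ w_k` converges to `u` in
`H^{μ(t)}` while `γ₀ w_k` converges to `φ` in `H^{t-μ-1/2}(ℝ^{n-1})`. -/
def HasWeightedTrace (d : ℕ) (μ t : ℝ) (u : 𝓢'(EuclideanSpace ℝ (Fin (d + 1)), ℂ))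
    (φ : 𝓢'(EuclideanSpace ℝ (Fin d), ℂ)) : Prop :=
  ∃ w : ℕ → 𝓢(EuclideanSpace ℝ (Fin (d + 1)), ℂ),
    Tendsto (fun k => transmissionENorm d μ t (u - powMul μ (w k))) atTop (𝓝 0) ∧
    Tendsto (fun k => sobolevENorm (t - μ - 1 / 2)
      (φ - (boundaryValue (w k) : 𝓢'(EuclideanSpace ℝ (Fin d), ℂ)))) atTop (𝓝 0)

end HalfSpaceDirichlet

end

/-! Write `lam 1 τ` and `lam (-1) τ` for the symbols of Ξ₊^τ and Ξ₋^τ, so that (1-Δ)^a = Ξ₋^a Ξ₊^a.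
Ξ₊^τ preserves support in the closed half-space x_n ≥ 0, and Ξ₋^τ preserves vanishing on the open
half-space x_n > 0 (`Van.mult_lam`, from `preservesHalfLine`). Let F ∈ H^s extend f, put X =
Ξ₋^{-a}F ∈ H^{s+a} and Y = e⁺r⁺X. Everything rests on the claim that the solution is

u = Ξ₊^{-a}(Y + Γ(a) φ ⊗ δ(x_n)).

The factor Γ(a) comes from the Gamma integral `integral_rpow_mul_cexp`: the one-sided Fourier
transform of x^{a-1}e^{-σx} is Γ(a)(σ + iξ)^{-a}. Consequently Ξ₊^a(e⁺x_n^{a-1}w) equals Γ(a) γ₀w ⊗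
δ up to a square-integrable remainder (`isL2_xi_powMul_sub`): subtracting two explicit exponential
models leaves a function vanishing to second order at x_n = 0, whose transform decays by two
integrations by parts.

The equation holds for u because Y + Γ(a)φ⊗δ - X vanishes on x_n > 0 and Ξ₋^a keeps it so.
Membership in the transmission space means that Ξ₊^{-1}(Y + Γ(a)φ⊗δ) is the zero extension of an
H̄^{s+a+1} function. This is `exists_resolvent_extension`: on distributions vanishing on x_n > 0,
Ξ₊^{-1} may be multiplied by (2⟨ξ'⟩/(⟨ξ'⟩ - iξ_n))^N without changing the result on x_n > 0, which
trades the missing regularity in x_n for tangential regularity, and the latter survives truncation.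

For the boundary condition, X is approximated by combinations of
ψ(ξ')(⟨ξ'⟩+iξ_n)^{-j}(⟨ξ'⟩-iξ_n)^{-l}. Partial fractions show that the truncation of each of these
is Ξ₊^a e⁺x_n^{a-1}w with w vanishing at the boundary (`hasFlatCut_atom`). Their density follows
because a finite measure is determined by its integrals against a point-separating star-algebra of
bounded continuous functions (`ae_eq_zero_of_integral_subalgebra`). Adding an exponential model that
carries the boundary value gives the required approximants (`exists_approximant`).

For uniqueness (`eq_of_isSolution`), let u be a solution. Then W = Ξ₊^a u agrees with X on x_n > 0,
so W and Y can differ only at the hyperplane. Approximate u by e⁺x_n^{a-1}w_k. The L₂ remainder Z_k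
of Ξ₊^a(e⁺x_n^{a-1}w_k) is compared with Y by truncation alone, which does not see layers and is
bounded in L₂; hence Z_k tends to Y. The layers Γ(a) γ₀w_k ⊗ δ tend to Γ(a) φ ⊗ δ. Thus W = Y + Γ(a)
φ ⊗ δ, and u is the distribution above. -/

noncomputable section

namespace HalfSpaceDirichlet


/-! ### Splitting `ℝⁿ = ℝⁿ⁻¹ × ℝ` -/

section Splitting

/-- `ℝⁿ` with `n = d + 1`. -/
abbrev Full (d : ℕ) := EuclideanSpace ℝ (Fin (d + 1))

/-- `ℝⁿ⁻¹` with `n = d + 1`. -/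
abbrev Bdry (d : ℕ) := EuclideanSpace ℝ (Fin d)

variable {d : ℕ}

/-- The tangential coordinates `x'` of `x`. -/
def tang (d : ℕ) : Full d →L[ℝ] Bdry d :=
  LinearMap.toContinuousLinearMap
    { toFun := fun x => WithLp.toLp 2 (fun i => x (Fin.castSucc i))
      map_add' := fun x y => by ext i; simp
      map_smul' := fun c x => by ext i; simp }

/-- The normal coordinate `x_n` of `x`. -/
def normal (d : ℕ) : Full d →L[ℝ] ℝ := EuclideanSpace.proj (Fin.last d)

/-- The point `(y, t)`. -/
def mk (y : Bdry d) (t : ℝ) : Full d := WithLp.toLp 2 (Fin.snoc (α := fun _ => ℝ) (fun i => y i) t)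

@[simp] theorem tang_apply (x : Full d) (i : Fin d) : tang d x i = x i.castSucc := rfl

theorem normal_apply (x : Full d) : normal d x = x (Fin.last d) := rfl

@[simp] theorem mk_last (y : Bdry d) (t : ℝ) : mk y t (Fin.last d) = t := by simp [mk]

@[simp] theorem mk_castSucc (y : Bdry d) (t : ℝ) (i : Fin d) : mk y t i.castSucc = y i := by
  simp [mk]

@[simp] theorem tang_mk (y : Bdry d) (t : ℝ) : tang d (mk y t) = y := by ext i; simp

@[simp] theorem normal_mk (y : Bdry d) (t : ℝ) : normal d (mk y t) = t := by simp [normal_apply]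

@[simp] theorem mk_tang_normal (x : Full d) : mk (tang d x) (normal d x) = x := by
  ext i
  refine Fin.lastCases ?_ (fun j => ?_) i <;> simp [normal_apply]

theorem mk_add (y y' : Bdry d) (t t' : ℝ) : mk (y + y') (t + t') = mk y t + mk y' t' := by
  ext i
  refine Fin.lastCases ?_ (fun j => ?_) i <;> simp

theorem mk_smul (c : ℝ) (y : Bdry d) (t : ℝ) : mk (c • y) (c * t) = c • mk y t := by
  ext i
  refine Fin.lastCases ?_ (fun j => ?_) i <;> simp

theorem inner_eq_tang_normal (x z : Full d) :
    inner ℝ x z = inner ℝ (tang d x) (tang d z) + normal d x * normal d z := by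
  simp [PiLp.inner_apply, Fin.sum_univ_castSucc, normal_apply, mul_comm]

theorem norm_sq_eq_tang_normal (x : Full d) : ‖x‖ ^ 2 = ‖tang d x‖ ^ 2 + normal d x ^ 2 := by
  rw [← real_inner_self_eq_norm_sq, ← real_inner_self_eq_norm_sq, inner_eq_tang_normal, sq]

theorem norm_tang_le (x : Full d) : ‖tang d x‖ ≤ ‖x‖ := by
  have := norm_sq_eq_tang_normal x
  exact le_of_sq_le_sq (by nlinarith) (norm_nonneg _)

theorem abs_normal_le (x : Full d) : |normal d x| ≤ ‖x‖ := by
  have := norm_sq_eq_tang_normal x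
  exact abs_le_of_sq_le_sq (by nlinarith [sq_nonneg ‖tang d x‖]) (norm_nonneg _)

theorem norm_mk_sq (y : Bdry d) (t : ℝ) : ‖mk y t‖ ^ 2 = ‖y‖ ^ 2 + t ^ 2 := by
  simp [norm_sq_eq_tang_normal]

/-- The embedding of a vertical line. -/
def vertEmb (d : ℕ) : ℝ →L[ℝ] Full d :=
  LinearMap.toContinuousLinearMap
    { toFun := fun t => mk 0 t
      map_add' := fun s t => by simpa using mk_add (0 : Bdry d) 0 s t
      map_smul' := fun c t => by simpa using mk_smul c (0 : Bdry d) t }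

/-- The embedding of a horizontal hyperplane. -/
def horEmb (d : ℕ) : Bdry d →L[ℝ] Full d :=
  LinearMap.toContinuousLinearMap
    { toFun := fun y => mk y 0
      map_add' := fun y z => by simpa using mk_add y z 0 0
      map_smul' := fun c t => by simpa using mk_smul c t 0 }

@[simp] theorem vertEmb_apply (t : ℝ) : vertEmb d t = mk 0 t := rfl

@[simp] theorem horEmb_apply (y : Bdry d) : horEmb d y = mk y 0 := rfl

theorem mk_eq_add (y : Bdry d) (t : ℝ) : mk y t = horEmb d y + vertEmb d t := by
  simp [← mk_add]

theorem continuous_mk : Continuous fun p : Bdry d × ℝ => mk p.1 p.2 := by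
  simp only [mk_eq_add]; fun_prop

@[fun_prop]
theorem Continuous.mk {X : Type*} [TopologicalSpace X] {f : X → Bdry d} {g : X → ℝ}
    (hf : Continuous f) (hg : Continuous g) : Continuous fun x => mk (f x) (g x) :=
  continuous_mk.comp (hf.prodMk hg)

/-- The measurable equivalence `ℝⁿ ≃ ℝⁿ⁻¹ × ℝ`. -/
def splitEquiv (d : ℕ) : Full d ≃ᵐ Bdry d × ℝ where
  toFun x := (tang d x, normal d x)
  invFun p := mk p.1 p.2
  left_inv x := by simp
  right_inv p := by simp
  measurable_toFun := by
    exact ((tang d).continuous.prodMk (normal d).continuous).measurable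
  measurable_invFun := continuous_mk.measurable

theorem measurePreserving_splitEquiv :
    MeasurePreserving (splitEquiv d) volume (volume.prod volume) := by
  have h1 := EuclideanSpace.volume_preserving_symm_measurableEquiv_toLp (Fin (d + 1))
  have h2 := volume_preserving_piFinSuccAbove (fun _ : Fin (d + 1) => ℝ) (Fin.last d)
  have h3 : MeasurePreserving (Prod.swap : ℝ × (Fin d → ℝ) → (Fin d → ℝ) × ℝ)
      (volume.prod volume) (volume.prod volume) := Measure.measurePreserving_swap
  have h4 := (EuclideanSpace.volume_preserving_symm_measurableEquiv_toLp (Fin d)).symm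
  have h5 := h4.prod (MeasurePreserving.id (volume : Measure ℝ))
  have h6 := h5.comp (h3.comp (h2.comp h1))
  convert! h6 using 1
  ext x i
  · simp [splitEquiv, MeasurableEquiv.piFinSuccAbove]
    rfl
  · simp [splitEquiv, normal_apply]

theorem integral_eq_integral_mk {F : Type*} [NormedAddCommGroup F] [NormedSpace ℝ F]
    {f : Full d → F} (hf : Integrable f) : ∫ x, f x = ∫ y, ∫ t, f (mk y t) := by
  have h := (measurePreserving_splitEquiv (d := d)).symm
  rw [← h.integral_comp' (g := f)]
  rw [integral_prod]
  · rfl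
  · exact (h.integrable_comp_emb (splitEquiv d).symm.measurableEmbedding).2 hf

theorem integrable_iff_mk {F : Type*} [NormedAddCommGroup F] {f : Full d → F} :
    Integrable f ↔ Integrable (fun p : Bdry d × ℝ => f (mk p.1 p.2)) (volume.prod volume) :=
  ((measurePreserving_splitEquiv (d := d)).symm.integrable_comp_emb
    (splitEquiv d).symm.measurableEmbedding).symm

theorem lintegral_eq_lintegral_mk {f : Full d → ℝ≥0∞} (hf : AEMeasurable f) :
    ∫⁻ x, f x = ∫⁻ y, ∫⁻ t, f (mk y t) := by
  have h := (measurePreserving_splitEquiv (d := d)).symm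
  rw [← h.lintegral_comp_emb (splitEquiv d).symm.measurableEmbedding]
  rw [lintegral_prod]
  · rfl
  · exact hf.comp_quasiMeasurePreserving h.quasiMeasurePreserving

theorem integrable_mul_mk {f : Bdry d → ℝ} {g : ℝ → ℝ} (hf : Integrable f) (hg : Integrable g) :
    Integrable fun x : Full d => f (tang d x) * g (normal d x) := by
  rw [integrable_iff_mk]
  simpa using hf.mul_prod hg

theorem quasiMeasurePreserving_tang : Measure.QuasiMeasurePreserving (tang d) volume volume := by
  have := Measure.quasiMeasurePreserving_fst.comp
    (measurePreserving_splitEquiv (d := d)).quasiMeasurePreserving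
  exact this

theorem quasiMeasurePreserving_normal :
    Measure.QuasiMeasurePreserving (normal d) volume volume := by
  have := Measure.quasiMeasurePreserving_snd.comp
    (measurePreserving_splitEquiv (d := d)).quasiMeasurePreserving
  exact this

theorem ae_normal_ne_zero : ∀ᵐ x : Full d, normal d x ≠ 0 := by
  have h : ∀ᵐ t : ℝ, t ≠ 0 := by simp [ae_iff]
  exact quasiMeasurePreserving_normal.ae h

end Splitting


/-! ### The Gamma integral with complex rate -/

section GammaIntegral

open Set

theorem integrableOn_rpow_mul_exp_neg_mul {a σ : ℝ} (ha : 0 < a) (hσ : 0 < σ) :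
    IntegrableOn (fun x : ℝ => x ^ (a - 1) * Real.exp (-σ * x)) (Ioi 0) := by
  have := integrableOn_rpow_mul_exp_neg_mul_rpow (p := 1) (s := a - 1) (b := σ) (by linarith)
    one_pos hσ
  simpa using this

theorem norm_rpow_mul_cexp (a : ℝ) (z : ℂ) {x : ℝ} (hx : 0 < x) :
    ‖((x ^ (a - 1) : ℝ) : ℂ) * Complex.exp (-z * x)‖ = x ^ (a - 1) * Real.exp (-z.re * x) := by
  rw [norm_mul, Complex.norm_real, Complex.norm_exp, Real.norm_of_nonneg (by positivity)]
  simp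

theorem integrableOn_rpow_mul_cexp {a : ℝ} {z : ℂ} (ha : 0 < a) (hz : 0 < z.re) :
    IntegrableOn (fun x : ℝ => ((x ^ (a - 1) : ℝ) : ℂ) * Complex.exp (-z * x)) (Ioi 0) := by
  refine Integrable.mono' (integrableOn_rpow_mul_exp_neg_mul ha hz) ?_ ?_
  · refine AEStronglyMeasurable.mul ?_ (by fun_prop)
    exact (Complex.measurable_ofReal.comp (measurable_id.pow_const _)).aestronglyMeasurable
  · filter_upwards [ae_restrict_mem measurableSet_Ioi] with x hx
    rw [norm_rpow_mul_cexp a z hx]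

/-- Integration by parts: x^a e^{-zx} vanishes at 0 because a > 0, and at infinity because Re z > 0.
-/
theorem integral_rpow_mul_cexp_succ {a : ℝ} {z : ℂ} (ha : 0 < a) (hz : 0 < z.re) :
    z * ∫ x in Ioi (0 : ℝ), ((x ^ (a + 1 - 1) : ℝ) : ℂ) * Complex.exp (-z * x) =
      a * ∫ x in Ioi (0 : ℝ), ((x ^ (a - 1) : ℝ) : ℂ) * Complex.exp (-z * x) := by
  have hd : ∀ x ∈ Ioi (0 : ℝ), HasDerivAt
      (fun x : ℝ => ((x ^ a : ℝ) : ℂ) * Complex.exp (-z * x))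
      ((a : ℂ) * (((x ^ (a - 1) : ℝ) : ℂ) * Complex.exp (-z * x)) -
        z * (((x ^ (a + 1 - 1) : ℝ) : ℂ) * Complex.exp (-z * x))) x := by
    intro x hx
    have h1 := (Real.hasDerivAt_rpow_const (p := a) (Or.inl (ne_of_gt hx))).ofReal_comp
    have h2 : HasDerivAt (fun x : ℝ => -z * (x : ℂ)) (-z * 1) x :=
      (Complex.ofRealCLM.hasDerivAt (x := x)).const_mul (-z)
    convert! h1.mul h2.cexp using 1
    simp only [add_sub_cancel_right]
    push_cast
    ring
  have hc : ContinuousWithinAt (fun x : ℝ => ((x ^ a : ℝ) : ℂ) * Complex.exp (-z * x))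
      (Ici 0) 0 := by
    refine Continuous.continuousWithinAt ?_
    have : Continuous fun x : ℝ => x ^ a := Real.continuous_rpow_const ha.le
    fun_prop
  have hlim : Tendsto (fun x : ℝ => ((x ^ a : ℝ) : ℂ) * Complex.exp (-z * x)) atTop (𝓝 0) := by
    rw [tendsto_zero_iff_norm_tendsto_zero]
    refine (tendsto_rpow_mul_exp_neg_mul_atTop_nhds_zero a z.re hz).congr' ?_
    filter_upwards [eventually_gt_atTop 0] with x hx
    have := norm_rpow_mul_cexp (a + 1) z hx
    simp only [add_sub_cancel_right] at this
    rw [this]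
  have hi1 := (integrableOn_rpow_mul_cexp ha hz)
  have hi2 := (integrableOn_rpow_mul_cexp (a := a + 1) (by linarith) hz)
  have h := integral_Ioi_of_hasDerivAt_of_tendsto hc hd
    ((hi1.const_mul (a : ℂ)).sub (hi2.const_mul z)) hlim
  rw [integral_sub (hi1.const_mul (a : ℂ)) (hi2.const_mul z), integral_const_mul,
    integral_const_mul, Real.zero_rpow ha.ne'] at h
  simp only [Complex.ofReal_zero, zero_mul, sub_zero] at h
  exact (sub_eq_zero.1 h).symm

/-- `∫₀^∞ x^{a-1} e^{-zx} dx = Γ(a) z^{-a}` for `Re z > 0`. -/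
theorem integral_rpow_mul_cexp {a : ℝ} {z : ℂ} (ha : 0 < a) (hz : 0 < z.re) :
    ∫ x in Ioi (0 : ℝ), ((x ^ (a - 1) : ℝ) : ℂ) * Complex.exp (-z * x) =
      Real.Gamma a * z ^ (-(a : ℂ)) := by
  -- Along the vertical line w(t) = σ + it the integral J satisfies J' = -i(a/w)J, by
  -- differentiation under the integral sign and the recursion in a. Hence w^a J is constant, and
  -- its value at t = 0 is the Gamma integral with a real rate.
  set σ := z.re with hσ
  let w : ℝ → ℂ := fun t => σ + t * Complex.I
  have hw : ∀ t, (w t).re = σ := fun t => by simp [w]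
  have hw0 : ∀ t, w t ≠ 0 := fun t h => by
    have := hw t
    rw [h] at this
    simp only [Complex.zero_re] at this
    exact hz.ne this
  let J : ℝ → ℂ := fun t => ∫ x in Ioi (0 : ℝ), ((x ^ (a - 1) : ℝ) : ℂ) * Complex.exp (-w t * x)
  have hJ : ∀ t, HasDerivAt J (-Complex.I * (a / w t) * J t) t := by
    intro t
    have key := (hasDerivAt_integral_of_dominated_loc_of_deriv_le (𝕜 := ℝ)
      (μ := volume.restrict (Ioi (0 : ℝ)))
      (F := fun t x => ((x ^ (a - 1) : ℝ) : ℂ) * Complex.exp (-w t * x))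
      (F' := fun t x => -Complex.I * (((x ^ (a + 1 - 1) : ℝ) : ℂ) * Complex.exp (-w t * x)))
      (x₀ := t) (s := univ) (bound := fun x => x ^ (a + 1 - 1) * Real.exp (-σ * x)) univ_mem
      (Eventually.of_forall fun t =>
        (integrableOn_rpow_mul_cexp ha (by rw [hw]; exact hz)).aestronglyMeasurable)
      (integrableOn_rpow_mul_cexp ha (by rw [hw]; exact hz))
      ((integrableOn_rpow_mul_cexp (a := a + 1) (by linarith)
        (by rw [hw]; exact hz)).aestronglyMeasurable.const_mul _)
      (by
        filter_upwards [ae_restrict_mem measurableSet_Ioi] with x hx t _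
        rw [norm_mul, norm_rpow_mul_cexp (a + 1) _ hx, hw]
        simp)
      (integrableOn_rpow_mul_exp_neg_mul (by linarith) hz)
      (by
        filter_upwards [ae_restrict_mem measurableSet_Ioi] with x hx t _
        have h1 : HasDerivAt (fun t : ℝ => -w t * (x : ℂ)) (-(Complex.I) * x) t := by
          have := (((Complex.ofRealCLM.hasDerivAt (x := t)).mul_const Complex.I).const_add
            (σ : ℂ)).neg.mul_const (x : ℂ)
          convert! this using 1
          simp
        convert! (h1.cexp).const_mul ((x ^ (a - 1) : ℝ) : ℂ) using 1
        have hx' : x ^ (a + 1 - 1) = x ^ (a - 1) * x := by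
          rw [add_sub_cancel_right]
          nth_rewrite 3 [← Real.rpow_one x]
          rw [← Real.rpow_add hx]; simp
        rw [hx']
        push_cast
        ring)).2
    rw [integral_const_mul] at key
    have h2 := integral_rpow_mul_cexp_succ (z := w t) ha (by rw [hw]; exact hz)
    convert! key using 1
    have h3 := eq_div_of_mul_eq (hw0 t) ((mul_comm _ _).trans h2)
    rw [h3]
    simp only [J]
    ring
  have hslit : ∀ t, w t ∈ Complex.slitPlane := fun t => Or.inl (by rw [hw]; exact hz)
  have hQ : ∀ t, HasDerivAt (fun t => w t ^ (a : ℂ) * J t) 0 t := by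
    intro t
    have h1 : HasDerivAt w Complex.I t := by
      have := ((Complex.ofRealCLM.hasDerivAt (x := t)).mul_const Complex.I).const_add (σ : ℂ)
      convert! this using 1
      simp
    have h2 : HasDerivAt (fun t => w t ^ (a : ℂ)) (a * w t ^ ((a : ℂ) - 1) * Complex.I) t :=
      (Complex.hasStrictDerivAt_cpow_const (hslit t)).hasDerivAt.comp t h1
    convert! h2.mul (hJ t) using 1
    rw [Complex.cpow_sub _ _ (hw0 t), Complex.cpow_one]
    field_simp
    ring
  have hconst : ∀ t, w t ^ (a : ℂ) * J t = w 0 ^ (a : ℂ) * J 0 := fun t =>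
    is_const_of_deriv_eq_zero (fun t => (hQ t).differentiableAt) (fun t => (hQ t).deriv) t 0
  have h0 : w 0 ^ (a : ℂ) * J 0 = Real.Gamma a := by
    have h1 := Complex.integral_cpow_mul_exp_neg_mul_Ioi (a := a) (r := σ) (by simpa using ha) hz
    have h2 : J 0 = ∫ t in Ioi (0 : ℝ), (t : ℂ) ^ ((a : ℂ) - 1) * Complex.exp (-(σ * t)) := by
      refine setIntegral_congr_fun measurableSet_Ioi fun x hx => ?_
      simp only [w]
      rw [Complex.ofReal_cpow (le_of_lt hx)]
      simp
    rw [h2, h1, Complex.Gamma_ofReal]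
    simp only [w]
    rw [← mul_assoc, one_div, Complex.inv_cpow]
    · simp only [Complex.ofReal_zero, zero_mul, add_zero]
      rw [mul_inv_cancel₀, one_mul]
      rw [Complex.cpow_ne_zero_iff_of_exponent_ne_zero]
      · exact_mod_cast hz.ne'
      · exact_mod_cast ha.ne'
    · rw [Complex.arg_ofReal_of_nonneg hz.le]
      exact Real.pi_pos.ne
  have hz' : w z.im = z := by simp [w, hσ]
  have h1 := hconst z.im
  rw [h0, hz'] at h1
  simp only [J, hz'] at h1
  have hz0 : z ≠ 0 := hz' ▸ hw0 z.im
  rw [Complex.cpow_neg, ← h1]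
  have : z ^ (a : ℂ) ≠ 0 := by simp [Complex.cpow_eq_zero_iff, hz0]
  field_simp

end GammaIntegral


/-! ### The symbols -/

section Symbols

theorem hasTemperateGrowth_arctan : Real.arctan.HasTemperateGrowth := by
  refine Function.HasTemperateGrowth.of_fderiv (k := 0) (C := Real.pi / 2) ?_
    Real.differentiable_arctan ?_
  · have h : fderiv ℝ Real.arctan =
        fun x => ((1 + ‖x‖ ^ 2) ^ (-1 : ℝ)) • ContinuousLinearMap.id ℝ ℝ := by
      ext x
      rw [(Real.hasDerivAt_arctan x).hasFDerivAt.fderiv]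
      simp [Real.rpow_neg_one]
    rw [h]
    exact (Function.hasTemperateGrowth_one_add_norm_sq_rpow ℝ (-1)).smul (.const _)
  · intro x
    simpa using (abs_lt.2 ⟨Real.neg_pi_div_two_lt_arctan x, Real.arctan_lt_pi_div_two x⟩).le

theorem hasTemperateGrowth_cexp_I_mul :
    (fun x : ℝ => Complex.exp (x * Complex.I)).HasTemperateGrowth := by
  have hs : ContDiff ℝ (⊤ : ℕ∞) fun x : ℝ => Complex.exp (x * Complex.I) :=
    (Complex.ofRealCLM.contDiff.mul contDiff_const).cexp
  refine ⟨hs, fun n => ⟨0, 1, fun x => ?_⟩⟩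
  have h : ∀ n, iteratedDeriv n (fun x : ℝ => Complex.exp (x * Complex.I)) =
      fun x : ℝ => Complex.I ^ n * Complex.exp (x * Complex.I) := by
    intro n
    induction n with
    | zero => simp
    | succ n ih =>
      rw [iteratedDeriv_succ, ih]
      ext x
      have h1 : HasDerivAt (fun x : ℝ => (x : ℂ) * Complex.I) Complex.I x := by
        simpa using (Complex.ofRealCLM.hasDerivAt (x := x)).mul_const Complex.I
      rw [(h1.cexp.const_mul _).deriv]
      ring
  rw [norm_iteratedFDeriv_eq_norm_iteratedDeriv, h]
  simp [Complex.norm_exp_ofReal_mul_I]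

variable {d : ℕ}

/-- `⟨2πy⟩ = (1 + |2πy|²)^{1/2}`. -/
def jap (y : Bdry d) : ℝ := Real.sqrt (1 + ‖(2 * Real.pi) • y‖ ^ 2)

theorem jap_sq (y : Bdry d) : jap y ^ 2 = 1 + ‖(2 * Real.pi) • y‖ ^ 2 :=
  Real.sq_sqrt (by positivity)

theorem one_le_jap (y : Bdry d) : 1 ≤ jap y :=
  Real.one_le_sqrt.2 (by nlinarith [sq_nonneg ‖(2 * Real.pi) • y‖])

theorem jap_pos (y : Bdry d) : 0 < jap y := one_pos.trans_le (one_le_jap y)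

theorem jap_rpow (y : Bdry d) (r : ℝ) :
    jap y ^ r = (1 + ‖(2 * Real.pi) • y‖ ^ 2) ^ (r / 2) := by
  rw [jap, Real.sqrt_eq_rpow, ← Real.rpow_mul (by positivity)]
  congr 1; ring

theorem hasTemperateGrowth_jap_rpow (r : ℝ) :
    (fun y : Bdry d => jap y ^ r).HasTemperateGrowth := by
  simp only [jap_rpow]
  exact (Function.hasTemperateGrowth_one_add_norm_sq_rpow (Bdry d) (r / 2)).comp
    ((2 * Real.pi) • ContinuousLinearMap.id ℝ (Bdry d)).hasTemperateGrowth

theorem continuous_jap : Continuous (jap (d := d)) := by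
  unfold jap; fun_prop

/-- The symbol `⟨ξ'⟩ ± i ξ_n` evaluated at `2πξ`; the sign is `ε`. -/
def base (ε : ℝ) (ξ : Full d) : ℂ :=
  (jap (tang d ξ) : ℂ) + Complex.I * ((ε * (2 * Real.pi * normal d ξ) : ℝ) : ℂ)

/-- The symbol `(⟨ξ'⟩ ± i ξ_n)^τ` evaluated at `2πξ`. -/
def lam (ε τ : ℝ) (ξ : Full d) : ℂ := base ε ξ ^ (τ : ℂ)

@[simp] theorem base_re (ε : ℝ) (ξ : Full d) : (base ε ξ).re = jap (tang d ξ) := by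
  simp [base]

@[simp] theorem base_im (ε : ℝ) (ξ : Full d) :
    (base ε ξ).im = ε * (2 * Real.pi * normal d ξ) := by
  simp [base]

theorem base_re_pos (ε : ℝ) (ξ : Full d) : 0 < (base ε ξ).re := by
  rw [base_re]; exact jap_pos _

theorem base_ne_zero (ε : ℝ) (ξ : Full d) : base ε ξ ≠ 0 := fun h => by
  have := base_re_pos ε ξ
  simp [h] at this

theorem norm_base {ε : ℝ} (hε : ε ^ 2 = 1) (ξ : Full d) :
    ‖base ε ξ‖ = Real.sqrt (1 + ‖(2 * Real.pi) • ξ‖ ^ 2) := by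
  rw [Complex.norm_eq_sqrt_sq_add_sq, base_re, base_im, jap_sq, norm_smul, norm_smul, mul_pow,
    mul_pow ε, mul_pow ‖2 * Real.pi‖ ‖ξ‖, norm_sq_eq_tang_normal ξ, hε]
  congr 1
  simp only [Real.norm_eq_abs, sq_abs]
  ring

/-- `(1 + |2πξ|²)^{1/2}`. -/
def fjap (ξ : Full d) : ℝ := Real.sqrt (1 + ‖(2 * Real.pi) • ξ‖ ^ 2)

theorem norm_base_eq {ε : ℝ} (hε : ε ^ 2 = 1) (ξ : Full d) : ‖base ε ξ‖ = fjap ξ :=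
  norm_base hε ξ

theorem fjap_sq (ξ : Full d) : fjap ξ ^ 2 = jap (tang d ξ) ^ 2 + (2 * Real.pi * normal d ξ) ^ 2 := by
  rw [← norm_base_eq (ε := 1) (by norm_num), Complex.sq_norm, Complex.normSq_apply]
  simp [sq]

theorem jap_le_fjap (ξ : Full d) : jap (tang d ξ) ≤ fjap ξ := by
  rw [← norm_base_eq (ε := 1) (by norm_num), ← base_re 1]
  exact Complex.re_le_norm _

theorem one_le_fjap (ξ : Full d) : 1 ≤ fjap ξ := (one_le_jap _).trans (jap_le_fjap ξ)

theorem fjap_pos (ξ : Full d) : 0 < fjap ξ := one_pos.trans_le (one_le_fjap ξ)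

theorem continuous_fjap : Continuous (fjap (d := d)) := by
  unfold fjap; fun_prop

theorem fjap_rpow (ξ : Full d) (r : ℝ) :
    fjap ξ ^ r = (1 + ‖(2 * Real.pi) • ξ‖ ^ 2) ^ (r / 2) := by
  rw [fjap, Real.sqrt_eq_rpow, ← Real.rpow_mul (by positivity)]
  congr 1; ring

theorem norm_lam {ε : ℝ} (hε : ε ^ 2 = 1) (τ : ℝ) (ξ : Full d) : ‖lam ε τ ξ‖ = fjap ξ ^ τ := by
  rw [lam, Complex.norm_cpow_real, norm_base_eq hε]

theorem hasTemperateGrowth_fjap_rpow (r : ℝ) :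
    (fun y : Full d => fjap y ^ r).HasTemperateGrowth := by
  simp only [fjap_rpow]
  exact (Function.hasTemperateGrowth_one_add_norm_sq_rpow (Full d) (r / 2)).comp
    ((2 * Real.pi) • ContinuousLinearMap.id ℝ (Full d)).hasTemperateGrowth

/-- Since Re > 0, the argument of the base is the arctangent of Im/Re. In this polar form the
complex power is built from real functions of temperate growth, which is how
`hasTemperateGrowth_lam` is obtained. -/
theorem lam_eq_exp {ε : ℝ} (hε : ε ^ 2 = 1) (τ : ℝ) (ξ : Full d) : lam ε τ ξ =
    ((fjap ξ ^ τ : ℝ) : ℂ) * Complex.exp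
      ((τ * Real.arctan ((ε * (2 * Real.pi)) * normal d ξ * jap (tang d ξ) ^ (-1 : ℝ)) : ℝ) *
        Complex.I) := by
  have harg : (base ε ξ).arg =
      Real.arctan ((ε * (2 * Real.pi)) * normal d ξ * jap (tang d ξ) ^ (-1 : ℝ)) := by
    have h := Complex.abs_arg_lt_pi_div_two_iff.2 (Or.inl (base_re_pos ε ξ))
    rw [abs_lt] at h
    rw [← Real.arctan_tan h.1 h.2, Complex.tan_arg, base_re, base_im, Real.rpow_neg_one]
    congr 1
    rw [div_eq_mul_inv]; ring
  have h0 : Complex.log (base ε ξ) * τ =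
      ((Real.log (fjap ξ) * τ : ℝ) : ℂ) + ((τ * (base ε ξ).arg : ℝ) : ℂ) * Complex.I := by
    rw [Complex.log, norm_base_eq hε]
    push_cast
    ring
  rw [lam, Complex.cpow_def_of_ne_zero (base_ne_zero _ _), h0, Complex.exp_add, ← harg,
    ← Complex.ofReal_exp, ← Real.rpow_def_of_pos (fjap_pos ξ)]

theorem hasTemperateGrowth_comp_tang {F : Type*} [NormedAddCommGroup F] [NormedSpace ℝ F]
    {g : Bdry d → F} (hg : g.HasTemperateGrowth) :
    (fun ξ : Full d => g (tang d ξ)).HasTemperateGrowth :=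
  hg.comp (tang d).hasTemperateGrowth

theorem hasTemperateGrowth_ofReal {V : Type*} [NormedAddCommGroup V] [NormedSpace ℝ V]
    {g : V → ℝ} (hg : g.HasTemperateGrowth) :
    (fun x => (g x : ℂ)).HasTemperateGrowth :=
  Function.HasTemperateGrowth.comp Function.Complex.hasTemperateGrowth_ofReal hg

theorem hasTemperateGrowth_lam {ε : ℝ} (hε : ε ^ 2 = 1) (τ : ℝ) :
    (lam (d := d) ε τ).HasTemperateGrowth := by
  have h1 : (fun ξ : Full d => τ * Real.arctan ((ε * (2 * Real.pi)) * normal d ξ *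
      jap (tang d ξ) ^ (-1 : ℝ))).HasTemperateGrowth := by
    refine (Function.HasTemperateGrowth.const τ).mul (hasTemperateGrowth_arctan.comp ?_)
    exact ((Function.HasTemperateGrowth.const _).mul (normal d).hasTemperateGrowth).mul
      (hasTemperateGrowth_comp_tang (hasTemperateGrowth_jap_rpow (-1)))
  have h2 : lam (d := d) ε τ = fun ξ => _ := funext (lam_eq_exp hε τ)
  rw [h2]
  exact (hasTemperateGrowth_ofReal (hasTemperateGrowth_fjap_rpow τ)).mul
    (hasTemperateGrowth_cexp_I_mul.comp h1)

theorem hasTemperateGrowth_jap_tang (r : ℝ) :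
    (fun ξ : Full d => ((jap (tang d ξ) ^ r : ℝ) : ℂ)).HasTemperateGrowth :=
  hasTemperateGrowth_ofReal (hasTemperateGrowth_comp_tang (hasTemperateGrowth_jap_rpow r))

theorem lam_add (ε τ τ' : ℝ) (ξ : Full d) : lam ε (τ + τ') ξ = lam ε τ ξ * lam ε τ' ξ := by
  simp only [lam, Complex.ofReal_add]
  exact Complex.cpow_add _ _ (base_ne_zero _ _)

@[simp] theorem lam_zero (ε : ℝ) (ξ : Full d) : lam ε 0 ξ = 1 := by simp [lam]

@[simp] theorem lam_one (ε : ℝ) (ξ : Full d) : lam ε 1 ξ = base ε ξ := by simp [lam]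

theorem lam_neg (ε τ : ℝ) (ξ : Full d) : lam ε (-τ) ξ = (lam ε τ ξ)⁻¹ := by
  simp [lam, Complex.cpow_neg]

theorem lam_neg_one (ε : ℝ) (ξ : Full d) : lam ε (-1) ξ = (base ε ξ)⁻¹ := by
  rw [lam_neg, lam_one]

theorem base_add_base (ξ : Full d) : base 1 ξ + base (-1) ξ = 2 * jap (tang d ξ) := by
  simp only [base]; push_cast; ring

theorem base_neg_eq_conj (ε : ℝ) (ξ : Full d) :
    base (-ε) ξ = (starRingEnd ℂ) (base ε ξ) := by
  apply Complex.ext <;> simp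

theorem lam_neg_eq_conj (ε τ : ℝ) (ξ : Full d) :
    lam (-ε) τ ξ = (starRingEnd ℂ) (lam ε τ ξ) := by
  have h : (base ε ξ).arg ≠ Real.pi := by
    have h := Complex.abs_arg_lt_pi_div_two_iff.2 (Or.inl (base_re_pos ε ξ))
    rw [abs_lt] at h
    linarith [h.2, Real.pi_pos]
  rw [lam, lam, base_neg_eq_conj, Complex.conj_cpow _ _ h, Complex.conj_ofReal]

/-- The two bases are complex conjugates off the branch cut, so their principal powers are conjugate
too. With ε = 1 and τ = a this is the factorization of (1-Δ)^a. -/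
theorem lam_mul_lam_neg {ε : ℝ} (hε : ε ^ 2 = 1) (τ : ℝ) (ξ : Full d) :
    lam ε τ ξ * lam (-ε) τ ξ = ((fjap ξ ^ (2 * τ) : ℝ) : ℂ) := by
  rw [lam_neg_eq_conj, Complex.mul_conj, Complex.normSq_eq_norm_sq, norm_lam hε,
    ← Real.rpow_natCast, ← Real.rpow_mul (fjap_pos ξ).le]
  congr 2
  push_cast; ring

theorem xiPlus_eq (t : ℝ) : xiPlus d t = fourierMultiplierCLM ℂ (lam 1 t) := by
  have h : (fun ξ : Full d => (((japTangential ((2 * Real.pi) • ξ) : ℝ) : ℂ) + Complex.I *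
      ((((2 * Real.pi) • ξ) (Fin.last d) : ℝ) : ℂ)) ^ (t : ℂ)) = lam 1 t := by
    ext ξ
    simp only [lam, base, one_mul]
    congr 3
    · simp only [japTangential, jap, EuclideanSpace.norm_sq_eq, PiLp.smul_apply, tang_apply,
        Real.norm_eq_abs, sq_abs]
  rw [xiPlus, op, h]

theorem oneSubLaplacianPow_eq (a : ℝ) : oneSubLaplacianPow (E := Full d) a =
    fourierMultiplierCLM ℂ (fun ξ => lam 1 a ξ * lam (-1) a ξ) := by
  have h : (fun ξ : Full d => (((1 + ‖(2 * Real.pi) • ξ‖ ^ 2) ^ a : ℝ) : ℂ)) =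
      fun ξ => lam 1 a ξ * lam (-1) a ξ := by
    ext ξ
    rw [lam_mul_lam_neg (by norm_num), fjap_rpow]
    congr 2
    ring
  rw [oneSubLaplacianPow, op, h]

end Symbols


/-! ### The weight of the Sobolev norm -/

section Bessel

variable {V : Type*} [NormedAddCommGroup V]

/-- The weight `(1 + |ξ|²)^{s/2}` of the norm in `H^s`. -/
def bessel (s : ℝ) (ξ : V) : ℝ := (1 + ‖ξ‖ ^ 2) ^ (s / 2)

theorem bessel_pos (s : ℝ) (ξ : V) : 0 < bessel s ξ := by unfold bessel; positivity

theorem bessel_add (s t : ℝ) (ξ : V) : bessel (s + t) ξ = bessel s ξ * bessel t ξ := by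
  rw [bessel, bessel, bessel, ← Real.rpow_add (by positivity)]
  congr 1; ring

theorem hasTemperateGrowth_bessel [InnerProductSpace ℝ V] (s : ℝ) :
    (fun ξ : V => (bessel s ξ : ℂ)).HasTemperateGrowth :=
  hasTemperateGrowth_ofReal (Function.hasTemperateGrowth_one_add_norm_sq_rpow V (s / 2))

end Bessel

/-! ### Distributions whose Fourier transform is a function -/

section HasFT

open FourierTransform

variable {V : Type*} [NormedAddCommGroup V] [InnerProductSpace ℝ V] [FiniteDimensional ℝ V]
  [MeasurableSpace V] [BorelSpace V]

/-- The Fourier transform of `U` is (integration against) the function `k`. -/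
structure HasFT (U : 𝓢'(V, ℂ)) (k : V → ℂ) : Prop where
  integrable : ∀ Θ : 𝓢(V, ℂ), Integrable (fun ξ => Θ ξ * k ξ)
  eq : ∀ Θ : 𝓢(V, ℂ), U (𝓕 Θ) = ∫ ξ, Θ ξ * k ξ

variable {U U' : 𝓢'(V, ℂ)} {k k' : V → ℂ}

theorem HasFT.unique (h : HasFT U k) (h' : HasFT U' k) : U = U' := by
  ext Θ
  have h1 := h.eq (𝓕⁻ Θ)
  have h2 := h'.eq (𝓕⁻ Θ)
  rw [fourier_fourierInv_eq] at h1 h2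
  rw [h1, h2]

theorem HasFT.congr (h : HasFT U k) (hk : k = k') : HasFT U k' := hk ▸ h

theorem HasFT.add (h : HasFT U k) (h' : HasFT U' k') : HasFT (U + U') (fun ξ => k ξ + k' ξ) where
  integrable Θ := by
    simpa only [mul_add] using! (h.integrable Θ).add (h'.integrable Θ)
  eq Θ := by
    simp only [mul_add]
    rw [integral_add (h.integrable Θ) (h'.integrable Θ), ← h.eq, ← h'.eq]
    rfl

theorem HasFT.smul (h : HasFT U k) (c : ℂ) : HasFT (c • U) (fun ξ => c * k ξ) where
  integrable Θ := by
    simpa only [mul_left_comm] using! (h.integrable Θ).const_mul c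
  eq Θ := by
    simp only [mul_left_comm _ c]
    rw [integral_const_mul, ← h.eq]
    rfl

theorem HasFT.sub (h : HasFT U k) (h' : HasFT U' k') : HasFT (U - U') (fun ξ => k ξ - k' ξ) where
  integrable Θ := by
    simpa only [mul_sub] using! (h.integrable Θ).sub (h'.integrable Θ)
  eq Θ := by
    simp only [mul_sub]
    rw [integral_sub (h.integrable Θ) (h'.integrable Θ), ← h.eq, ← h'.eq]
    rfl

theorem HasFT.zero : HasFT (0 : 𝓢'(V, ℂ)) (fun _ => 0) where
  integrable Θ := by simp
  eq Θ := by simp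

theorem HasFT.mult (h : HasFT U k) {g : V → ℂ} (hg : g.HasTemperateGrowth) :
    HasFT (fourierMultiplierCLM ℂ g U) (fun ξ => g ξ * k ξ) where
  integrable Θ := by
    have := h.integrable (SchwartzMap.smulLeftCLM ℂ g Θ)
    refine this.congr (ae_of_all _ fun ξ => ?_)
    simp only [SchwartzMap.smulLeftCLM_apply_apply hg, smul_eq_mul]
    ring
  eq Θ := by
    rw [fourierMultiplierCLM_apply_apply, fourierInv_fourier_eq, h.eq]
    refine integral_congr_ae (ae_of_all _ fun ξ => ?_)
    simp only [SchwartzMap.smulLeftCLM_apply_apply hg, smul_eq_mul]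
    ring

theorem hasFT_toLp (h : Lp ℂ 2 (volume : Measure V)) :
    HasFT (h : 𝓢'(V, ℂ)) ((𝓕 h : Lp ℂ 2 (volume : Measure V)) : V → ℂ) where
  integrable Θ := MemLp.integrable_mul (p := 2) (q := 2) (Θ.memLp 2 volume) (Lp.memLp _)
  eq Θ := by
    rw [← TemperedDistribution.fourier_apply, Lp.fourier_toTemperedDistribution_eq,
      Lp.toTemperedDistribution_apply]
    rfl

theorem HasFT.exists_toLp (h : HasFT U k) (hk : MemLp k 2) :
    ∃ f : Lp ℂ 2 (volume : Measure V), U = f ∧ ‖f‖ₑ = eLpNorm k 2 := by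
  refine ⟨𝓕⁻ (hk.toLp k), ?_, ?_⟩
  · have h1 := hasFT_toLp (𝓕⁻ (hk.toLp k))
    rw [fourier_fourierInv_eq] at h1
    refine h.unique ⟨h.integrable, fun Θ => ?_⟩
    rw [h1.eq]
    refine integral_congr_ae ?_
    filter_upwards [hk.coeFn_toLp] with ξ hξ
    rw [hξ]
  · have h1 : ‖(𝓕⁻ (hk.toLp k) : Lp ℂ 2 (volume : Measure V))‖ = ‖hk.toLp k‖ := by
      rw [← Lp.norm_fourier_eq (𝓕⁻ (hk.toLp k)), fourier_fourierInv_eq]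
    rw [← ofReal_norm, h1, ofReal_norm, Lp.enorm_toLp]

theorem memLp_fourier_toLp (h : Lp ℂ 2 (volume : Measure V)) :
    MemLp ((𝓕 h : Lp ℂ 2 (volume : Measure V)) : V → ℂ) 2 := Lp.memLp _

theorem eLpNorm_fourier_toLp (h : Lp ℂ 2 (volume : Measure V)) :
    eLpNorm ((𝓕 h : Lp ℂ 2 (volume : Measure V)) : V → ℂ) 2 = ‖h‖ₑ := by
  rw [← Lp.enorm_def, ← ofReal_norm, Lp.norm_fourier_eq, ofReal_norm]

theorem exists_hasFT_of_besselPotential {s : ℝ} {f : Lp ℂ 2 (volume : Measure V)}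
    (hf : besselPotential V ℂ s U = f) :
    ∃ k, HasFT U k ∧ MemLp (fun ξ => (bessel s ξ : ℂ) * k ξ) 2 ∧
      eLpNorm (fun ξ => (bessel s ξ : ℂ) * k ξ) 2 = ‖f‖ₑ := by
  have hU : U = besselPotential V ℂ (-s) f := by
    rw [eq_comm, besselPotential_neg_apply_eq_iff, hf]
  refine ⟨_, hU ▸ (hasFT_toLp f).mult (hasTemperateGrowth_bessel (-s)), ?_⟩
  have h : (fun ξ => (bessel s ξ : ℂ) * ((bessel (-s) ξ : ℂ) *
      ((𝓕 f : Lp ℂ 2 (volume : Measure V)) : V → ℂ) ξ)) =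
      ((𝓕 f : Lp ℂ 2 (volume : Measure V)) : V → ℂ) := by
    ext ξ
    rw [← mul_assoc, ← Complex.ofReal_mul, ← bessel_add]
    simp [bessel]
  rw [h]
  exact ⟨memLp_fourier_toLp f, eLpNorm_fourier_toLp f⟩

theorem HasFT.besselPotential_eq (h : HasFT U k) {s : ℝ}
    (hk : MemLp (fun ξ => (bessel s ξ : ℂ) * k ξ) 2) :
    ∃ f : Lp ℂ 2 (volume : Measure V), besselPotential V ℂ s U = f ∧
      ‖f‖ₑ = eLpNorm (fun ξ => (bessel s ξ : ℂ) * k ξ) 2 :=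
  (h.mult (hasTemperateGrowth_bessel s)).exists_toLp hk

theorem HasFT.memSobolev (h : HasFT U k) {s : ℝ}
    (hk : MemLp (fun ξ => (bessel s ξ : ℂ) * k ξ) 2) : MemSobolev s 2 U :=
  let ⟨f, hf, _⟩ := h.besselPotential_eq hk
  ⟨f, hf⟩

theorem HasFT.sobolevENorm_le (h : HasFT U k) {s : ℝ}
    (hk : MemLp (fun ξ => (bessel s ξ : ℂ) * k ξ) 2) :
    sobolevENorm s U ≤ eLpNorm (fun ξ => (bessel s ξ : ℂ) * k ξ) 2 := by
  obtain ⟨f, hf, hn⟩ := h.besselPotential_eq hk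
  exact (iInf₂_le f hf).trans hn.le

theorem exists_hasFT_of_memSobolev {s : ℝ} (h : MemSobolev s 2 U) :
    ∃ k, HasFT U k ∧ MemLp (fun ξ => (bessel s ξ : ℂ) * k ξ) 2 := by
  obtain ⟨f, hf⟩ := h
  obtain ⟨k, h1, h2, _⟩ := exists_hasFT_of_besselPotential hf
  exact ⟨k, h1, h2⟩

theorem exists_hasFT_of_sobolevENorm_lt {s : ℝ} {r : ℝ≥0∞} (h : sobolevENorm s U < r) :
    ∃ k, HasFT U k ∧ MemLp (fun ξ => (bessel s ξ : ℂ) * k ξ) 2 ∧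
      eLpNorm (fun ξ => (bessel s ξ : ℂ) * k ξ) 2 < r := by
  simp only [sobolevENorm, iInf_lt_iff] at h
  obtain ⟨f, hf, hr⟩ := h
  obtain ⟨k, h1, h2, h3⟩ := exists_hasFT_of_besselPotential hf
  exact ⟨k, h1, h2, h3 ▸ hr⟩

theorem exists_hasFT_of_sobolevRestrENorm_lt {Ω : TopologicalSpace.Opens V} {s : ℝ} {r : ℝ≥0∞}
    {g : 𝓓'(Ω, ℂ)} (h : sobolevRestrENorm Ω s g < r) :
    ∃ G k, restr Ω G = g ∧ HasFT G k ∧ MemLp (fun ξ => (bessel s ξ : ℂ) * k ξ) 2 ∧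
      eLpNorm (fun ξ => (bessel s ξ : ℂ) * k ξ) 2 < r := by
  simp only [sobolevRestrENorm, iInf_lt_iff] at h
  obtain ⟨G, hG, hr⟩ := h
  obtain ⟨k, h1, h2, h3⟩ := exists_hasFT_of_sobolevENorm_lt hr
  exact ⟨G, k, hG, h1, h2, h3⟩

end HasFT

/-! ### Comparison of the weights with and without the factor 2π -/

section Weights

theorem four_le_two_pi_sq : (1 : ℝ) ≤ (2 * Real.pi) ^ 2 := by
  nlinarith [Real.pi_gt_three]

theorem bessel_le_fjap {d : ℕ} {s : ℝ} (hs : 0 ≤ s) (ξ : Full d) : bessel s ξ ≤ fjap ξ ^ s := by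
  rw [fjap_rpow, bessel]
  refine Real.rpow_le_rpow (by positivity) ?_ (by linarith)
  rw [norm_smul, mul_pow, Real.norm_eq_abs, sq_abs]
  nlinarith [four_le_two_pi_sq, sq_nonneg ‖ξ‖]

theorem fjap_le_bessel {d : ℕ} {s : ℝ} (hs : 0 ≤ s) (ξ : Full d) :
    fjap ξ ^ s ≤ (2 * Real.pi) ^ s * bessel s ξ := by
  have h0 : (2 * Real.pi) ^ s = ((2 * Real.pi) ^ 2) ^ (s / 2) := by
    rw [← Real.rpow_natCast, ← Real.rpow_mul (by positivity)]
    congr 1; push_cast; ring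
  rw [fjap_rpow, bessel, h0, ← Real.mul_rpow (by positivity) (by positivity)]
  refine Real.rpow_le_rpow (by positivity) ?_ (by linarith)
  rw [norm_smul, mul_pow, Real.norm_eq_abs, sq_abs]
  nlinarith [four_le_two_pi_sq, sq_nonneg ‖ξ‖]

theorem bessel_le_jap {d : ℕ} {s : ℝ} (hs : 0 ≤ s) (y : Bdry d) : bessel s y ≤ jap y ^ s := by
  rw [jap_rpow, bessel]
  refine Real.rpow_le_rpow (by positivity) ?_ (by linarith)
  rw [norm_smul, mul_pow, Real.norm_eq_abs, sq_abs]
  nlinarith [four_le_two_pi_sq, sq_nonneg ‖y‖]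

theorem jap_le_bessel {d : ℕ} {s : ℝ} (hs : 0 ≤ s) (y : Bdry d) :
    jap y ^ s ≤ (2 * Real.pi) ^ s * bessel s y := by
  have h0 : (2 * Real.pi) ^ s = ((2 * Real.pi) ^ 2) ^ (s / 2) := by
    rw [← Real.rpow_natCast, ← Real.rpow_mul (by positivity)]
    congr 1; push_cast; ring
  rw [jap_rpow, bessel, h0, ← Real.mul_rpow (by positivity) (by positivity)]
  refine Real.rpow_le_rpow (by positivity) ?_ (by linarith)
  rw [norm_smul, mul_pow, Real.norm_eq_abs, sq_abs]
  nlinarith [four_le_two_pi_sq, sq_nonneg ‖y‖]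

end Weights


/-! ### The partial Fourier transform in the tangential variables -/

section PartialFourier

open FourierTransform

variable {d : ℕ} {F : Type*} [NormedAddCommGroup F] [NormedSpace ℂ F]

/-- Rapid decay of a Schwartz function in both variables. -/
theorem exists_norm_mk_le (B : 𝓢(Full d, F)) {r s : ℝ} (hr : 0 ≤ r) (hs : 0 ≤ s) :
    ∃ C, 0 ≤ C ∧ ∀ y t, ‖B (mk y t)‖ ≤ C * ((1 + ‖y‖) ^ (-r) * (1 + |t|) ^ (-s)) := by
  obtain ⟨N, hN⟩ := exists_nat_ge (r + s)
  let C := 2 ^ N * ((Finset.Iic (N, 0)).sup fun m => SchwartzMap.seminorm ℝ m.1 m.2) B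
  refine ⟨C, by positivity, fun y t => ?_⟩
  have h := SchwartzMap.one_add_le_sup_seminorm_apply (𝕜 := ℝ) (m := (N, 0)) le_rfl le_rfl B
    (mk y t)
  rw [norm_iteratedFDeriv_zero] at h
  have h1 : (1 + ‖y‖) ^ r * (1 + |t|) ^ s ≤ (1 + ‖mk y t‖) ^ N := by
    have hy : ‖y‖ ≤ ‖mk y t‖ := by simpa using norm_tang_le (mk y t)
    have ht : |t| ≤ ‖mk y t‖ := by simpa using abs_normal_le (mk y t)
    calc (1 + ‖y‖) ^ r * (1 + |t|) ^ s ≤ (1 + ‖mk y t‖) ^ r * (1 + ‖mk y t‖) ^ s := by gcongr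
      _ = (1 + ‖mk y t‖) ^ (r + s) := (Real.rpow_add (by positivity) _ _).symm
      _ ≤ (1 + ‖mk y t‖) ^ (N : ℝ) :=
        Real.rpow_le_rpow_of_exponent_le (by linarith [norm_nonneg (mk y t)]) hN
      _ = _ := Real.rpow_natCast _ _
  rw [Real.rpow_neg (by positivity), Real.rpow_neg (by positivity), ← mul_inv, ← div_eq_mul_inv,
    le_div_iff₀ (by positivity), mul_comm]
  calc _ ≤ (1 + ‖mk y t‖) ^ N * ‖B (mk y t)‖ := by gcongr
    _ ≤ C := h

theorem exists_norm_mk_le' (B : 𝓢(Full d, F)) : ∃ (C r : ℝ), 0 ≤ C ∧ 0 ≤ r ∧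
    Integrable (fun y : Bdry d => C * (1 + ‖y‖) ^ (-r)) ∧
    ∀ y t, ‖B (mk y t)‖ ≤ C * (1 + ‖y‖) ^ (-r) := by
  obtain ⟨C, hC, h⟩ := exists_norm_mk_le B (r := Module.finrank ℝ (Bdry d) + 1) (s := 0)
    (by positivity) le_rfl
  refine ⟨C, Module.finrank ℝ (Bdry d) + 1, hC, by positivity, ?_, fun y t => ?_⟩
  · exact (integrable_one_add_norm (by linarith)).const_mul _
  · simpa using h y t

theorem hasTemperateGrowth_mk_left (t : ℝ) : (fun y : Bdry d => mk y t).HasTemperateGrowth := by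
  simp only [mk_eq_add]
  exact (horEmb d).hasTemperateGrowth.add (.const _)

theorem hasTemperateGrowth_mk_right (y : Bdry d) : (fun t : ℝ => mk y t).HasTemperateGrowth := by
  simp only [mk_eq_add]
  exact (Function.HasTemperateGrowth.const _).add (vertEmb d).hasTemperateGrowth

/-- The restriction of a Schwartz function to the hyperplane `x_n = t`. -/
def slice (t : ℝ) : 𝓢(Full d, F) →L[ℂ] 𝓢(Bdry d, F) :=
  SchwartzMap.compCLM ℂ (hasTemperateGrowth_mk_left t) ⟨1, 1, fun y => by
    have : ‖y‖ ≤ ‖mk y t‖ := by simpa using norm_tang_le (mk y t)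
    linarith⟩

/-- The restriction of a Schwartz function to the line `x' = y`. -/
def vslice (y : Bdry d) : 𝓢(Full d, F) →L[ℂ] 𝓢(ℝ, F) :=
  SchwartzMap.compCLM ℂ (hasTemperateGrowth_mk_right y) ⟨1, 1, fun t => by
    have : |t| ≤ ‖mk y t‖ := by simpa using abs_normal_le (mk y t)
    rw [Real.norm_eq_abs]; linarith⟩

@[simp] theorem slice_apply (t : ℝ) (B : 𝓢(Full d, F)) (y : Bdry d) :
    slice t B y = B (mk y t) := rfl

@[simp] theorem vslice_apply (y : Bdry d) (B : 𝓢(Full d, F)) (t : ℝ) :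
    vslice y B t = B (mk y t) := rfl

/-- Both ‖y‖ and |t| are at most ‖(y, t)‖, so a power of |t| is absorbed by raising the weight. This
decay of the slices in t gives the joint decay of the partial Fourier transform. -/
theorem seminorm_slice_le (k l n : ℕ) (B : 𝓢(Full d, F)) (t : ℝ) :
    |t| ^ l * SchwartzMap.seminorm ℂ k n (slice t B) ≤ SchwartzMap.seminorm ℂ (k + l) n B := by
  have key : ∀ y, ‖y‖ ^ k * ‖iteratedFDeriv ℝ n (slice t B) y‖ * |t| ^ l ≤
      SchwartzMap.seminorm ℂ (k + l) n B := by
    intro y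
    have hy : ‖y‖ ≤ ‖mk y t‖ := by simpa using norm_tang_le (mk y t)
    have ht : |t| ≤ ‖mk y t‖ := by simpa using abs_normal_le (mk y t)
    have h1 : (slice t B : Bdry d → F) = (fun x => B (x + vertEmb d t)) ∘ horEmb d := by
      ext y
      change B (mk y t) = B (horEmb d y + vertEmb d t)
      rw [← mk_eq_add]
    have h2 : ‖iteratedFDeriv ℝ n (slice t B) y‖ ≤ ‖iteratedFDeriv ℝ n B (mk y t)‖ := by
      have hs : ContDiff ℝ n fun x => B (x + vertEmb d t) :=
        (B.smooth n).comp (contDiff_id.add contDiff_const)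
      rw [h1, ContinuousLinearMap.iteratedFDeriv_comp_right (n := n) (horEmb d) hs y le_rfl,
        iteratedFDeriv_comp_add_right, ← mk_eq_add]
      refine (ContinuousMultilinearMap.norm_compContinuousLinearMap_le _ _).trans ?_
      have h3 : ‖horEmb d‖ ≤ 1 := by
        refine ContinuousLinearMap.opNorm_le_bound _ zero_le_one fun x => ?_
        have := norm_mk_sq x 0
        rw [one_mul, horEmb_apply]
        exact (pow_le_pow_iff_left₀ (norm_nonneg _) (norm_nonneg _) two_ne_zero).1 (by linarith)
      calc _ ≤ ‖iteratedFDeriv ℝ n B (mk y t)‖ * 1 := by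
            gcongr
            exact Finset.prod_le_one (fun _ _ => norm_nonneg _) (fun _ _ => h3)
        _ = _ := mul_one _
    calc _ ≤ ‖mk y t‖ ^ k * ‖iteratedFDeriv ℝ n B (mk y t)‖ * ‖mk y t‖ ^ l := by gcongr
      _ = ‖mk y t‖ ^ (k + l) * ‖iteratedFDeriv ℝ n B (mk y t)‖ := by ring
      _ ≤ _ := SchwartzMap.le_seminorm ℂ (k + l) n B _
  rcases eq_or_lt_of_le (pow_nonneg (abs_nonneg t) l) with h0 | h0
  · rw [← h0, zero_mul]; positivity
  · rw [mul_comm, ← le_div_iff₀ h0]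
    refine SchwartzMap.seminorm_le_bound ℂ k n _ (by positivity) fun y => ?_
    rw [le_div_iff₀ h0]
    exact key y

/-- The partial Fourier transform in the tangential variables, as a function. -/
def partialFourierFun (B : 𝓢(Full d, F)) (z : Full d) : F := 𝓕 (slice (normal d z) B) (tang d z)

theorem partialFourierFun_eq (B : 𝓢(Full d, F)) (z : Full d) : partialFourierFun B z =
    ∫ y, Complex.exp (((-2 * Real.pi * inner ℝ y (tang d z) : ℝ) : ℂ) * Complex.I) •
      B (mk y (normal d z)) := by
  rw [partialFourierFun, SchwartzMap.fourier_coe, Real.fourier_eq']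
  rfl

/-- Continuity of the Fourier transform on Schwartz space bounds the tangential decay by finitely
many seminorms of the slice, and each of these decays in x_n to any order. -/
theorem exists_pow_mul_partialFourierFun_le (B : 𝓢(Full d, F)) (k : ℕ) :
    ∃ C, ∀ z, ‖z‖ ^ k * ‖partialFourierFun B z‖ ≤ C := by
  have key : ∀ k l : ℕ, ∃ C, ∀ z, ‖tang d z‖ ^ k * |normal d z| ^ l * ‖partialFourierFun B z‖ ≤ C := by
    intro k l
    let q : Seminorm ℂ 𝓢(Bdry d, F) :=
      (SchwartzMap.seminorm ℂ k 0).comp (fourierCLM ℂ 𝓢(Bdry d, F)).toLinearMap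
    have hq : Continuous q :=
      ((schwartz_withSeminorms ℂ (Bdry d) F).continuous_seminorm (k, 0)).comp
        (fourierCLM ℂ 𝓢(Bdry d, F)).continuous
    obtain ⟨s, C, -, hC⟩ := Seminorm.bound_of_continuous
      (schwartz_withSeminorms ℂ (Bdry d) F) q hq
    refine ⟨C * ∑ i ∈ s, SchwartzMap.seminorm ℂ (i.1 + l) i.2 B, fun z => ?_⟩
    set t := normal d z
    have h1 : ‖tang d z‖ ^ k * ‖partialFourierFun B z‖ ≤ q (slice t B) := by
      have := SchwartzMap.le_seminorm ℂ k 0 (𝓕 (slice t B)) (tang d z)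
      rwa [norm_iteratedFDeriv_zero] at this
    have h2 : q (slice t B) ≤ C * ∑ i ∈ s, SchwartzMap.seminorm ℂ i.1 i.2 (slice t B) := by
      refine (hC (slice t B)).trans ?_
      have := Seminorm.finset_sup_le_sum (schwartzSeminormFamily ℂ (Bdry d) F) s (slice t B)
      rw [smul_apply, NNReal.smul_def, smul_eq_mul]
      gcongr
      refine this.trans (le_of_eq ?_)
      rw [_root_.sum_apply]
      rfl
    calc _ = |t| ^ l * (‖tang d z‖ ^ k * ‖partialFourierFun B z‖) := by ring
      _ ≤ |t| ^ l * (C * ∑ i ∈ s, SchwartzMap.seminorm ℂ i.1 i.2 (slice t B)) := by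
          exact mul_le_mul_of_nonneg_left (h1.trans h2) (by positivity)
      _ = C * ∑ i ∈ s, |t| ^ l * SchwartzMap.seminorm ℂ i.1 i.2 (slice t B) := by
          rw [Finset.mul_sum, Finset.mul_sum, Finset.mul_sum]
          exact Finset.sum_congr rfl fun i _ => by ring
      _ ≤ _ := by
          gcongr with i _
          exact seminorm_slice_le _ _ _ _ _
  obtain ⟨C1, h1⟩ := key k 0
  obtain ⟨C2, h2⟩ := key 0 k
  refine ⟨2 ^ k * (C1 + C2), fun z => ?_⟩
  have h3 : ‖z‖ ≤ ‖tang d z‖ + |normal d z| := by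
    refine abs_le_of_sq_le_sq' ?_ (by positivity) |>.2
    rw [norm_sq_eq_tang_normal, add_sq, sq_abs]
    nlinarith [mul_nonneg (norm_nonneg (tang d z)) (abs_nonneg (normal d z))]
  have h4 : ‖z‖ ^ k ≤ 2 ^ k * (‖tang d z‖ ^ k + |normal d z| ^ k) := by
    calc ‖z‖ ^ k ≤ (‖tang d z‖ + |normal d z|) ^ k := by gcongr
      _ ≤ 2 ^ (k - 1) * (‖tang d z‖ ^ k + |normal d z| ^ k) :=
        add_pow_le (norm_nonneg _) (abs_nonneg _) k
      _ ≤ _ := by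
        gcongr
        · norm_num
        · exact Nat.sub_le k 1
  have h1' := h1 z
  have h2' := h2 z
  simp only [pow_zero, mul_one, one_mul] at h1' h2'
  calc _ ≤ 2 ^ k * (‖tang d z‖ ^ k + |normal d z| ^ k) * ‖partialFourierFun B z‖ := by gcongr
    _ = 2 ^ k * (‖tang d z‖ ^ k * ‖partialFourierFun B z‖ +
        |normal d z| ^ k * ‖partialFourierFun B z‖) := by ring
    _ ≤ _ := by gcongr

/-- The Schwartz function whose partial Fourier transform is the derivative of the partial
Fourier transform of `B`. -/
def partialFourierDeriv (B : 𝓢(Full d, F)) : 𝓢(Full d, Full d →L[ℝ] F) :=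
  (-(2 * Real.pi * Complex.I)) •
    SchwartzMap.smulRightCLM ℂ F ((innerSL ℝ).bilinearComp (tang d) (tang d)) B +
  SchwartzMap.postcompCLM
    (((ContinuousLinearMap.compL ℝ (Full d) (Full d) F).flip ((vertEmb d).comp (normal d))))
    (SchwartzMap.fderivCLM ℝ (Full d) F B)

theorem partialFourierDeriv_apply (B : 𝓢(Full d, F)) (z : Full d) : partialFourierDeriv B z =
    (-(2 * Real.pi * Complex.I)) •
      ((innerSL ℝ (tang d z)).comp (tang d)).smulRight (B z) +
    (fderiv ℝ B z).comp ((vertEmb d).comp (normal d)) := by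
  rfl

end PartialFourier


section PartialFourier

open FourierTransform

variable {d : ℕ} {F : Type*} [NormedAddCommGroup F] [NormedSpace ℂ F]

theorem hasFDerivAt_partialFourierFun [CompleteSpace F] (B : 𝓢(Full d, F)) (z : Full d) :
    HasFDerivAt (partialFourierFun B) (partialFourierFun (partialFourierDeriv B) z) z := by
  set B1 := partialFourierDeriv B with hB1
  obtain ⟨C, r, -, -, hint, hC⟩ := exists_norm_mk_le' B1
  obtain ⟨C0, r0, -, -, hint0, hC0⟩ := exists_norm_mk_le' B
  have hnorm : ∀ (x : ℝ), ‖Complex.exp ((x : ℂ) * Complex.I)‖ = 1 :=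
    Complex.norm_exp_ofReal_mul_I
  have hmk : ∀ z : Full d, Continuous fun y : Bdry d => mk y (normal d z) := fun z => by fun_prop
  have hexp : ∀ z : Full d, Continuous fun y : Bdry d =>
      Complex.exp (((-2 * Real.pi * inner ℝ y (tang d z) : ℝ) : ℂ) * Complex.I) := fun z => by
    fun_prop
  have key := hasFDerivAt_integral_of_dominated_of_fderiv_le (𝕜 := ℝ) (μ := volume)
    (F := fun (z : Full d) (y : Bdry d) =>
      Complex.exp (((-2 * Real.pi * inner ℝ y (tang d z) : ℝ) : ℂ) * Complex.I) •
        B (mk y (normal d z)))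
    (F' := fun (z : Full d) (y : Bdry d) =>
      Complex.exp (((-2 * Real.pi * inner ℝ y (tang d z) : ℝ) : ℂ) * Complex.I) •
        B1 (mk y (normal d z)))
    (x₀ := z) (s := Set.univ) (bound := fun y => C * (1 + ‖y‖) ^ (-r)) univ_mem
    (Eventually.of_forall fun z =>
      ((hexp z).smul (B.continuous.comp (hmk z))).aestronglyMeasurable)
    (by
      refine hint0.mono' ((hexp z).smul (B.continuous.comp (hmk z))).aestronglyMeasurable
        (ae_of_all _ fun y => ?_)
      rw [norm_smul, hnorm, one_mul]
      exact hC0 y _)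
    ((hexp z).smul (B1.continuous.comp (hmk z))).aestronglyMeasurable
    (ae_of_all _ fun y z _ => by
      rw [norm_smul, hnorm, one_mul]
      exact hC y _)
    hint
    (ae_of_all _ fun y z _ => by
      let ℓ : Full d →L[ℝ] ℝ := (innerSL ℝ y).comp (tang d)
      have h1 : HasFDerivAt (fun z : Full d =>
          (((-2 * Real.pi * inner ℝ y (tang d z) : ℝ) : ℂ) * Complex.I))
          (((-2 * Real.pi) • (Complex.ofRealCLM.comp ℓ)).smulRight Complex.I) z := by
        have h2 := (((-2 * Real.pi) • (Complex.ofRealCLM.comp ℓ)).smulRight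
          Complex.I).hasFDerivAt (x := z)
        convert! h2 using 1
        ext z
        simp [ℓ]
      have h3 : HasFDerivAt (fun z : Full d => B (mk y (normal d z)))
          ((fderiv ℝ B (mk y (normal d z))).comp ((vertEmb d).comp (normal d))) z := by
        have h4 : HasFDerivAt (fun z : Full d => mk y (normal d z))
            ((vertEmb d).comp (normal d)) z := by
          simp only [mk_eq_add y]
          exact ((vertEmb d).comp (normal d)).hasFDerivAt.const_add _
        exact (B.hasFDerivAt _).comp z h4
      convert! h1.cexp.smul h3 using 1
      rw [hB1, partialFourierDeriv_apply]
      ext v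
      simp only [smul_apply, add_apply, smul_add,
        ContinuousLinearMap.smulRight_apply, ContinuousLinearMap.comp_apply, tang_mk, ℓ]
      rw [add_comm]
      congr 1
      simp only [innerSL_apply_apply, Complex.ofRealCLM_apply, ← Complex.coe_smul, smul_smul,
        smul_eq_mul]
      congr 1
      push_cast
      ring)
  have h0 : partialFourierFun B = fun z => _ := funext (partialFourierFun_eq B)
  rw [h0, partialFourierFun_eq]
  exact key

/-- Partial Fourier transforms are closed under differentiation, but the derivative takes values in
a larger space; the induction therefore runs over all target spaces at once. -/
theorem contDiff_partialFourierFun [CompleteSpace F] (B : 𝓢(Full d, F)) :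
    ContDiff ℝ (⊤ : ℕ∞) (partialFourierFun B) := by
  have key : ∀ (n : ℕ) {F : Type _} [NormedAddCommGroup F] [NormedSpace ℂ F] [CompleteSpace F]
      (B : 𝓢(Full d, F)), ContDiff ℝ n (partialFourierFun B) := by
    intro n
    induction n with
    | zero =>
      intro F _ _ _ B
      rw [Nat.cast_zero, contDiff_zero, continuous_iff_continuousAt]
      exact fun z => (hasFDerivAt_partialFourierFun B z).continuousAt
    | succ n ih =>
      intro F _ _ _ B
      rw [Nat.cast_succ, contDiff_succ_iff_hasFDerivAt]
      exact ⟨_, ih (partialFourierDeriv B), hasFDerivAt_partialFourierFun B⟩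
  exact contDiff_infty.2 fun n => key n B

theorem exists_pow_mul_iteratedFDeriv_partialFourierFun_le [CompleteSpace F] (k n : ℕ) :
    ∀ (B : 𝓢(Full d, F)),
    ∃ C, ∀ z, ‖z‖ ^ k * ‖iteratedFDeriv ℝ n (partialFourierFun B) z‖ ≤ C := by
  induction n generalizing F with
  | zero =>
    intro B
    simpa using exists_pow_mul_partialFourierFun_le B k
  | succ n ih =>
    intro B
    obtain ⟨C, hC⟩ := ih (partialFourierDeriv B)
    refine ⟨C, fun z => ?_⟩
    have h : fderiv ℝ (partialFourierFun B) = partialFourierFun (partialFourierDeriv B) :=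
      funext fun z => (hasFDerivAt_partialFourierFun B z).fderiv
    rw [← norm_iteratedFDeriv_fderiv, h]
    exact hC z

/-- The partial Fourier transform in the tangential variables. -/
def partialFourier (B : 𝓢(Full d, ℂ)) : 𝓢(Full d, ℂ) where
  toFun := partialFourierFun B
  smooth' := contDiff_partialFourierFun B
  decay' k n := exists_pow_mul_iteratedFDeriv_partialFourierFun_le k n B

theorem partialFourier_mk (B : 𝓢(Full d, ℂ)) (η : Bdry d) (t : ℝ) :
    partialFourier B (mk η t) = 𝓕 (slice t B) η := by
  change partialFourierFun B (mk η t) = _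
  simp [partialFourierFun]

theorem slice_partialFourier (B : 𝓢(Full d, ℂ)) (t : ℝ) :
    slice t (partialFourier B) = 𝓕 (slice t B) := by
  ext η
  rw [slice_apply, partialFourier_mk]

/-- The reflection `x' ↦ -x'`. -/
def tangReflect (d : ℕ) : Full d ≃L[ℝ] Full d :=
  LinearEquiv.toContinuousLinearEquiv
    { toFun := fun x => mk (-tang d x) (normal d x)
      invFun := fun x => mk (-tang d x) (normal d x)
      left_inv := fun x => by simp
      right_inv := fun x => by simp
      map_add' := fun x y => by simp only [map_add, neg_add, mk_add]
      map_smul' := fun c x => by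
        simp only [map_smul, ← smul_neg, smul_eq_mul, mk_smul, RingHom.id_apply] }

/-- The inverse of the partial Fourier transform. -/
def partialFourierInv (B : 𝓢(Full d, ℂ)) : 𝓢(Full d, ℂ) :=
  SchwartzMap.compCLMOfContinuousLinearEquiv ℂ (tangReflect d) (partialFourier B)

theorem slice_partialFourierInv (B : 𝓢(Full d, ℂ)) (t : ℝ) :
    slice t (partialFourierInv B) = 𝓕⁻ (slice t B) := by
  ext η
  rw [slice_apply, SchwartzMap.fourierInv_coe, Real.fourierInv_eq_fourier_neg,
    ← SchwartzMap.fourier_coe, ← partialFourier_mk]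
  change partialFourier B (mk (-tang d (mk η t)) (normal d (mk η t))) = _
  simp

theorem slice_ext {A B : 𝓢(Full d, ℂ)} (h : ∀ t, slice t A = slice t B) : A = B := by
  ext z
  rw [← mk_tang_normal z, ← slice_apply, ← slice_apply, h]

theorem partialFourier_partialFourierInv (B : 𝓢(Full d, ℂ)) :
    partialFourier (partialFourierInv B) = B :=
  slice_ext fun t => by
    rw [slice_partialFourier, slice_partialFourierInv, fourier_fourierInv_eq]

/-- The Fourier transform factors through the partial Fourier transform. -/
theorem fourier_mk (B : 𝓢(Full d, ℂ)) (η : Bdry d) (τ : ℝ) :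
    𝓕 B (mk η τ) = 𝓕 (vslice η (partialFourier B)) τ := by
  have hi : Integrable fun p : Bdry d × ℝ =>
      Complex.exp (((-2 * Real.pi * inner ℝ (mk p.1 p.2) (mk η τ) : ℝ) : ℂ) * Complex.I) •
        B (mk p.1 p.2) := by
    refine ((integrable_iff_mk.1 (B.integrable (μ := volume)))).mono ?_ (ae_of_all _ fun p => ?_)
    · refine Continuous.aestronglyMeasurable ?_
      have := B.continuous
      fun_prop
    · rw [norm_smul, Complex.norm_exp_ofReal_mul_I, one_mul]
  rw [SchwartzMap.fourier_coe, SchwartzMap.fourier_coe, Real.fourier_eq', Real.fourier_eq',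
    integral_eq_integral_mk (integrable_iff_mk.2 hi), integral_integral_swap hi]
  refine integral_congr_ae (ae_of_all _ fun t => ?_)
  simp only [vslice_apply, partialFourier_mk, SchwartzMap.fourier_coe, Real.fourier_eq',
    slice_apply]
  rw [← integral_smul]
  refine integral_congr_ae (ae_of_all _ fun y => ?_)
  simp only [smul_smul, ← Complex.exp_add, inner_eq_tang_normal, tang_mk, normal_mk]
  congr 2
  simp
  ring

end PartialFourier


/-! ### Multipliers preserving supports in half-spaces -/

section HalfLine

open FourierTransform Set
open scoped LineDeriv

variable {d : ℕ}

section Inversion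

variable {V : Type*} [NormedAddCommGroup V] [InnerProductSpace ℝ V] [FiniteDimensional ℝ V]
  [MeasurableSpace V] [BorelSpace V]

theorem schwartz_fourier_fourierInv (k : 𝓢(V, ℂ)) : 𝓕 (𝓕⁻ k : 𝓢(V, ℂ)) = k :=
  fourier_fourierInv_eq k

theorem schwartz_fourierInv_fourier (k : 𝓢(V, ℂ)) : 𝓕⁻ (𝓕 k : 𝓢(V, ℂ)) = k :=
  fourierInv_fourier_eq k

theorem schwartz_ext_fourierInv {k l : 𝓢(V, ℂ)} (h : ∀ ξ, 𝓕⁻ l ξ = 𝓕⁻ k ξ) : l = k := by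
  rw [← schwartz_fourier_fourierInv l, ← schwartz_fourier_fourierInv k]
  congr 1
  ext ξ
  exact h ξ

end Inversion

/-- Convolution with the Fourier transform of `b^τ` preserves Schwartz functions on the line
vanishing on `{ε x ≤ 0}`; here `b = base (-ε) (mk η ·)`. -/
def PreservesHalfLine (ε : ℝ) (η : Bdry d) (τ : ℝ) : Prop :=
  ∀ k l : 𝓢(ℝ, ℂ), (∀ ξ, 𝓕⁻ l ξ = lam (-ε) τ (mk η ξ) * 𝓕⁻ k ξ) →
    (∀ x, ε * x ≤ 0 → k x = 0) → ∀ x, ε * x ≤ 0 → l x = 0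

theorem preservesHalfLine_zero (ε : ℝ) (η : Bdry d) : PreservesHalfLine ε η 0 := by
  intro k l h hk
  have : l = k := schwartz_ext_fourierInv fun ξ => by simpa using h ξ
  rwa [this]

/-- Exponents add when multipliers are composed; the intermediate function is Schwartz because the
symbol has temperate growth. -/
theorem PreservesHalfLine.add {ε : ℝ} (hε : ε ^ 2 = 1) {η : Bdry d} {τ τ' : ℝ}
    (h : PreservesHalfLine ε η τ) (h' : PreservesHalfLine ε η τ') :
    PreservesHalfLine ε η (τ + τ') := by
  intro k l hl hk
  have ht : (fun ξ : ℝ => lam (-ε) τ (mk η ξ)).HasTemperateGrowth :=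
    (hasTemperateGrowth_lam (by simpa using hε) τ).comp (hasTemperateGrowth_mk_right η)
  refine h' (𝓕 (SchwartzMap.smulLeftCLM ℂ (fun ξ : ℝ => lam (-ε) τ (mk η ξ)) (𝓕⁻ k))) l
    (fun ξ => ?_) (h k _ (fun ξ => ?_) hk)
  · rw [fourierInv_fourier_eq, SchwartzMap.smulLeftCLM_apply_apply ht, hl, lam_add, smul_eq_mul]
    ring
  · rw [fourierInv_fourier_eq, SchwartzMap.smulLeftCLM_apply_apply ht, smul_eq_mul]

/-- For exponent 1 the operator is k ↦ ⟨η⟩k + εk', which is local. The endpoint of the half-line is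
reached by continuity from inside. -/
theorem preservesHalfLine_one {ε : ℝ} (hε : ε ^ 2 = 1) (η : Bdry d) :
    PreservesHalfLine ε η 1 := by
  intro k l hl hk
  have hlk : l = (jap η : ℂ) • k + (ε : ℂ) • ∂_{(1 : ℝ)} k := by
    refine schwartz_ext_fourierInv fun ξ => ?_
    rw [hl, fourierInv_add, fourierInv_smul, fourierInv_smul,
      SchwartzMap.fourierInv_lineDerivOp_eq]
    have ht : (fun x : ℝ => inner ℝ x (1 : ℝ)).HasTemperateGrowth := by fun_prop
    simp only [add_apply, smul_apply,
      SchwartzMap.smulLeftCLM_apply_apply ht, lam_one, base, tang_mk, normal_mk]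
    simp
    ring
  have h0 : ∀ x, ε * x < 0 → l x = 0 := by
    intro x hx
    have hev : k =ᶠ[𝓝 x] fun _ => 0 := by
      have : {y : ℝ | ε * y < 0} ∈ 𝓝 x :=
        (isOpen_lt (by fun_prop) continuous_const).mem_nhds hx
      filter_upwards [this] with y hy using hk y (le_of_lt hy)
    rw [hlk, add_apply, smul_apply, smul_apply,
      SchwartzMap.lineDerivOp_apply_eq_fderiv, hev.fderiv_eq, hk x hx.le]
    simp
  intro x hx
  have hc : Tendsto (fun n : ℕ => l (x - ε * (1 / ((n : ℝ) + 1)))) atTop (𝓝 (l (x - ε * 0))) :=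
    (l.continuous.tendsto _).comp
      ((tendsto_one_div_add_atTop_nhds_zero_nat (𝕜 := ℝ)).const_mul ε |>.const_sub x)
  rw [mul_zero, sub_zero] at hc
  refine tendsto_nhds_unique hc (tendsto_const_nhds.congr fun n => ?_)
  refine (h0 _ ?_).symm
  have : (0 : ℝ) < 1 / ((n : ℝ) + 1) := by positivity
  nlinarith

/-- By the Gamma integral, l(x) is a multiple of ∫₀^∞ y^{r-1} e^{-⟨η⟩y} k(x - εy) dy: a
superposition of translations, each of which maps a point of {εx ≤ 0} to another such point. -/
theorem preservesHalfLine_neg {ε : ℝ} (hε : ε ^ 2 = 1) (η : Bdry d) {r : ℝ} (hr : 0 < r) :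
    PreservesHalfLine ε η (-r) := by
  intro k l hl hk x hx
  set κ : 𝓢(ℝ, ℂ) := 𝓕⁻ k with hκ
  have hΓ : (Real.Gamma r : ℂ) ≠ 0 := by exact_mod_cast (Real.Gamma_pos_of_pos hr).ne'
  have hk0 : ∀ y ∈ Ioi (0 : ℝ), k (x - ε * y) = 0 := fun y hy => hk _ (by
    have hy' : (0 : ℝ) < y := hy
    nlinarith)
  have hk1 : ∀ z, k z = ∫ ξ, Complex.exp (((-2 * Real.pi * (ξ * z) : ℝ) : ℂ) * Complex.I) * κ ξ := by
    intro z
    rw [← schwartz_fourier_fourierInv k, SchwartzMap.fourier_coe, Real.fourier_eq']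
    refine integral_congr_ae (ae_of_all _ fun ξ => ?_)
    simp [mul_comm z, ← hκ]
  have hl1 : ∀ z, l z =
      ∫ ξ, Complex.exp (((-2 * Real.pi * (ξ * z) : ℝ) : ℂ) * Complex.I) *
        (lam (-ε) (-r) (mk η ξ) * κ ξ) := by
    intro z
    rw [← schwartz_fourier_fourierInv l, SchwartzMap.fourier_coe, Real.fourier_eq']
    refine integral_congr_ae (ae_of_all _ fun ξ => ?_)
    simp [mul_comm z, hl]
  have hlam : ∀ ξ : ℝ, (Real.Gamma r : ℂ) * lam (-ε) (-r) (mk η ξ) =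
      ∫ y in Ioi (0 : ℝ), ((y ^ (r - 1) : ℝ) : ℂ) * Complex.exp (-base (-ε) (mk η ξ) * y) := by
    intro ξ
    rw [integral_rpow_mul_cexp hr (base_re_pos _ _), lam]
    push_cast
    rfl
  let G : ℝ → ℝ → ℂ := fun ξ y =>
    Complex.exp (((-2 * Real.pi * (ξ * x) : ℝ) : ℂ) * Complex.I) *
      ((((y ^ (r - 1) : ℝ) : ℂ) * Complex.exp (-base (-ε) (mk η ξ) * y)) * κ ξ)
  have hG : Integrable (Function.uncurry G) (volume.prod (volume.restrict (Ioi 0))) := by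
    have hm : Integrable (fun p : ℝ × ℝ => ‖κ p.1‖ * (p.2 ^ (r - 1) * Real.exp (-jap η * p.2)))
        (volume.prod (volume.restrict (Ioi 0))) :=
      (κ.integrable (μ := volume)).norm.mul_prod
        (integrableOn_rpow_mul_exp_neg_mul hr (jap_pos η))
    refine hm.mono' ?_ ?_
    · have h1 : AEStronglyMeasurable (fun p : ℝ × ℝ => ((p.2 ^ (r - 1) : ℝ) : ℂ))
          (volume.prod (volume.restrict (Ioi 0))) :=
        (Complex.measurable_ofReal.comp (measurable_snd.pow_const _)).aestronglyMeasurable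
      have h2 : Continuous fun p : ℝ × ℝ => base (-ε) (mk η p.1) := by
        unfold base
        simp only [tang_mk, normal_mk]
        fun_prop
      have h3 := κ.continuous
      refine AEStronglyMeasurable.mul (Continuous.aestronglyMeasurable (by fun_prop)) ?_
      refine AEStronglyMeasurable.mul (h1.mul ?_) ?_
      · exact Continuous.aestronglyMeasurable (by fun_prop)
      · exact Continuous.aestronglyMeasurable (by fun_prop)
    · have h4 : ∀ᵐ p : ℝ × ℝ ∂(volume.prod (volume.restrict (Ioi 0))), p.2 ∈ Ioi (0 : ℝ) :=
        Measure.quasiMeasurePreserving_snd.ae (ae_restrict_mem measurableSet_Ioi)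
      filter_upwards [h4] with p hp
      simp only [Function.uncurry, G]
      rw [norm_mul, Complex.norm_exp_ofReal_mul_I, one_mul, norm_mul,
        norm_rpow_mul_cexp r _ hp, base_re, tang_mk, mul_comm]
  have hfin : (Real.Gamma r : ℂ) * l x = 0 := by
    rw [hl1, ← integral_const_mul]
    have h1 : ∀ ξ, (Real.Gamma r : ℂ) *
        (Complex.exp (((-2 * Real.pi * (ξ * x) : ℝ) : ℂ) * Complex.I) *
        (lam (-ε) (-r) (mk η ξ) * κ ξ)) = ∫ y in Ioi (0 : ℝ), G ξ y := by
      intro ξ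
      simp only [G]
      rw [integral_const_mul, integral_mul_const, ← hlam]
      ring
    simp only [h1]
    rw [integral_integral_swap hG]
    have h2 : ∀ y ∈ Ioi (0 : ℝ), ∫ ξ, G ξ y = 0 := by
      intro y hy
      have h3 : ∀ ξ, G ξ y = ((y ^ (r - 1) : ℝ) : ℂ) * Complex.exp (-jap η * y) *
          (Complex.exp (((-2 * Real.pi * (ξ * (x - ε * y)) : ℝ) : ℂ) * Complex.I) * κ ξ) := by
        intro ξ
        simp only [G, base, tang_mk, normal_mk]
        have h4 : Complex.exp (((-2 * Real.pi * (ξ * x) : ℝ) : ℂ) * Complex.I) *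
            Complex.exp (-(jap η + Complex.I * ((-ε * (2 * Real.pi * ξ) : ℝ) : ℂ)) * y) =
            Complex.exp (-jap η * y) *
              Complex.exp (((-2 * Real.pi * (ξ * (x - ε * y)) : ℝ) : ℂ) * Complex.I) := by
          rw [← Complex.exp_add, ← Complex.exp_add]
          congr 1
          push_cast
          ring
        linear_combination (((y ^ (r - 1) : ℝ) : ℂ) * κ ξ) * h4
      simp only [h3]
      rw [integral_const_mul, ← hk1, hk0 y hy, mul_zero]
    rw [setIntegral_congr_fun measurableSet_Ioi h2]
    simp
  exact (mul_eq_zero.1 hfin).resolve_left hΓ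

/-- Any τ equals -(n - τ) + n with a natural number n > τ, so the operator is a superposition of
translations followed by n first-order differential operators. -/
theorem preservesHalfLine {ε : ℝ} (hε : ε ^ 2 = 1) (η : Bdry d) (τ : ℝ) :
    PreservesHalfLine ε η τ := by
  have hN : ∀ n : ℕ, PreservesHalfLine ε η n := by
    intro n
    induction n with
    | zero => simpa using preservesHalfLine_zero ε η
    | succ n ih => simpa using ih.add hε (preservesHalfLine_one hε η)
  obtain ⟨n, hn⟩ := exists_nat_gt τ
  have h := (preservesHalfLine_neg hε η (r := n - τ) (by linarith)).add hε (hN n)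
  convert h using 1
  ring

end HalfLine

/-! ### Distributions vanishing on a half-space, and the multipliers that respect this -/

section Vanishing

open FourierTransform

variable {d : ℕ}

theorem fourierInv_mk (B : 𝓢(Full d, ℂ)) (η : Bdry d) (τ : ℝ) :
    𝓕⁻ B (mk η τ) = 𝓕⁻ (vslice (-η) (partialFourier B)) τ := by
  have h : -(mk η τ) = mk (-η) (-τ) := by
    have := mk_smul (-1) η τ
    simpa using this.symm
  rw [SchwartzMap.fourierInv_coe, Real.fourierInv_eq_fourier_neg, h, ← SchwartzMap.fourier_coe,
    fourier_mk, SchwartzMap.fourierInv_coe, Real.fourierInv_eq_fourier_neg,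
    ← SchwartzMap.fourier_coe]

theorem partialFourier_eq_zero_iff (B : 𝓢(Full d, ℂ)) (t : ℝ) :
    (∀ η, partialFourier B (mk η t) = 0) ↔ ∀ y, B (mk y t) = 0 := by
  constructor
  · intro h y
    have h1 : slice t (partialFourier B) = 0 := by ext η; simpa using h η
    rw [slice_partialFourier] at h1
    have h2 : slice t B = 0 := by
      rw [← schwartz_fourierInv_fourier (slice t B), h1]
      simp
    rw [← slice_apply, h2]; rfl
  · intro h η
    have h1 : slice t B = 0 := by ext y; simpa using h y
    rw [← slice_apply, slice_partialFourier, h1]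
    have := map_zero (fourierCLM ℂ 𝓢(Bdry d, ℂ))
    simp only [fourierCLM_apply] at this
    rw [this]; rfl

/-- `U` vanishes on the open half-space `{ε x_n > 0}`. -/
def Van (ε : ℝ) (U : 𝓢'(Full d, ℂ)) : Prop :=
  ∀ Θ : 𝓢(Full d, ℂ), (∀ x, ε * normal d x ≤ 0 → Θ x = 0) → U Θ = 0

variable {ε : ℝ} {U W : 𝓢'(Full d, ℂ)}

theorem Van.add (hU : Van ε U) (hW : Van ε W) : Van ε (U + W) := fun Θ hΘ => by
  rw [add_apply, hU Θ hΘ, hW Θ hΘ, add_zero]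

theorem Van.sub (hU : Van ε U) (hW : Van ε W) : Van ε (U - W) := fun Θ hΘ => by
  rw [sub_apply, hU Θ hΘ, hW Θ hΘ, sub_zero]

theorem Van.smul (hU : Van ε U) (c : ℂ) : Van ε (c • U) := fun Θ hΘ => by
  rw [smul_apply, hU Θ hΘ, smul_zero]

theorem Van.zero : Van ε (0 : 𝓢'(Full d, ℂ)) := fun _ _ => rfl

/-- A multiplier acting fibrewise as an operator preserving the half-line preserves `Van`. -/
theorem Van.mult_of_fibre (hU : Van ε U) {g : Full d → ℂ} (hg : g.HasTemperateGrowth)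
    (h : ∀ (η : Bdry d) (k l : 𝓢(ℝ, ℂ)), (∀ ξ, 𝓕⁻ l ξ = g (mk η ξ) * 𝓕⁻ k ξ) →
      (∀ x, ε * x ≤ 0 → k x = 0) → ∀ x, ε * x ≤ 0 → l x = 0) :
    Van ε (fourierMultiplierCLM ℂ g U) := by
  intro Θ hΘ
  rw [fourierMultiplierCLM_apply_apply]
  set Θ' := 𝓕 (SchwartzMap.smulLeftCLM ℂ g (𝓕⁻ Θ)) with hΘ'
  refine hU _ fun x hx => ?_
  -- After the tangential Fourier transform the multiplier acts on each vertical line separately,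
  -- and vanishing on the hyperplanes x_n = t can be tested before or after that transform.
  have h1 : ∀ η t, ε * t ≤ 0 → partialFourier Θ' (mk η t) = 0 := by
    intro η t ht
    have := h (-η) (vslice η (partialFourier Θ)) (vslice η (partialFourier Θ')) (fun ξ => ?_)
      (fun s hs => (partialFourier_eq_zero_iff Θ s).2
        (fun y => hΘ _ (by simpa using hs)) η) t ht
    · simpa using this
    · have h2 := fourierInv_mk Θ' (-η) ξ
      have h3 := fourierInv_mk Θ (-η) ξ
      rw [neg_neg] at h2 h3
      rw [← h2, ← h3, hΘ', fourierInv_fourier_eq, SchwartzMap.smulLeftCLM_apply_apply hg,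
        smul_eq_mul]
  rw [← mk_tang_normal x]
  exact (partialFourier_eq_zero_iff Θ' _).1 (fun η => h1 η _ hx) _

/-- For ε = -1, Ξ₊^τ preserves support in x_n ≥ 0. For ε = 1, Ξ₋^τ preserves vanishing on x_n > 0.
Both hold for every real τ, so these operators can be inverted within the classes. -/
theorem Van.mult_lam (hε : ε ^ 2 = 1) (hU : Van ε U) (τ : ℝ) :
    Van ε (fourierMultiplierCLM ℂ (lam (-ε) τ) U) :=
  hU.mult_of_fibre (hasTemperateGrowth_lam (by simpa using hε) τ)
    fun η => preservesHalfLine hε η τ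

theorem Van.mult_tang (hU : Van ε U) {m : Bdry d → ℂ} (hm : m.HasTemperateGrowth) :
    Van ε (fourierMultiplierCLM ℂ (fun ξ => m (tang d ξ)) U) := by
  refine hU.mult_of_fibre (hasTemperateGrowth_comp_tang hm) fun η k l hl hk x hx => ?_
  have : l = m η • k := by
    refine schwartz_ext_fourierInv fun ξ => ?_
    rw [hl, fourierInv_smul, smul_apply, tang_mk, smul_eq_mul]
  rw [this, smul_apply, hk x hx, smul_zero]

end Vanishing


/-! ### Square-integrable distributions and truncation to the half-space -/

section Weights

variable {V : Type*} [MeasurableSpace V] {μ : Measure V}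

theorem memLp_of_norm_le_mul {f h : V → ℂ} {C : ℝ} (hf : MemLp f 2 μ)
    (hh : AEStronglyMeasurable h μ) (hC : ∀ x, ‖h x‖ ≤ C * ‖f x‖) : MemLp h 2 μ :=
  hf.of_le_mul hh (ae_of_all _ hC)

theorem eLpNorm_le_of_norm_le_mul {f h : V → ℂ} {C : ℝ} (hC : ∀ x, ‖h x‖ ≤ C * ‖f x‖) :
    eLpNorm h 2 μ ≤ ENNReal.ofReal C * eLpNorm f 2 μ :=
  eLpNorm_le_mul_eLpNorm_of_ae_le_mul (ae_of_all _ hC) 2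

/-- A function is measurable if its product with a positive continuous weight is. -/
theorem aestronglyMeasurable_of_weight [TopologicalSpace V] [OpensMeasurableSpace V]
    {w : V → ℂ} {f : V → ℂ} (hw : Continuous w) (h0 : ∀ x, w x ≠ 0)
    (hf : AEStronglyMeasurable (fun x => w x * f x) μ) : AEStronglyMeasurable f μ := by
  have h1 : f = fun x => (w x)⁻¹ * (w x * f x) := by
    ext x
    rw [← mul_assoc, inv_mul_cancel₀ (h0 x), one_mul]
  rw [h1]
  exact (hw.inv₀ h0).measurable.aestronglyMeasurable.mul hf

end Weights

section LTwo

open FourierTransform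
open scoped ContDiff

variable {d : ℕ} {ε : ℝ}

/-- `U` is a square-integrable function. -/
def IsL2 (U : 𝓢'(Full d, ℂ)) : Prop := ∃ h : Lp ℂ 2 (volume : Measure (Full d)), U = h

theorem HasFT.isL2 {U : 𝓢'(Full d, ℂ)} {k : Full d → ℂ} (h : HasFT U k) (hk : MemLp k 2) :
    IsL2 U :=
  let ⟨f, hf, _⟩ := h.exists_toLp hk
  ⟨f, hf⟩

theorem exists_hasFT_toLp (g : Lp ℂ 2 (volume : Measure (Full d))) :
    ∃ p : Full d → ℂ, HasFT (g : 𝓢'(Full d, ℂ)) p ∧ MemLp p 2 ∧ eLpNorm p 2 = ‖g‖ₑ :=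
  ⟨_, hasFT_toLp g, memLp_fourier_toLp g, eLpNorm_fourier_toLp g⟩

theorem coe_sub_toTemperedDistribution (f g : Lp ℂ 2 (volume : Measure (Full d))) :
    ((f - g : Lp ℂ 2 (volume : Measure (Full d))) : 𝓢'(Full d, ℂ)) = f - g :=
  map_sub (Lp.toTemperedDistributionCLM ℂ volume 2) f g

theorem IsL2.sub {U W : 𝓢'(Full d, ℂ)} (hU : IsL2 U) (hW : IsL2 W) : IsL2 (U - W) := by
  obtain ⟨f, rfl⟩ := hU
  obtain ⟨g, rfl⟩ := hW
  exact ⟨f - g, (coe_sub_toTemperedDistribution f g).symm⟩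

/-- A distribution in `L₂` vanishing on compactly supported real test functions in an open set
vanishes almost everywhere there. -/
theorem ae_eq_zero_of_test {Ω : Set (Full d)} (hΩ : IsOpen Ω)
    {h : Lp ℂ 2 (volume : Measure (Full d))}
    (H : ∀ Θ : 𝓢(Full d, ℂ), HasCompactSupport Θ → tsupport Θ ⊆ Ω → (∀ x, (Θ x).im = 0) →
      (h : 𝓢'(Full d, ℂ)) Θ = 0) : ∀ᵐ x, x ∈ Ω → h x = 0 := by
  refine hΩ.ae_eq_zero_of_integral_contDiff_smul_eq_zero
    (((Lp.memLp h).locallyIntegrable (by norm_num)).locallyIntegrableOn _) ?_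
  intro g hg hgc hgs
  have hg' : ContDiff ℝ ∞ fun x => (g x : ℂ) := Complex.ofRealCLM.contDiff.comp hg
  have hgc' : HasCompactSupport fun x => (g x : ℂ) :=
    hgc.comp_left (g := fun r : ℝ => (r : ℂ)) Complex.ofReal_zero
  have h1 := H (hgc'.toSchwartzMap hg') hgc' ?_ (fun x => Complex.ofReal_im _)
  · rw [Lp.toTemperedDistribution_apply] at h1
    simpa using h1
  · refine (tsupport_comp_subset (g := fun r : ℝ => (r : ℂ)) Complex.ofReal_zero g).trans hgs

theorem isOpen_side (ε : ℝ) : IsOpen {x : Full d | 0 < ε * normal d x} :=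
  isOpen_lt continuous_const (by fun_prop)

theorem van_of_ae_eq_zero {h : Lp ℂ 2 (volume : Measure (Full d))}
    (H : ∀ᵐ x, 0 < ε * normal d x → h x = 0) : Van ε (h : 𝓢'(Full d, ℂ)) := by
  intro Θ hΘ
  rw [Lp.toTemperedDistribution_apply]
  refine integral_eq_zero_of_ae ?_
  filter_upwards [H] with x hx
  rcases le_or_gt (ε * normal d x) 0 with h1 | h1
  · simp [hΘ x h1]
  · simp [hx h1]

theorem Van.ae_eq_zero {h : Lp ℂ 2 (volume : Measure (Full d))}
    (H : Van ε (h : 𝓢'(Full d, ℂ))) : ∀ᵐ x, 0 < ε * normal d x → h x = 0 := by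
  refine ae_eq_zero_of_test (isOpen_side ε) fun Θ _ hs _ => H Θ fun x hx => ?_
  by_contra h0
  have := hs (subset_tsupport _ h0)
  simp only [Set.mem_ofPred_eq] at this
  linarith

theorem Van.restr_eq_zero {U : 𝓢'(Full d, ℂ)} (hU : Van 1 U) : restr (halfSpace d) U = 0 := by
  ext φ
  rw [restr_apply]
  refine hU _ fun x hx => ?_
  rw [testToSchwartz_apply]
  by_contra h0
  have h1 : x ∈ halfSpace d := φ.tsupport_subset (subset_tsupport _ fun h => h0 (by simp [h]))
  have h2 : 0 < normal d x := h1
  linarith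

theorem restr_sub (U W : 𝓢'(Full d, ℂ)) :
    restr (halfSpace d) (U - W) = restr (halfSpace d) U - restr (halfSpace d) W := rfl

theorem Van.restr_eq {U W : 𝓢'(Full d, ℂ)} (h : Van 1 (U - W)) :
    restr (halfSpace d) U = restr (halfSpace d) W := by
  rw [← sub_eq_zero, ← restr_sub, h.restr_eq_zero]

/-- Real test functions with compact support in the half-space determine an L₂-function there almost
everywhere, and this extends the vanishing to Schwartz test functions that reach the boundary. -/
theorem van_of_restr_eq_zero {U : 𝓢'(Full d, ℂ)} (hU : IsL2 U) (h : restr (halfSpace d) U = 0) :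
    Van 1 U := by
  obtain ⟨f, rfl⟩ := hU
  refine van_of_ae_eq_zero ?_
  have h1 := ae_eq_zero_of_test (h := f) (halfSpace d).isOpen fun Θ hc hs hi => by
    let φ : 𝓓(halfSpace d, ℝ) := ⟨fun x => (Θ x).re,
      Complex.reCLM.contDiff.comp (Θ.smooth _), hc.comp_left (g := Complex.re) rfl,
      (tsupport_comp_subset (g := Complex.re) rfl _).trans hs⟩
    have h2 : testToSchwartz φ = Θ := by
      ext x
      refine Complex.ext ?_ ?_
      · rfl
      · rw [hi]; rfl
    rw [← h2, ← restr_apply, h]; rfl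
  filter_upwards [h1] with x hx h2
  exact hx (show 0 < normal d x by simpa using h2)

theorem van_of_restr_eq {U W : 𝓢'(Full d, ℂ)} (hU : IsL2 U) (hW : IsL2 W)
    (h : restr (halfSpace d) U = restr (halfSpace d) W) : Van 1 (U - W) :=
  van_of_restr_eq_zero (hU.sub hW) (by rw [restr_sub, h, sub_self])

/-- The hyperplane is a null set. Square integrability is essential: a layer φ ⊗ δ vanishes on both
open sides. -/
theorem IsL2.eq_zero_of_van {U : 𝓢'(Full d, ℂ)} (hU : IsL2 U) (h1 : Van 1 U) (h2 : Van (-1) U) :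
    U = 0 := by
  obtain ⟨f, rfl⟩ := hU
  have h3 : f = 0 := by
    rw [Lp.eq_zero_iff_ae_eq_zero]
    filter_upwards [h1.ae_eq_zero, h2.ae_eq_zero, ae_normal_ne_zero] with x h1 h2 h3
    rcases lt_or_gt_of_ne h3 with h | h
    · exact h2 (by linarith)
    · exact h1 (by linarith)
  rw [h3]
  exact map_zero (Lp.toTemperedDistributionCLM ℂ volume 2)

theorem isZeroExtension_iff {g : 𝓓'(halfSpace d, ℂ)} {v : 𝓢'(Full d, ℂ)} :
    IsZeroExtension (halfSpace d) g v ↔ IsL2 v ∧ Van (-1) v ∧ restr (halfSpace d) v = g := by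
  constructor
  · rintro ⟨h, rfl, h1, h2⟩
    refine ⟨⟨h, rfl⟩, van_of_ae_eq_zero ?_, h2⟩
    filter_upwards [h1] with x hx h3
    refine hx fun h4 => ?_
    have : 0 < normal d x := h4
    linarith
  · rintro ⟨⟨h, rfl⟩, h1, h2⟩
    refine ⟨h, rfl, ?_, h2⟩
    filter_upwards [h1.ae_eq_zero, ae_normal_ne_zero] with x h3 h4 h5
    have h6 : ¬ 0 < normal d x := h5
    have h7 : normal d x < 0 := lt_of_le_of_ne (not_lt.1 h6) h4
    exact h3 (by linarith)

theorem Van.dsupport_subset {U : 𝓢'(Full d, ℂ)} (hU : Van (-1) U) :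
    Distribution.dsupport U ⊆ {x | 0 ≤ x (Fin.last d)} := by
  intro x hx
  by_contra h0
  refine (Distribution.notMem_dsupport_iff (f := U) x).2
    ⟨{x | 0 < (-1) * normal d x}, fun Θ hΘ => hU Θ fun z hz => ?_, isOpen_side _, ?_⟩ hx
  · by_contra h1
    have := hΘ (subset_tsupport _ h1)
    simp only [Set.mem_ofPred_eq] at this
    linarith
  · have h1 : ¬ 0 ≤ normal d x := h0
    simp only [Set.mem_ofPred_eq]
    linarith

/-- `Y = e⁺ r⁺ X` for square-integrable `X`. -/
structure IsCut (X Y : 𝓢'(Full d, ℂ)) : Prop where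
  isL2 : IsL2 X
  isL2_cut : IsL2 Y
  van_neg : Van (-1) Y
  van_sub : Van 1 (X - Y)

/-- The difference of the two truncations is square-integrable and vanishes on both sides of the
hyperplane. Truncation thus depends only on the values in x_n > 0. -/
theorem IsCut.unique {X X' Y Y' : 𝓢'(Full d, ℂ)} (h : IsCut X Y) (h' : IsCut X' Y')
    (hX : Van 1 (X - X')) : Y = Y' := by
  rw [← sub_eq_zero]
  refine (h.isL2_cut.sub h'.isL2_cut).eq_zero_of_van ?_ (h.van_neg.sub h'.van_neg)
  have : Y - Y' = (X - X') - (X - Y) + (X' - Y') := by abel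
  rw [this]
  exact (hX.sub h.van_sub).add h'.van_sub

theorem IsCut.sub {X X' Y Y' : 𝓢'(Full d, ℂ)} (h : IsCut X Y) (h' : IsCut X' Y') :
    IsCut (X - X') (Y - Y') where
  isL2 := h.isL2.sub h'.isL2
  isL2_cut := h.isL2_cut.sub h'.isL2_cut
  van_neg := h.van_neg.sub h'.van_neg
  van_sub := by
    have : X - X' - (Y - Y') = (X - Y) - (X' - Y') := by abel
    rw [this]
    exact h.van_sub.sub h'.van_sub

theorem exists_isCut_toLp (f : Lp ℂ 2 (volume : Measure (Full d))) :
    ∃ g : Lp ℂ 2 (volume : Measure (Full d)), ‖g‖ₑ ≤ ‖f‖ₑ ∧ IsCut (f : 𝓢'(Full d, ℂ)) g := by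
  have hm : MeasurableSet (halfSpace d : Set (Full d)) := (halfSpace d).isOpen.measurableSet
  have hi : MemLp ((halfSpace d : Set (Full d)).indicator f) 2 := (Lp.memLp f).indicator hm
  refine ⟨hi.toLp _, ?_, ⟨f, rfl⟩, ⟨_, rfl⟩, van_of_ae_eq_zero ?_, ?_⟩
  · rw [Lp.enorm_toLp, Lp.enorm_def]
    exact eLpNorm_indicator_le _
  · filter_upwards [hi.coeFn_toLp] with x hx h1
    rw [hx, Set.indicator_of_notMem]
    intro h2
    have : 0 < normal d x := h2
    linarith
  · rw [← coe_sub_toTemperedDistribution]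
    refine van_of_ae_eq_zero ?_
    filter_upwards [hi.coeFn_toLp, Lp.coeFn_sub f (hi.toLp _)] with x hx h2 h1
    have h3 : x ∈ (halfSpace d : Set (Full d)) := by
      change 0 < normal d x
      linarith
    rw [h2, Pi.sub_apply, hx, Set.indicator_of_mem h3, sub_self]

theorem continuous_jap_tang_rpow (r : ℝ) :
    Continuous fun ξ : Full d => ((jap (tang d ξ) ^ r : ℝ) : ℂ) :=
  Complex.continuous_ofReal.comp ((continuous_jap.comp (tang d).continuous).rpow_const
    fun _ => Or.inl (jap_pos _).ne')

theorem jap_tang_rpow_ne_zero (r : ℝ) (ξ : Full d) : ((jap (tang d ξ) ^ r : ℝ) : ℂ) ≠ 0 :=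
  Complex.ofReal_ne_zero.2 (Real.rpow_pos_of_pos (jap_pos _) r).ne'

theorem memLp_of_jap_mul {m : ℝ} (hm : 0 ≤ m) {k : Full d → ℂ}
    (hk : MemLp (fun ξ => ((jap (tang d ξ) ^ m : ℝ) : ℂ) * k ξ) 2) : MemLp k 2 := by
  refine memLp_of_norm_le_mul (C := 1) hk (aestronglyMeasurable_of_weight
    (continuous_jap_tang_rpow m) (jap_tang_rpow_ne_zero m) hk.1) fun ξ => ?_
  rw [one_mul, norm_mul, Complex.norm_real, Real.norm_of_nonneg (Real.rpow_nonneg (jap_pos _).le _)]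
  exact le_mul_of_one_le_left (norm_nonneg _) (Real.one_le_rpow (one_le_jap _) hm)

/-- Truncation to the half-space preserves tangential regularity. -/
theorem HasFT.exists_isCut {m : ℝ} (hm : 0 ≤ m) {X : 𝓢'(Full d, ℂ)} {k : Full d → ℂ}
    (h : HasFT X k) (hk : MemLp (fun ξ => ((jap (tang d ξ) ^ m : ℝ) : ℂ) * k ξ) 2) :
    ∃ Y l, HasFT Y l ∧ IsCut X Y ∧ MemLp (fun ξ => ((jap (tang d ξ) ^ m : ℝ) : ℂ) * l ξ) 2 ∧
      eLpNorm (fun ξ => ((jap (tang d ξ) ^ m : ℝ) : ℂ) * l ξ) 2 ≤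
        eLpNorm (fun ξ => ((jap (tang d ξ) ^ m : ℝ) : ℂ) * k ξ) 2 := by
  -- Multipliers in ξ' alone respect both half-spaces, so truncation can be done after applying the
  -- weight ⟨ξ'⟩^m, which is then removed; the weighted norm does not increase.
  obtain ⟨f, hf, hfn⟩ := (h.mult (hasTemperateGrowth_jap_tang m)).exists_toLp hk
  obtain ⟨g, hg, hc⟩ := exists_isCut_toLp f
  have hinv : ∀ (ξ : Full d) (z : ℂ),
      ((jap (tang d ξ) ^ m : ℝ) : ℂ) * (((jap (tang d ξ) ^ (-m) : ℝ) : ℂ) * z) = z := by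
    intro ξ z
    rw [← mul_assoc, ← Complex.ofReal_mul, ← Real.rpow_add (jap_pos _)]
    simp
  obtain ⟨p, hp, hpm, hpn⟩ := exists_hasFT_toLp g
  have hFT := hp.mult (hasTemperateGrowth_jap_tang (-m))
  have hl : (fun ξ => ((jap (tang d ξ) ^ m : ℝ) : ℂ) *
      (((jap (tang d ξ) ^ (-m) : ℝ) : ℂ) * p ξ)) = p := funext fun ξ => hinv ξ _
  have hl' : MemLp (fun ξ => ((jap (tang d ξ) ^ m : ℝ) : ℂ) *
      (((jap (tang d ξ) ^ (-m) : ℝ) : ℂ) * p ξ)) 2 := hl.symm ▸ hpm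
  have ht := hasTemperateGrowth_ofReal (hasTemperateGrowth_jap_rpow (d := d) (-m))
  have h1 : X = fourierMultiplierCLM ℂ (fun ξ => ((jap (tang d ξ) ^ (-m) : ℝ) : ℂ))
      (f : 𝓢'(Full d, ℂ)) := by
    rw [← hf]
    refine h.unique (((h.mult (hasTemperateGrowth_jap_tang m)).mult
      (hasTemperateGrowth_jap_tang (-m))).congr ?_)
    ext ξ
    rw [mul_left_comm, hinv]
  have h2 := hc.van_neg.mult_tang ht
  have h3 := hc.van_sub.mult_tang ht
  rw [map_sub, ← h1] at h3
  refine ⟨_, _, hFT, ⟨h.isL2 (memLp_of_jap_mul hm hk), hFT.isL2 (memLp_of_jap_mul hm hl'), h2, h3⟩,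
    hl', ?_⟩
  rw [hl, hpn, ← hfn]
  exact hg

end LTwo

/-! ### Layers φ ⊗ δ on the boundary hyperplane -/

section Layer

open FourierTransform

variable {d : ℕ}

/-- The distribution `φ(x') ⊗ δ(x_n)`. -/
def layer : 𝓢'(Bdry d, ℂ) →L[ℂ] 𝓢'(Full d, ℂ) :=
  PointwiseConvergenceCLM.precomp ℂ (slice (d := d) (F := ℂ) 0)

theorem layer_apply (φ : 𝓢'(Bdry d, ℂ)) (Θ : 𝓢(Full d, ℂ)) : layer φ Θ = φ (slice 0 Θ) := rfl

theorem boundaryValue_eq (w : 𝓢(Full d, ℂ)) : boundaryValue w = slice 0 w := by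
  ext y; rfl

theorem van_layer (ε : ℝ) (φ : 𝓢'(Bdry d, ℂ)) : Van ε (layer φ) := by
  intro Θ hΘ
  have : slice 0 Θ = 0 := by
    ext y
    exact hΘ _ (by simp)
  rw [layer_apply, this, map_zero]

/-- Fourier inversion in the normal variable only: evaluating a transform at x_n = 0 is integrating
over ξ_n. Hence the transform of a layer is independent of ξ_n. -/
theorem fourierInv_slice_fourier (Θ : 𝓢(Full d, ℂ)) (η : Bdry d) :
    𝓕⁻ (slice 0 (𝓕 Θ)) η = ∫ t, Θ (mk η t) := by
  have h1 : vslice η Θ = 𝓕⁻ (vslice (-η) (partialFourier (𝓕 Θ))) := by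
    ext τ
    rw [← fourierInv_mk, schwartz_fourierInv_fourier, vslice_apply]
  have h2 : 𝓕 (vslice η Θ) = vslice (-η) (partialFourier (𝓕 Θ)) := by
    rw [h1, schwartz_fourier_fourierInv]
  rw [SchwartzMap.fourierInv_coe, Real.fourierInv_eq_fourier_neg, ← SchwartzMap.fourier_coe,
    ← partialFourier_mk, ← vslice_apply, ← h2, SchwartzMap.fourier_coe, Real.fourier_eq']
  simp

theorem memLp_one_add_norm_rpow : MemLp (fun y : Bdry d => (1 + ‖y‖) ^ (-((Module.finrank ℝ (Bdry d) : ℝ) + 1))) 2 := by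
  have hc : Continuous fun y : Bdry d =>
      (1 + ‖y‖) ^ (-((Module.finrank ℝ (Bdry d) : ℝ) + 1)) :=
    (continuous_const.add continuous_norm).rpow_const
      fun y => Or.inl (by linarith [norm_nonneg y] : (0 : ℝ) < 1 + ‖y‖).ne'
  rw [memLp_two_iff_integrable_sq hc.aestronglyMeasurable]
  refine (integrable_one_add_norm (E := Bdry d) (μ := volume)
    (r := Module.finrank ℝ (Bdry d) + 1) (by linarith)).mono
    (hc.pow 2).aestronglyMeasurable (ae_of_all _ fun y => ?_)
  rw [norm_pow, sq]
  refine mul_le_of_le_one_left (norm_nonneg _) ?_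
  rw [Real.norm_of_nonneg (by positivity)]
  exact Real.rpow_le_one_of_one_le_of_nonpos (by linarith [norm_nonneg y]) (by
    have : (0 : ℝ) ≤ Module.finrank ℝ (Bdry d) := by positivity
    linarith)

theorem integrable_mul_comp_tang {κ : Bdry d → ℂ} (hκ : MemLp κ 2) (Θ : 𝓢(Full d, ℂ)) :
    Integrable fun ξ => Θ ξ * κ (tang d ξ) := by
  obtain ⟨C, hC, h⟩ := exists_norm_mk_le Θ (r := Module.finrank ℝ (Bdry d) + 1) (s := 2)
    (by positivity) (by norm_num)
  have h1 := memLp_one_add_norm_rpow (d := d)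
  have h2 : Integrable fun y : Bdry d =>
      ‖κ y‖ * (1 + ‖y‖) ^ (-((Module.finrank ℝ (Bdry d) : ℝ) + 1)) :=
    MemLp.integrable_mul (p := 2) (q := 2) hκ.norm h1
  have h3 : Integrable fun t : ℝ => C * (1 + |t|) ^ (-2 : ℝ) :=
    (integrable_one_add_norm (E := ℝ) (μ := volume) (r := 2) (by simp)).const_mul C
  refine (integrable_mul_mk h2 h3).mono' ?_ (ae_of_all _ fun ξ => ?_)
  · exact Θ.continuous.aestronglyMeasurable.mul
      (hκ.1.comp_quasiMeasurePreserving quasiMeasurePreserving_tang)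
  · have := h (tang d ξ) (normal d ξ)
    rw [mk_tang_normal] at this
    rw [norm_mul]
    calc _ ≤ _ := mul_le_mul_of_nonneg_right this (norm_nonneg _)
      _ = _ := by ring

theorem HasFT.layer {φ : 𝓢'(Bdry d, ℂ)} {κ : Bdry d → ℂ} (h : HasFT φ κ) (hκ : MemLp κ 2) :
    HasFT (layer φ) (fun ξ => κ (tang d ξ)) where
  integrable Θ := integrable_mul_comp_tang hκ Θ
  eq Θ := by
    rw [layer_apply, ← schwartz_fourier_fourierInv (slice 0 (𝓕 Θ)), h.eq,
      integral_eq_integral_mk (integrable_mul_comp_tang hκ Θ)]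
    refine integral_congr_ae (ae_of_all _ fun η => ?_)
    simp only [tang_mk]
    rw [fourierInv_slice_fourier, integral_mul_const]

/-- A dilation by ⟨ξ'⟩/2π reduces this to ∫ dt/(1 + t²) = π. The value does not depend on y, so
⟨ξ'⟩^{1/2} exactly compensates the integration over ξ_n; this is the half-order relating boundary
and interior regularity. -/
theorem lintegral_jap_mul_fjap (y : Bdry d) :
    ∫⁻ t, ENNReal.ofReal (jap y * fjap (mk y t) ^ (-2 : ℝ)) = ENNReal.ofReal (1 / 2) := by
  have hσ := jap_pos y
  have h1 : ∀ t, jap y * fjap (mk y t) ^ (-2 : ℝ) =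
      (jap y)⁻¹ * (1 + (2 * Real.pi / jap y * t) ^ 2)⁻¹ := by
    intro t
    rw [Real.rpow_neg (fjap_pos _).le]
    norm_cast
    rw [fjap_sq, tang_mk, normal_mk]
    field_simp
  have hi : Integrable fun t : ℝ => (1 + (2 * Real.pi / jap y * t) ^ 2)⁻¹ :=
    integrable_inv_one_add_sq.comp_mul_left' (R := 2 * Real.pi / jap y) (by positivity)
  simp only [h1]
  rw [← ofReal_integral_eq_lintegral_ofReal (hi.const_mul _) (ae_of_all _ fun t => by positivity),
    integral_const_mul, Measure.integral_comp_mul_left (fun t : ℝ => (1 + t ^ 2)⁻¹),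
    integral_univ_inv_one_add_sq]
  congr 1
  rw [abs_of_pos (by positivity), smul_eq_mul]
  field_simp

theorem continuous_fjap_rpow (r : ℝ) : Continuous fun ξ : Full d => ((fjap ξ ^ r : ℝ) : ℂ) :=
  Complex.continuous_ofReal.comp (continuous_fjap.rpow_const fun _ => Or.inl (fjap_pos _).ne')

/-- The weighted `L₂`-estimate for the Fourier transform of a layer. -/
theorem memLp_layer_weight {g : Bdry d → ℂ} (hg : MemLp g 2) :
    MemLp (fun ξ : Full d => ((jap (tang d ξ) ^ (1 / 2 : ℝ) : ℝ) : ℂ) *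
      ((fjap ξ ^ (-1 : ℝ) : ℝ) : ℂ) * g (tang d ξ)) 2 ∧
    eLpNorm (fun ξ : Full d => ((jap (tang d ξ) ^ (1 / 2 : ℝ) : ℝ) : ℂ) *
      ((fjap ξ ^ (-1 : ℝ) : ℝ) : ℂ) * g (tang d ξ)) 2 ≤ eLpNorm g 2 := by
  have hm : AEStronglyMeasurable (fun ξ : Full d => ((jap (tang d ξ) ^ (1 / 2 : ℝ) : ℝ) : ℂ) *
      ((fjap ξ ^ (-1 : ℝ) : ℝ) : ℂ) * g (tang d ξ)) volume :=
    ((continuous_jap_tang_rpow _).mul (continuous_fjap_rpow _)).aestronglyMeasurable.mul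
      (hg.1.comp_quasiMeasurePreserving quasiMeasurePreserving_tang)
  have hle : eLpNorm (fun ξ : Full d => ((jap (tang d ξ) ^ (1 / 2 : ℝ) : ℝ) : ℂ) *
      ((fjap ξ ^ (-1 : ℝ) : ℝ) : ℂ) * g (tang d ξ)) 2 ≤ eLpNorm g 2 := by
    rw [eLpNorm_eq_lintegral_rpow_enorm_toReal (by norm_num) (by norm_num),
      eLpNorm_eq_lintegral_rpow_enorm_toReal (by norm_num) (by norm_num)]
    refine ENNReal.rpow_le_rpow ?_ (by norm_num)
    rw [lintegral_eq_lintegral_mk (hm.enorm.pow_const _)]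
    refine lintegral_mono fun y => ?_
    have h1 : ∀ t, ‖((jap (tang d (mk y t)) ^ (1 / 2 : ℝ) : ℝ) : ℂ) *
        ((fjap (mk y t) ^ (-1 : ℝ) : ℝ) : ℂ) * g (tang d (mk y t))‖ₑ ^ (2 : ℝ≥0∞).toReal =
        ENNReal.ofReal (jap y * fjap (mk y t) ^ (-2 : ℝ)) * ‖g y‖ₑ ^ (2 : ℝ≥0∞).toReal := by
      intro t
      rw [enorm_mul, ENNReal.mul_rpow_of_nonneg _ _ (by norm_num), tang_mk]
      congr 1
      rw [← ofReal_norm, norm_mul, Complex.norm_real, Complex.norm_real,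
        Real.norm_of_nonneg (Real.rpow_nonneg (jap_pos _).le _),
        Real.norm_of_nonneg (Real.rpow_nonneg (fjap_pos _).le _),
        ENNReal.ofReal_rpow_of_nonneg (mul_nonneg (Real.rpow_nonneg (jap_pos _).le _)
          (Real.rpow_nonneg (fjap_pos _).le _)) (by norm_num),
        Real.mul_rpow (Real.rpow_nonneg (jap_pos _).le _) (Real.rpow_nonneg (fjap_pos _).le _),
        ← Real.rpow_mul (jap_pos _).le, ← Real.rpow_mul (fjap_pos _).le]
      norm_num
    simp only [h1]
    rw [lintegral_mul_const' _ _ (by simp), lintegral_jap_mul_fjap]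
    refine mul_le_of_le_one_left zero_le ?_
    rw [ENNReal.ofReal_le_one]
    norm_num
  exact ⟨⟨hm, hle.trans_lt hg.2⟩, hle⟩

end Layer


/-! ### The mapping property of `Ξ₊⁻¹` on truncations and layers -/

section Resolvent

variable {d : ℕ}

theorem mult_mult {g h : Full d → ℂ} (hg : g.HasTemperateGrowth) (hh : h.HasTemperateGrowth)
    (U : 𝓢'(Full d, ℂ)) : fourierMultiplierCLM ℂ g (fourierMultiplierCLM ℂ h U) =
      fourierMultiplierCLM ℂ (fun ξ => g ξ * h ξ) U := by
  rw [fourierMultiplierCLM_fourierMultiplierCLM_apply hh hg U, mul_comm]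
  rfl

theorem mult_add {g h : Full d → ℂ} (hg : g.HasTemperateGrowth) (hh : h.HasTemperateGrowth)
    (U : 𝓢'(Full d, ℂ)) : fourierMultiplierCLM ℂ (fun ξ => g ξ + h ξ) U =
      fourierMultiplierCLM ℂ g U + fourierMultiplierCLM ℂ h U := by
  have := smulLeftCLM_add (F := ℂ) hg hh
  rw [fourierMultiplierCLM_apply, fourierMultiplierCLM_apply, fourierMultiplierCLM_apply,
    ← FourierTransform.fourierInv_add]
  congr 1
  rw [← add_apply, ← this]
  rfl

theorem temperate_lam_one (τ : ℝ) : (lam (d := d) 1 τ).HasTemperateGrowth :=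
  hasTemperateGrowth_lam (by norm_num) τ

theorem temperate_lam_neg_one (τ : ℝ) : (lam (d := d) (-1) τ).HasTemperateGrowth :=
  hasTemperateGrowth_lam (by norm_num) τ

theorem Van.mult_lam_one {U : 𝓢'(Full d, ℂ)} (hU : Van (-1) U) (τ : ℝ) :
    Van (-1) (fourierMultiplierCLM ℂ (lam 1 τ) U) := by
  have := hU.mult_lam (by norm_num) τ
  rwa [neg_neg] at this

theorem Van.mult_lam_neg_one {U : 𝓢'(Full d, ℂ)} (hU : Van 1 U) (τ : ℝ) :
    Van 1 (fourierMultiplierCLM ℂ (lam (-1) τ) U) :=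
  hU.mult_lam (by norm_num) τ

/-- The symbol `2⟨ξ'⟩ / (⟨ξ'⟩ - iξ_n)`. -/
def quot (ξ : Full d) : ℂ := ((2 * jap (tang d ξ) : ℝ) : ℂ) * lam (-1) (-1) ξ

theorem temperate_two_mul_jap :
    (fun y : Bdry d => ((2 * jap y : ℝ) : ℂ)).HasTemperateGrowth := by
  have h := hasTemperateGrowth_jap_rpow (d := d) 1
  simp only [Real.rpow_one] at h
  exact hasTemperateGrowth_ofReal ((Function.HasTemperateGrowth.const 2).mul h)

theorem temperate_quot : (quot (d := d)).HasTemperateGrowth :=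
  (hasTemperateGrowth_comp_tang temperate_two_mul_jap).mul (temperate_lam_neg_one (-1))

theorem temperate_quot_pow (N : ℕ) : (fun ξ : Full d => quot ξ ^ N).HasTemperateGrowth :=
  temperate_quot.pow N

theorem temperate_quot_pow_mul (N : ℕ) :
    (fun ξ : Full d => quot ξ ^ N * lam 1 (-1) ξ).HasTemperateGrowth :=
  (temperate_quot_pow N).mul (temperate_lam_one _)

theorem Van.mult_quot {U : 𝓢'(Full d, ℂ)} (hU : Van 1 U) :
    Van 1 (fourierMultiplierCLM ℂ quot U) := by
  have h := (hU.mult_lam_neg_one (-1)).mult_tang temperate_two_mul_jap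
  rw [mult_mult (hasTemperateGrowth_comp_tang temperate_two_mul_jap)
    (temperate_lam_neg_one (-1))] at h
  exact h

/-- Since 2⟨ξ'⟩ is the sum of the bases b₊ and b₋, the left side is (b₊ + b₋)/(b₊b₋). -/
theorem quot_mul_lam (ξ : Full d) :
    quot ξ * lam 1 (-1) ξ = lam 1 (-1) ξ + lam (-1) (-1) ξ := by
  have h1 := base_ne_zero 1 ξ
  have h2 := base_ne_zero (-1) ξ
  have h3 := base_add_base ξ
  rw [quot, lam_neg_one, lam_neg_one]
  push_cast
  rw [← h3]
  field_simp
  ring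

/-- Each factor `quot` changes Ξ₊^{-1} by Ξ₋^{-1}, which keeps distributions vanishing on x_n > 0 in
that class. So on x_n > 0 the operator Ξ₊^{-1} can be replaced by one whose symbol gains the factor
(⟨ξ'⟩/⟨ξ⟩)^N. -/
theorem Van.mult_sub_mult_pow (N : ℕ) {W : 𝓢'(Full d, ℂ)} (hW : Van 1 W) :
    Van 1 (fourierMultiplierCLM ℂ (fun ξ => quot ξ ^ N * lam 1 (-1) ξ) W -
      fourierMultiplierCLM ℂ (lam 1 (-1)) W) := by
  induction N generalizing W with
  | zero => simpa using Van.zero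
  | succ N ih =>
    have h1 := ih hW.mult_quot
    have h2 : fourierMultiplierCLM ℂ (lam 1 (-1)) (fourierMultiplierCLM ℂ quot W) =
        fourierMultiplierCLM ℂ (lam 1 (-1)) W + fourierMultiplierCLM ℂ (lam (-1) (-1)) W := by
      rw [mult_mult (temperate_lam_one _) temperate_quot,
        ← mult_add (temperate_lam_one _) (temperate_lam_neg_one _)]
      congr 2
      ext ξ
      rw [mul_comm, quot_mul_lam]
    have h3 : fourierMultiplierCLM ℂ (fun ξ => quot ξ ^ N * lam 1 (-1) ξ)
        (fourierMultiplierCLM ℂ quot W) =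
        fourierMultiplierCLM ℂ (fun ξ => quot ξ ^ (N + 1) * lam 1 (-1) ξ) W := by
      refine (mult_mult (temperate_quot_pow_mul N) temperate_quot W).trans ?_
      congr 2
      ext ξ
      ring
    have h4 := h1.add (hW.mult_lam_neg_one (-1))
    rw [h3, h2] at h4
    convert h4 using 1
    abel

theorem memLp_of_norm_le_three {V : Type*} [MeasurableSpace V] {μ : Measure V}
    {f₁ f₂ f₃ h : V → ℂ} {c : ℝ} (h₁ : MemLp f₁ 2 μ) (h₂ : MemLp f₂ 2 μ) (h₃ : MemLp f₃ 2 μ)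
    (hh : AEStronglyMeasurable h μ) (hc : ∀ x, ‖h x‖ ≤ c * (‖f₁ x‖ + ‖f₂ x‖ + ‖f₃ x‖)) :
    MemLp h 2 μ ∧ eLpNorm h 2 μ ≤
      ENNReal.ofReal c * (eLpNorm f₁ 2 μ + eLpNorm f₂ 2 μ + eLpNorm f₃ 2 μ) := by
  have hF : MemLp (fun x => ‖f₁ x‖ + ‖f₂ x‖ + ‖f₃ x‖) 2 μ := (h₁.norm.add h₂.norm).add h₃.norm
  have hc' : ∀ x, ‖h x‖ ≤ c * ‖‖f₁ x‖ + ‖f₂ x‖ + ‖f₃ x‖‖ := fun x => by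
    rw [Real.norm_of_nonneg (by positivity)]; exact hc x
  refine ⟨hF.of_le_mul hh (ae_of_all _ hc'), ?_⟩
  refine (eLpNorm_le_mul_eLpNorm_of_ae_le_mul (ae_of_all _ hc') 2).trans ?_
  gcongr
  refine (eLpNorm_add_le (h₁.norm.add h₂.norm).1 h₃.norm.1 (by norm_num)).trans ?_
  rw [eLpNorm_norm]
  gcongr
  refine (eLpNorm_add_le h₁.norm.1 h₂.norm.1 (by norm_num)).trans ?_
  rw [eLpNorm_norm, eLpNorm_norm]

/-- By uniqueness of the truncation, the bound proved for one construction of it holds for any. -/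
theorem IsCut.exists_hasFT {m : ℝ} (hm : 0 ≤ m) {X Y : 𝓢'(Full d, ℂ)} {k : Full d → ℂ}
    (hc : IsCut X Y) (h : HasFT X k)
    (hk : MemLp (fun ξ => ((jap (tang d ξ) ^ m : ℝ) : ℂ) * k ξ) 2) :
    ∃ l, HasFT Y l ∧ MemLp (fun ξ => ((jap (tang d ξ) ^ m : ℝ) : ℂ) * l ξ) 2 ∧
      eLpNorm (fun ξ => ((jap (tang d ξ) ^ m : ℝ) : ℂ) * l ξ) 2 ≤
        eLpNorm (fun ξ => ((jap (tang d ξ) ^ m : ℝ) : ℂ) * k ξ) 2 := by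
  obtain ⟨Y', l, h1, h2, h3⟩ := h.exists_isCut hm hk
  have h4 : Y' = Y := h2.unique hc (by rw [sub_self]; exact Van.zero)
  exact ⟨l, h4 ▸ h1, h3⟩

theorem norm_ofReal_rpow {x : ℝ} (hx : 0 < x) (r : ℝ) : ‖((x ^ r : ℝ) : ℂ)‖ = x ^ r := by
  rw [Complex.norm_real, Real.norm_of_nonneg (Real.rpow_nonneg hx.le _)]

theorem jap_mul_le_fjap_mul {m : ℝ} (hm : 0 ≤ m) {k : Full d → ℂ}
    (hk : MemLp (fun ξ => ((fjap ξ ^ m : ℝ) : ℂ) * k ξ) 2) :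
    MemLp (fun ξ => ((jap (tang d ξ) ^ m : ℝ) : ℂ) * k ξ) 2 ∧
    eLpNorm (fun ξ => ((jap (tang d ξ) ^ m : ℝ) : ℂ) * k ξ) 2 ≤
      eLpNorm (fun ξ => ((fjap ξ ^ m : ℝ) : ℂ) * k ξ) 2 := by
  have hkm : AEStronglyMeasurable k volume := aestronglyMeasurable_of_weight
    (continuous_fjap_rpow m) (fun ξ => Complex.ofReal_ne_zero.2
      (Real.rpow_pos_of_pos (fjap_pos ξ) m).ne') hk.1
  have hle : ∀ ξ, ‖((jap (tang d ξ) ^ m : ℝ) : ℂ) * k ξ‖ ≤ ‖((fjap ξ ^ m : ℝ) : ℂ) * k ξ‖ := by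
    intro ξ
    rw [norm_mul, norm_mul, norm_ofReal_rpow (jap_pos _), norm_ofReal_rpow (fjap_pos _)]
    gcongr
    exacts [(jap_pos _).le, jap_le_fjap ξ]
  exact ⟨hk.of_le ((continuous_jap_tang_rpow m).aestronglyMeasurable.mul hkm)
    (ae_of_all _ hle), eLpNorm_mono hle⟩

/-- Splitting ⟨ξ'⟩^{m+1} as ⟨ξ'⟩^{1/2}⟨ξ'⟩^{m+1/2}, the first factor pays for the integration over
ξ_n and the second is the boundary weight. -/
theorem memLp_layer_term {m : ℝ} {κ : Bdry d → ℂ}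
    (hκ : MemLp (fun y => ((jap y ^ (m + 1 / 2) : ℝ) : ℂ) * κ y) 2) :
    MemLp (fun ξ : Full d => ((jap (tang d ξ) ^ (m + 1) : ℝ) : ℂ) *
      ((fjap ξ ^ (-1 : ℝ) : ℝ) : ℂ) * κ (tang d ξ)) 2 ∧
    eLpNorm (fun ξ : Full d => ((jap (tang d ξ) ^ (m + 1) : ℝ) : ℂ) *
      ((fjap ξ ^ (-1 : ℝ) : ℝ) : ℂ) * κ (tang d ξ)) 2 ≤
      eLpNorm (fun y => ((jap y ^ (m + 1 / 2) : ℝ) : ℂ) * κ y) 2 := by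
  have h := memLp_layer_weight hκ
  have h1 : (fun ξ : Full d => ((jap (tang d ξ) ^ (m + 1) : ℝ) : ℂ) *
      ((fjap ξ ^ (-1 : ℝ) : ℝ) : ℂ) * κ (tang d ξ)) =
      fun ξ : Full d => ((jap (tang d ξ) ^ (1 / 2 : ℝ) : ℝ) : ℂ) * ((fjap ξ ^ (-1 : ℝ) : ℝ) : ℂ) *
        (((jap (tang d ξ) ^ (m + 1 / 2) : ℝ) : ℂ) * κ (tang d ξ)) := by
    ext ξ
    have : m + 1 = 1 / 2 + (m + 1 / 2) := by ring
    rw [this, Real.rpow_add (jap_pos _)]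
    push_cast
    ring
  rw [h1]
  exact h

theorem memLp_of_bdry_weight {r : ℝ} (hr : 0 ≤ r) {κ : Bdry d → ℂ}
    (hκ : MemLp (fun y => ((jap y ^ r : ℝ) : ℂ) * κ y) 2) : MemLp κ 2 := by
  have hc : Continuous fun y : Bdry d => ((jap y ^ r : ℝ) : ℂ) :=
    Complex.continuous_ofReal.comp (continuous_jap.rpow_const fun _ => Or.inl (jap_pos _).ne')
  refine hκ.of_le (aestronglyMeasurable_of_weight hc (fun y => Complex.ofReal_ne_zero.2
      (Real.rpow_pos_of_pos (jap_pos y) r).ne') hκ.1) (ae_of_all _ fun y => ?_)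
  rw [norm_mul, norm_ofReal_rpow (jap_pos _)]
  exact le_mul_of_one_le_left (norm_nonneg _) (Real.one_le_rpow (one_le_jap _) hr)

/-- For `X ∈ H^m` and `φ ∈ H^{m+1/2}`, the distribution `Ξ₊⁻¹(e⁺r⁺X + φ ⊗ δ)` is square-integrable,
supported in the closed half-space, and its restriction to the open half-space is in `H̄^{m+1}`. -/
theorem exists_resolvent_extension {m : ℝ} (hm : 0 ≤ m) : ∃ C : ℝ≥0∞, C ≠ ⊤ ∧
    ∀ {X Y : 𝓢'(Full d, ℂ)} {φ : 𝓢'(Bdry d, ℂ)} {k : Full d → ℂ} {κ : Bdry d → ℂ},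
    HasFT X k → MemLp (fun ξ => ((fjap ξ ^ m : ℝ) : ℂ) * k ξ) 2 → IsCut X Y → HasFT φ κ →
    MemLp (fun y => ((jap y ^ (m + 1 / 2) : ℝ) : ℂ) * κ y) 2 →
    IsL2 (fourierMultiplierCLM ℂ (lam 1 (-1)) (Y + layer φ)) ∧
    Van (-1) (fourierMultiplierCLM ℂ (lam 1 (-1)) (Y + layer φ)) ∧
    ∃ G g, HasFT G g ∧ MemLp (fun ξ => (bessel (m + 1) ξ : ℂ) * g ξ) 2 ∧
      eLpNorm (fun ξ => (bessel (m + 1) ξ : ℂ) * g ξ) 2 ≤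
        C * (eLpNorm (fun ξ => ((fjap ξ ^ m : ℝ) : ℂ) * k ξ) 2 +
          eLpNorm (fun y => ((jap y ^ (m + 1 / 2) : ℝ) : ℂ) * κ y) 2) ∧
      restr (halfSpace d) G =
        restr (halfSpace d) (fourierMultiplierCLM ℂ (lam 1 (-1)) (Y + layer φ)) := by
  -- With N ≥ m + 1, the product ⟨ξ⟩^{m+1}(⟨ξ'⟩/⟨ξ⟩)^N⟨ξ⟩^{-1} is at most ⟨ξ'⟩^{m+1}⟨ξ⟩^{-1}: only
  -- tangential weights remain.
  obtain ⟨N, hN⟩ := exists_nat_ge (m + 1)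
  -- The factor 2^N comes from the 2 in `quot`. One factor 2 arises because k occurs in both terms
  -- of the extension, the other because the truncation is bounded by k once more.
  refine ⟨ENNReal.ofReal (2 * 2 ^ N) * 2, by finiteness, ?_⟩
  intro X Y φ k κ hX hk hc hφ hκ
  obtain ⟨hjk, hjk'⟩ := jap_mul_le_fjap_mul hm hk
  obtain ⟨l, hY, hl, hl'⟩ := hc.exists_hasFT hm hX hjk
  have hκ2 := memLp_of_bdry_weight (by linarith) hκ
  obtain ⟨hw, hw'⟩ := memLp_layer_term hκ
  have hT := hY.add (hφ.layer hκ2)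
  have hkm : AEStronglyMeasurable k volume := (memLp_of_jap_mul hm hjk).1
  have hlm : AEStronglyMeasurable l volume := (memLp_of_jap_mul hm hl).1
  have hκm : AEStronglyMeasurable (fun ξ : Full d => κ (tang d ξ)) volume :=
    hκ2.1.comp_quasiMeasurePreserving quasiMeasurePreserving_tang
  have hpm : AEStronglyMeasurable (lam (d := d) 1 (-1)) volume :=
    (temperate_lam_one _).1.continuous.aestronglyMeasurable
  have hqm : AEStronglyMeasurable (fun ξ : Full d => quot ξ ^ N) volume :=
    (temperate_quot_pow N).1.continuous.aestronglyMeasurable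
  have hbm : AEStronglyMeasurable (fun ξ : Full d => (bessel (m + 1) ξ : ℂ)) volume :=
    (hasTemperateGrowth_bessel (m + 1)).1.continuous.aestronglyMeasurable
  have hp : ∀ ξ : Full d, ‖lam 1 (-1) ξ‖ = fjap ξ ^ (-1 : ℝ) := norm_lam (by norm_num) (-1)
  -- The extension is G = Ξ₊^{-1}X + `quot`^N Ξ₊^{-1}(Y + φ⊗δ - X). The first term is in H^{m+1}; in
  -- the second, the bracket vanishes on x_n > 0, so the factor `quot`^N is invisible there.
  refine ⟨(hT.mult (temperate_lam_one _)).isL2 ?_, (hc.van_neg.add (van_layer _ _)).mult_lam_one _,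
    _, _, (hX.mult (temperate_lam_one (-1))).add ((hT.sub hX).mult
      (temperate_quot_pow_mul N)), ?_⟩
  · refine (memLp_of_norm_le_three (c := 1) hl hw hw
      (h := fun ξ => lam 1 (-1) ξ * (l ξ + κ (tang d ξ))) (hpm.mul (hlm.add hκm)) fun ξ => ?_).1
    have hf1 : fjap ξ ^ (-1 : ℝ) ≤ 1 :=
      Real.rpow_le_one_of_one_le_of_nonpos (one_le_fjap ξ) (by norm_num)
    have hf0 : 0 < fjap ξ ^ (-1 : ℝ) := Real.rpow_pos_of_pos (fjap_pos ξ) _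
    have hj : 1 ≤ jap (tang d ξ) ^ m := Real.one_le_rpow (one_le_jap _) hm
    have hj' : 1 ≤ jap (tang d ξ) ^ (m + 1) := Real.one_le_rpow (one_le_jap _) (by linarith)
    rw [norm_mul, hp, norm_mul, norm_mul, norm_mul, norm_ofReal_rpow (jap_pos _),
      norm_ofReal_rpow (jap_pos _), norm_ofReal_rpow (fjap_pos _)]
    have h1 : fjap ξ ^ (-1 : ℝ) * ‖l ξ‖ ≤ jap (tang d ξ) ^ m * ‖l ξ‖ := by gcongr; linarith
    have h2 : fjap ξ ^ (-1 : ℝ) * ‖κ (tang d ξ)‖ ≤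
        jap (tang d ξ) ^ (m + 1) * fjap ξ ^ (-1 : ℝ) * ‖κ (tang d ξ)‖ := by
      gcongr
      exact le_mul_of_one_le_left hf0.le hj'
    have h3 := mul_le_mul_of_nonneg_left (norm_add_le (l ξ) (κ (tang d ξ))) hf0.le
    have h4 : 0 ≤ jap (tang d ξ) ^ (m + 1) * fjap ξ ^ (-1 : ℝ) * ‖κ (tang d ξ)‖ := by positivity
    linarith
  · have hmain := memLp_of_norm_le_three (c := 2 * 2 ^ N) hk hl hw
      (h := fun ξ => (bessel (m + 1) ξ : ℂ) * (lam 1 (-1) ξ * k ξ +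
        quot ξ ^ N * lam 1 (-1) ξ * (l ξ + κ (tang d ξ) - k ξ)))
      (hbm.mul ((hpm.mul hkm).add ((hqm.mul hpm).mul ((hlm.add hκm).sub hkm)))) fun ξ => by
      have hF := fjap_pos ξ
      have hJ := jap_pos (tang d ξ)
      have hJF := jap_le_fjap ξ
      have hb := bessel_le_fjap (s := m + 1) (by linarith) ξ
      have hb0 : 0 ≤ bessel (m + 1) ξ := (bessel_pos _ _).le
      have hq : ‖quot ξ ^ N * lam 1 (-1) ξ‖ =
          2 ^ N * (jap (tang d ξ) ^ (N : ℝ) * fjap ξ ^ (-(N : ℝ) - 1)) := by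
        rw [norm_mul, norm_pow, quot, norm_mul, norm_lam (by norm_num), hp, Complex.norm_real,
          Real.norm_of_nonneg (by positivity), mul_pow, mul_pow, ← Real.rpow_natCast (fjap ξ ^ _),
          ← Real.rpow_mul hF.le, Real.rpow_natCast, mul_assoc, mul_assoc, ← Real.rpow_add hF]
        congr 3
        ring_nf
      have e1 : fjap ξ ^ (m + 1) * fjap ξ ^ (-1 : ℝ) = fjap ξ ^ m := by
        rw [← Real.rpow_add hF]; ring_nf
      have e2 : fjap ξ ^ (m + 1) * (jap (tang d ξ) ^ (N : ℝ) * fjap ξ ^ (-(N : ℝ) - 1)) ≤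
          jap (tang d ξ) ^ (m + 1) * fjap ξ ^ (-1 : ℝ) := by
        have e3 : fjap ξ ^ (m + 1) * (jap (tang d ξ) ^ (N : ℝ) * fjap ξ ^ (-(N : ℝ) - 1)) =
            jap (tang d ξ) ^ (m + 1) * jap (tang d ξ) ^ ((N : ℝ) - (m + 1)) *
              (fjap ξ ^ (-((N : ℝ) - (m + 1))) * fjap ξ ^ (-1 : ℝ)) := by
          rw [← Real.rpow_add hJ, ← Real.rpow_add hF, mul_left_comm, ← Real.rpow_add hF]
          ring_nf
        have e4 : jap (tang d ξ) ^ ((N : ℝ) - (m + 1)) * fjap ξ ^ (-((N : ℝ) - (m + 1))) ≤ 1 := by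
          rw [Real.rpow_neg hF.le, ← div_eq_mul_inv, div_le_one (by positivity)]
          exact Real.rpow_le_rpow hJ.le hJF (by linarith)
        calc _ = (jap (tang d ξ) ^ ((N : ℝ) - (m + 1)) * fjap ξ ^ (-((N : ℝ) - (m + 1)))) *
              (jap (tang d ξ) ^ (m + 1) * fjap ξ ^ (-1 : ℝ)) := by rw [e3]; ring
          _ ≤ 1 * (jap (tang d ξ) ^ (m + 1) * fjap ξ ^ (-1 : ℝ)) := by gcongr
          _ = _ := one_mul _
      have e5 : jap (tang d ξ) ^ (m + 1) * fjap ξ ^ (-1 : ℝ) ≤ jap (tang d ξ) ^ m := by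
        rw [Real.rpow_add hJ, Real.rpow_one, Real.rpow_neg hF.le, Real.rpow_one, mul_assoc]
        refine mul_le_of_le_one_right (by positivity) ?_
        rw [← div_eq_mul_inv, div_le_one hF]
        exact hJF
      have e6 : jap (tang d ξ) ^ m ≤ fjap ξ ^ m := Real.rpow_le_rpow hJ.le hJF hm
      have e7 : (1 : ℝ) ≤ 2 ^ N := one_le_pow₀ (by norm_num)
      simp only [norm_mul, norm_ofReal_rpow hJ, norm_ofReal_rpow hF]
      set F := fjap ξ ^ (m + 1) * (jap (tang d ξ) ^ (N : ℝ) * fjap ξ ^ (-(N : ℝ) - 1)) with hFdef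
      have hF0 : 0 ≤ F := by positivity
      set κ' := ‖κ (tang d ξ)‖
      set w := jap (tang d ξ) ^ (m + 1) * fjap ξ ^ (-1 : ℝ)
      have t1 : ‖lam 1 (-1) ξ * k ξ + quot ξ ^ N * lam 1 (-1) ξ * (l ξ + κ (tang d ξ) - k ξ)‖ ≤
          fjap ξ ^ (-1 : ℝ) * ‖k ξ‖ +
          2 ^ N * (jap (tang d ξ) ^ (N : ℝ) * fjap ξ ^ (-(N : ℝ) - 1)) *
            (‖l ξ‖ + κ' + ‖k ξ‖) := by
        refine (norm_add_le _ _).trans ?_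
        rw [norm_mul, hp, norm_mul (quot ξ ^ N * lam 1 (-1) ξ), hq]
        gcongr
        exact (norm_sub_le _ _).trans (by gcongr; exact norm_add_le _ _)
      rw [Complex.norm_real, Real.norm_of_nonneg hb0]
      calc _ ≤ fjap ξ ^ (m + 1) * (fjap ξ ^ (-1 : ℝ) * ‖k ξ‖ +
          2 ^ N * (jap (tang d ξ) ^ (N : ℝ) * fjap ξ ^ (-(N : ℝ) - 1)) *
            (‖l ξ‖ + κ' + ‖k ξ‖)) := by gcongr
        _ = fjap ξ ^ m * ‖k ξ‖ + 2 ^ N * (F * ‖l ξ‖ + F * κ' + F * ‖k ξ‖) := by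
          rw [← e1, hFdef]; ring
        _ ≤ 2 ^ N * (fjap ξ ^ m * ‖k ξ‖) +
            2 ^ N * (jap (tang d ξ) ^ m * ‖l ξ‖ + w * κ' + fjap ξ ^ m * ‖k ξ‖) := by
          have u0 : fjap ξ ^ m * ‖k ξ‖ ≤ 2 ^ N * (fjap ξ ^ m * ‖k ξ‖) :=
            le_mul_of_one_le_left (by positivity) e7
          have u1 : F * ‖l ξ‖ ≤ jap (tang d ξ) ^ m * ‖l ξ‖ :=
            mul_le_mul_of_nonneg_right (e2.trans e5) (norm_nonneg _)
          have u2 : F * κ' ≤ w * κ' := mul_le_mul_of_nonneg_right e2 (norm_nonneg _)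
          have u3 : F * ‖k ξ‖ ≤ fjap ξ ^ m * ‖k ξ‖ :=
            mul_le_mul_of_nonneg_right (e2.trans (e5.trans e6)) (norm_nonneg _)
          exact add_le_add u0 (mul_le_mul_of_nonneg_left
            (add_le_add (add_le_add u1 u2) u3) (by positivity))
        _ ≤ _ := by
          have t2 : 0 ≤ (2 : ℝ) ^ N * (jap (tang d ξ) ^ m * ‖l ξ‖) := by positivity
          have t3 : 0 ≤ (2 : ℝ) ^ N * (w * κ') := by positivity
          linarith
    refine ⟨hmain.1, hmain.2.trans ?_, ?_⟩
    · rw [mul_assoc]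
      gcongr
      rw [two_mul]
      calc _ ≤ eLpNorm (fun ξ => ((fjap ξ ^ m : ℝ) : ℂ) * k ξ) 2 +
            eLpNorm (fun ξ => ((fjap ξ ^ m : ℝ) : ℂ) * k ξ) 2 +
            eLpNorm (fun y => ((jap y ^ (m + 1 / 2) : ℝ) : ℂ) * κ y) 2 := by
            gcongr
            exact hl'.trans hjk'
        _ ≤ _ := by
          rw [add_assoc]
          exact add_le_add_left le_self_add _
    · refine Van.restr_eq ?_
      have hW : Van 1 (Y + layer φ - X) := by
        have h1 : Y + layer φ - X = layer φ - (X - Y) := by abel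
        rw [h1]
        exact (van_layer _ _).sub hc.van_sub
      have h2 := hW.mult_sub_mult_pow N
      rw [map_sub (fourierMultiplierCLM ℂ (lam 1 (-1))) (Y + layer φ) X] at h2
      convert h2 using 1
      abel

end Resolvent


/-! ### Oscillatory integrals with a weight `x^{a-1}` -/

section HalfLineIntegral

open Set

theorem integrableOn_rpow_mul_one_add {a s : ℝ} (ha : 0 < a) (hs : a < s) :
    IntegrableOn (fun x : ℝ => x ^ (a - 1) * (1 + x) ^ (-s)) (Ioi 0) := by
  have hm : Measurable fun x : ℝ => x ^ (a - 1) * (1 + x) ^ (-s) := by fun_prop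
  rw [← Ioc_union_Ioi_eq_Ioi zero_le_one]
  refine IntegrableOn.union ?_ ?_
  · have h1 : IntegrableOn (fun x : ℝ => x ^ (a - 1)) (Ioc 0 1) :=
      (intervalIntegral.intervalIntegrable_rpow' (by linarith)).1
    refine Integrable.mono' h1 hm.aestronglyMeasurable ?_
    filter_upwards [ae_restrict_mem measurableSet_Ioc] with x hx
    rw [Real.norm_of_nonneg (mul_nonneg (Real.rpow_nonneg hx.1.le _)
      (Real.rpow_nonneg (by linarith [hx.1]) _))]
    exact mul_le_of_le_one_right (Real.rpow_nonneg hx.1.le _)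
      (Real.rpow_le_one_of_one_le_of_nonpos (by linarith [hx.1]) (by linarith))
  · refine Integrable.mono' (integrableOn_Ioi_rpow_of_lt (a := a - 1 - s) (by linarith) one_pos)
      hm.aestronglyMeasurable ?_
    filter_upwards [ae_restrict_mem measurableSet_Ioi] with x hx
    have hx' : (1 : ℝ) < x := hx
    have hx0 : 0 < x := by linarith
    rw [Real.norm_of_nonneg (mul_nonneg (Real.rpow_nonneg hx0.le _)
      (Real.rpow_nonneg (by linarith) _)), sub_eq_add_neg (a - 1), Real.rpow_add hx0]
    exact mul_le_mul_of_nonneg_left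
      (Real.rpow_le_rpow_of_nonpos hx0 (by linarith) (by linarith)) (Real.rpow_nonneg hx0.le _)

/-- The value of `∫₀^∞ x^{a-1} / (1+x) dx`. -/
def weightMass (a : ℝ) : ℝ := ∫ x in Ioi (0 : ℝ), x ^ (a - 1) * (1 + x) ^ (-1 : ℝ)

theorem weightMass_nonneg (a : ℝ) : 0 ≤ weightMass a :=
  setIntegral_nonneg measurableSet_Ioi fun x hx => by
    have : (0 : ℝ) < x := hx
    positivity

theorem measurable_ofReal_rpow (r : ℝ) : Measurable fun x : ℝ => ((x ^ r : ℝ) : ℂ) :=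
  Complex.measurable_ofReal.comp (measurable_id.pow_const r)

variable {a K : ℝ} {f f' f'' : ℝ → ℂ}

theorem integrableOn_of_le_weight (ha : 0 < a) (ha1 : a < 1) {g : ℝ → ℂ} (hg : Measurable g)
    (h : ∀ x, 0 < x → ‖g x‖ ≤ K * (x ^ (a - 1) * (1 + x) ^ (-1 : ℝ))) :
    IntegrableOn g (Ioi 0) ∧ ‖∫ x in Ioi (0 : ℝ), g x‖ ≤ K * weightMass a := by
  have hi := (integrableOn_rpow_mul_one_add ha ha1).const_mul K
  have h' : ∀ᵐ x ∂(volume.restrict (Ioi (0 : ℝ))),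
      ‖g x‖ ≤ K * (x ^ (a - 1) * (1 + x) ^ (-1 : ℝ)) := by
    filter_upwards [ae_restrict_mem measurableSet_Ioi] with x hx using h x hx
  refine ⟨Integrable.mono' hi hg.aestronglyMeasurable h', ?_⟩
  refine (norm_integral_le_of_norm_le hi h').trans ?_
  rw [integral_const_mul]
  rfl

theorem norm_cexp_mul_I (t : ℝ) (z : ℂ) : ‖Complex.exp ((t : ℂ) * Complex.I) * z‖ = ‖z‖ := by
  rw [norm_mul, Complex.norm_exp_ofReal_mul_I, one_mul]

/-- Decay of the oscillatory integral of `x^{a-1} f` when `f` vanishes to second order at `0`. -/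
theorem sq_mul_norm_integral_le (ha : 0 < a) (ha1 : a < 1) (hK : 0 ≤ K)
    (hf : ∀ x, HasDerivAt f (f' x) x) (hf' : ∀ x, HasDerivAt f' (f'' x) x)
    (hf'' : Measurable f'') (h0 : f 0 = 0) (h0' : f' 0 = 0)
    (b : ∀ x, 0 ≤ x → ‖f x‖ ≤ K * (1 + x) ^ (-1 : ℝ)) (b' : ∀ x, 0 ≤ x → ‖f' x‖ ≤ K)
    (b'' : ∀ x, 0 ≤ x → ‖f'' x‖ ≤ K * (1 + x) ^ (-1 : ℝ)) (τ : ℝ) :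
    (1 + τ ^ 2) * ‖∫ x in Ioi (0 : ℝ), ((x ^ (a - 1) : ℝ) : ℂ) *
      (Complex.exp (((-(x * τ) : ℝ) : ℂ) * Complex.I) * f x)‖ ≤ 10 * K * weightMass a := by
  have hfc : Continuous f := continuous_iff_continuousAt.2 fun x => (hf x).continuousAt
  have hfc' : Continuous f' := continuous_iff_continuousAt.2 fun x => (hf' x).continuousAt
  have hi1 : ∀ x : ℝ, 0 ≤ x → (1 + x) ^ (-1 : ℝ) = (1 + x)⁻¹ := fun x hx => Real.rpow_neg_one _
  have hi2 : ∀ x : ℝ, 0 ≤ x → (1 + x) ^ (-1 : ℝ) ≤ 1 := fun x hx => by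
    rw [hi1 x hx]; exact inv_le_one_of_one_le₀ (by linarith)
  have c'' : ∀ x, 0 ≤ x → ‖f'' x‖ ≤ K := fun x hx =>
    (b'' x hx).trans (mul_le_of_le_one_right hK (hi2 x hx))
  have c' : ∀ x, 0 ≤ x → ‖f' x‖ ≤ K * x := fun x hx => by
    have := (convex_Icc 0 x).norm_image_sub_le_of_norm_hasDerivWithin_le (f := f')
      (fun z _ => (hf' z).hasDerivWithinAt) (fun z hz => c'' z hz.1) (left_mem_Icc.2 hx)
      (right_mem_Icc.2 hx)
    simpa [h0', abs_of_nonneg hx] using this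
  -- Adding the bounds |f'| ≤ Kx and x|f'| ≤ Kx gives one estimate that is good both at 0 and at
  -- infinity.
  have e' : ∀ x, 0 ≤ x → ‖f' x‖ ≤ 2 * K * x * (1 + x) ^ (-1 : ℝ) := fun x hx => by
    rw [hi1 x hx, ← div_eq_mul_inv, le_div_iff₀ (by linarith)]
    have h1 := c' x hx
    have h2 := mul_le_mul_of_nonneg_right (b' x hx) hx
    linarith
  have e : ∀ x, 0 ≤ x → ‖f x‖ ≤ 2 * K * x * (1 + x) ^ (-1 : ℝ) * x := fun x hx => by
    have := (convex_Icc 0 x).norm_image_sub_le_of_norm_hasDerivWithin_le (f := f)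
      (C := 2 * K * x * (1 + x) ^ (-1 : ℝ))
      (fun z _ => (hf z).hasDerivWithinAt) (fun z hz => (e' z hz.1).trans ?_) (left_mem_Icc.2 hx)
      (right_mem_Icc.2 hx)
    · simpa [h0, abs_of_nonneg hx] using this
    · rw [hi1 x hx, hi1 z hz.1, ← div_eq_mul_inv, ← div_eq_mul_inv,
        div_le_div_iff₀ (by linarith [hz.1]) (by linarith)]
      nlinarith [mul_le_mul_of_nonneg_left hz.2 hK]
  set E : ℝ → ℂ := fun x => Complex.exp (((-(x * τ) : ℝ) : ℂ) * Complex.I) with hE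
  have hEd : ∀ x, HasDerivAt E (-(τ * Complex.I) * E x) x := fun x => by
    have h1 : HasDerivAt (fun x : ℝ => ((-(x * τ) : ℝ) : ℂ) * Complex.I)
        (((-(1 * τ) : ℝ) : ℂ) * Complex.I) x :=
      (((hasDerivAt_id x).mul_const τ).neg.ofReal_comp).mul_const _
    convert! h1.cexp using 1
    simp only [hE]
    push_cast
    ring
  have hEm : Measurable E := by
    have : Continuous E := continuous_iff_continuousAt.2 fun x => (hEd x).continuousAt
    exact this.measurable
  have hEn : ∀ x z, ‖E x * z‖ = ‖z‖ := fun x z => norm_cexp_mul_I _ z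
  set p : ℝ → ℝ → ℂ := fun r x => ((x ^ r : ℝ) : ℂ) with hp
  have hpm : ∀ r, Measurable (p r) := measurable_ofReal_rpow
  have hpn : ∀ r x, 0 ≤ x → ‖p r x‖ = x ^ r := fun r x hx => by
    simp only [hp, Complex.norm_real, Real.norm_of_nonneg (Real.rpow_nonneg hx _)]
  have hpd : ∀ r x, 0 < x → HasDerivAt (p r) (r * p (r - 1) x) x := fun r x hx => by
    have := (Real.hasDerivAt_rpow_const (x := x) (p := r) (Or.inl hx.ne')).ofReal_comp
    simpa [hp] using this
  have hps : ∀ (r x : ℝ), 0 < x → x ^ (r - 1) * x = x ^ r := fun r x hx => by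
    rw [← Real.rpow_add_one hx.ne']; ring_nf
  -- Y0 = x^{a-1}f, with first and second derivatives Y1 and Y2. Second-order vanishing of f at 0
  -- compensates the two powers of x lost by differentiating x^{a-1}.
  set Y0 : ℝ → ℂ := fun x => p (a - 1) x * f x with hY0
  set Y1 : ℝ → ℂ := fun x => ((a - 1 : ℝ) : ℂ) * p (a - 1 - 1) x * f x + p (a - 1) x * f' x with hY1
  set Y2 : ℝ → ℂ := fun x => ((a - 1 : ℝ) : ℂ) * (((a - 1 - 1 : ℝ) : ℂ) * p (a - 1 - 1 - 1) x) * f x +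
    2 * ((a - 1 : ℝ) : ℂ) * p (a - 1 - 1) x * f' x + p (a - 1) x * f'' x with hY2
  have hY0d : ∀ x, 0 < x → HasDerivAt Y0 (Y1 x) x := fun x hx => by
    convert! (hpd (a - 1) x hx).mul (hf x) using 1
  have hY1d : ∀ x, 0 < x → HasDerivAt Y1 (Y2 x) x := fun x hx => by
    convert! (((hpd (a - 1 - 1) x hx).const_mul ((a - 1 : ℝ) : ℂ)).mul (hf x)).add
      ((hpd (a - 1) x hx).mul (hf' x)) using 1
    simp only [hY2]
    push_cast
    ring
  have n0 : ∀ x, 0 < x → ‖E x * Y0 x‖ ≤ K * (x ^ (a - 1) * (1 + x) ^ (-1 : ℝ)) := fun x hx => by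
    rw [hEn, norm_mul, hpn _ x hx.le, mul_left_comm]
    exact mul_le_mul_of_nonneg_left (b x hx.le) (Real.rpow_nonneg hx.le _)
  have habs1 : ‖((a - 1 : ℝ) : ℂ)‖ ≤ 1 := by
    rw [Complex.norm_real, Real.norm_eq_abs, abs_le]; constructor <;> linarith
  have habs2 : ‖((a - 1 - 1 : ℝ) : ℂ)‖ ≤ 2 := by
    rw [Complex.norm_real, Real.norm_eq_abs, abs_le]; constructor <;> linarith
  -- The constant is 9 = 4 + 4 + 1, from the three terms of Y2; the term with f'' needs no vanishing
  -- at 0.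
  have n2 : ∀ x, 0 < x → ‖E x * Y2 x‖ ≤ 9 * K * (x ^ (a - 1) * (1 + x) ^ (-1 : ℝ)) := fun x hx => by
    have q1 : ‖((a - 1 : ℝ) : ℂ) * (((a - 1 - 1 : ℝ) : ℂ) * p (a - 1 - 1 - 1) x) * f x‖ ≤
        1 * (2 * x ^ (a - 1 - 1 - 1)) * (2 * K * x * (1 + x) ^ (-1 : ℝ) * x) := by
      rw [norm_mul, norm_mul, norm_mul, hpn _ x hx.le]
      have := e x hx.le
      gcongr
    have q2 : ‖2 * ((a - 1 : ℝ) : ℂ) * p (a - 1 - 1) x * f' x‖ ≤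
        2 * 1 * x ^ (a - 1 - 1) * (2 * K * x * (1 + x) ^ (-1 : ℝ)) := by
      rw [norm_mul, norm_mul, norm_mul, hpn _ x hx.le, Complex.norm_ofNat]
      have := e' x hx.le
      gcongr
    have q3 : ‖p (a - 1) x * f'' x‖ ≤ x ^ (a - 1) * (K * (1 + x) ^ (-1 : ℝ)) := by
      rw [norm_mul, hpn _ x hx.le]
      have := b'' x hx.le
      gcongr
    have s1 := hps (a - 1) x hx
    have s2 := hps (a - 1 - 1) x hx
    have r1 : 1 * (2 * x ^ (a - 1 - 1 - 1)) * (2 * K * x * (1 + x) ^ (-1 : ℝ) * x) =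
        4 * K * (x ^ (a - 1) * (1 + x) ^ (-1 : ℝ)) := by
      rw [← s1, ← s2]; ring
    have r2 : 2 * 1 * x ^ (a - 1 - 1) * (2 * K * x * (1 + x) ^ (-1 : ℝ)) =
        4 * K * (x ^ (a - 1) * (1 + x) ^ (-1 : ℝ)) := by
      rw [← s1]; ring
    rw [hEn]
    refine (norm_add₃_le).trans ?_
    rw [r1] at q1
    rw [r2] at q2
    linarith
  obtain ⟨i0, m0⟩ := integrableOn_of_le_weight ha ha1
    (hEm.mul ((hpm _).mul hfc.measurable)) n0
  obtain ⟨i2, m2⟩ := integrableOn_of_le_weight ha ha1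
    (hEm.mul (((((hpm _).const_mul _).const_mul _).mul hfc.measurable).add
      (((hpm _).const_mul _).mul hfc'.measurable) |>.add ((hpm _).mul hf''))) n2
  replace i0 : IntegrableOn (fun x => E x * Y0 x) (Ioi 0) := i0
  replace i2 : IntegrableOn (fun x => E x * Y2 x) (Ioi 0) := i2
  replace m0 : ‖∫ x in Ioi (0 : ℝ), E x * Y0 x‖ ≤ K * weightMass a := m0
  replace m2 : ‖∫ x in Ioi (0 : ℝ), E x * Y2 x‖ ≤ 9 * K * weightMass a := m2
  -- Two integrations by parts at once: E(Y1 + iτY0) is a primitive of E·Y2 + τ²E·Y0 and vanishes at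
  -- both ends, so τ²∫E·Y0 = -∫E·Y2.
  have hΦd : ∀ x ∈ Ioi (0 : ℝ), HasDerivAt (fun x => E x * (Y1 x + τ * Complex.I * Y0 x))
      (E x * Y2 x + (τ ^ 2 : ℂ) * (E x * Y0 x)) x := fun x hx => by
    convert! (hEd x).mul ((hY1d x hx).add ((hY0d x hx).const_mul (τ * Complex.I))) using 1
    simp only [Pi.add_apply]
    linear_combination ((τ : ℂ) ^ 2 * (E x * Y0 x)) * Complex.I_sq
  have nΦ : ∀ x, ‖E x * (Y1 x + τ * Complex.I * Y0 x)‖ ≤ ‖Y1 x‖ + |τ| * ‖Y0 x‖ := fun x => by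
    rw [hEn]
    refine (norm_add_le _ _).trans ?_
    simp
  have hΦ0 : ContinuousWithinAt (fun x => E x * (Y1 x + τ * Complex.I * Y0 x)) (Ici 0) 0 := by
    have z0 : E 0 * (Y1 0 + τ * Complex.I * Y0 0) = 0 := by simp [hY1, hY0, h0, h0']
    rw [ContinuousWithinAt, z0]
    have hlim : Tendsto (fun x : ℝ => 4 * K * x ^ a + |τ| * (2 * K * x ^ (a + 1))) (𝓝[Ici 0] 0)
        (𝓝 0) := by
      have hc : Continuous fun x : ℝ => 4 * K * x ^ a + |τ| * (2 * K * x ^ (a + 1)) := by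
        have h1 := Real.continuous_rpow_const ha.le
        have h2 := Real.continuous_rpow_const (q := a + 1) (by linarith)
        fun_prop
      have := (hc.tendsto 0).mono_left (nhdsWithin_le_nhds (s := Ici 0))
      simpa [Real.zero_rpow ha.ne', Real.zero_rpow (by linarith : a + 1 ≠ 0)] using this
    refine squeeze_zero_norm' ?_ hlim
    filter_upwards [self_mem_nhdsWithin] with x hx
    have hx' : (0 : ℝ) ≤ x := hx
    rcases hx'.eq_or_lt with rfl | hx0
    · simp [hY1, hY0, h0, h0', Real.zero_rpow ha.ne', Real.zero_rpow (by linarith : a + 1 ≠ 0)]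
    have f1 : ‖f x‖ ≤ 2 * K * x * x := (e x hx0.le).trans (by
      have := hi2 x hx0.le
      have h3 : 2 * K * x * (1 + x) ^ (-1 : ℝ) ≤ 2 * K * x * 1 := by gcongr
      nlinarith)
    have f2 : ‖f' x‖ ≤ 2 * K * x := (e' x hx0.le).trans
      (mul_le_of_le_one_right (by positivity) (hi2 x hx0.le))
    have s0 := hps a x hx0
    have s1 := hps (a - 1) x hx0
    have s3 : x ^ a * x = x ^ (a + 1) := (Real.rpow_add_one hx0.ne' a).symm
    have g0 : ‖Y0 x‖ ≤ x ^ (a - 1) * (2 * K * x * x) := by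
      rw [hY0, norm_mul, hpn _ x hx0.le]; gcongr
    have g1 : ‖Y1 x‖ ≤ 1 * x ^ (a - 1 - 1) * (2 * K * x * x) + x ^ (a - 1) * (2 * K * x) := by
      refine (norm_add_le _ _).trans ?_
      rw [norm_mul, norm_mul, norm_mul, hpn _ x hx0.le, hpn _ x hx0.le]
      gcongr
    refine (nΦ x).trans (add_le_add (g1.trans (le_of_eq ?_))
      (mul_le_mul_of_nonneg_left (g0.trans (le_of_eq ?_)) (abs_nonneg τ)))
    · rw [← s0, ← s1]; ring
    · rw [← s3, ← s0]; ring
  have hΦi : Tendsto (fun x => E x * (Y1 x + τ * Complex.I * Y0 x)) atTop (𝓝 0) := by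
    have hlim : Tendsto (fun x : ℝ => x ^ (-(2 - a)) * K + x ^ (-(1 - a)) * K +
        |τ| * (x ^ (-(1 - a)) * K)) atTop (𝓝 (0 * K + 0 * K + |τ| * (0 * K))) := by
      have h1 := tendsto_rpow_neg_atTop (y := 2 - a) (by linarith)
      have h2 := tendsto_rpow_neg_atTop (y := 1 - a) (by linarith)
      exact ((h1.mul_const K).add (h2.mul_const K)).add ((h2.mul_const K).const_mul _)
    simp only [zero_mul, mul_zero, add_zero] at hlim
    refine squeeze_zero_norm' ?_ hlim
    filter_upwards [eventually_gt_atTop 0] with x hx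
    have hb := (b x hx.le).trans (mul_le_of_le_one_right hK (hi2 x hx.le))
    have g0 : ‖Y0 x‖ ≤ x ^ (a - 1) * K := by
      rw [hY0, norm_mul, hpn _ x hx.le]; gcongr
    have g1 : ‖Y1 x‖ ≤ 1 * x ^ (a - 1 - 1) * K + x ^ (a - 1) * K := by
      refine (norm_add_le _ _).trans ?_
      rw [norm_mul, norm_mul, norm_mul, hpn _ x hx.le, hpn _ x hx.le]
      have := b' x hx.le
      gcongr
    have r1 : -(2 - a) = a - 1 - 1 := by ring
    have r2 : -(1 - a) = a - 1 := by ring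
    rw [r1, r2]
    refine (nΦ x).trans (add_le_add (g1.trans (by rw [one_mul]))
      (mul_le_mul_of_nonneg_left g0 (abs_nonneg τ)))
  have hftc := integral_Ioi_of_hasDerivAt_of_tendsto hΦ0 hΦd (i2.add (i0.const_mul _)) hΦi
  have z0 : E 0 * (Y1 0 + τ * Complex.I * Y0 0) = 0 := by simp [hY1, hY0, h0, h0']
  rw [z0, sub_zero, integral_add i2 (i0.const_mul _), integral_const_mul] at hftc
  have hR : (∫ x in Ioi (0 : ℝ), ((x ^ (a - 1) : ℝ) : ℂ) * (E x * f x)) =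
      ∫ x in Ioi (0 : ℝ), E x * Y0 x :=
    integral_congr_ae (ae_of_all _ fun x => by simp only [hY0, hp]; ring)
  rw [hR]
  have h2 : τ ^ 2 * ‖∫ x in Ioi (0 : ℝ), E x * Y0 x‖ = ‖∫ x in Ioi (0 : ℝ), E x * Y2 x‖ := by
    rw [eq_neg_of_add_eq_zero_left hftc, norm_neg, norm_mul]
    simp
  rw [add_mul, one_mul, h2]
  linarith

end HalfLineIntegral


/-! ### The Fourier transform of `e⁺ x_n^{a-1} w` -/

section PowMul

open FourierTransform Set
open scoped LineDeriv

variable {d : ℕ} {a : ℝ}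

/-- The one-sided Fourier transform in `x_n` of `x_n^{a-1} B(ξ', x_n)`. -/
def halfFT (a : ℝ) (B : 𝓢(Full d, ℂ)) (ξ : Full d) : ℂ :=
  ∫ x in Ioi (0 : ℝ), ((x ^ (a - 1) : ℝ) : ℂ) *
    (Complex.exp (((-(x * (2 * Real.pi * normal d ξ)) : ℝ) : ℂ) * Complex.I) * B (mk (tang d ξ) x))

theorem measurable_halfFT (a : ℝ) (B : 𝓢(Full d, ℂ)) : Measurable (halfFT a B) := by
  have hB := B.continuous
  have h : StronglyMeasurable (Function.uncurry fun (ξ : Full d) (x : ℝ) =>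
      ((x ^ (a - 1) : ℝ) : ℂ) * (Complex.exp (((-(x * (2 * Real.pi * normal d ξ)) : ℝ) : ℂ) *
        Complex.I) * B (mk (tang d ξ) x))) := by
    refine Measurable.stronglyMeasurable ?_
    refine ((measurable_ofReal_rpow (a - 1)).comp measurable_snd).mul (Continuous.measurable ?_)
    fun_prop
  exact (h.integral_prod_right (ν := volume.restrict (Ioi (0 : ℝ)))).measurable

theorem measurable_powMulFun (μ : ℝ) (w : 𝓢(Full d, ℂ)) : Measurable (powMulFun μ w) := by
  refine Measurable.indicator ?_ (halfSpace d).isOpen.measurableSet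
  exact ((measurable_ofReal_rpow μ).comp (normal d).continuous.measurable).mul w.continuous.measurable

theorem powMulFun_mk (μ : ℝ) (w : 𝓢(Full d, ℂ)) (y : Bdry d) (t : ℝ) :
    powMulFun μ w (mk y t) = (Ioi (0 : ℝ)).indicator (fun t => ((t ^ μ : ℝ) : ℂ) * w (mk y t)) t := by
  have h1 : (mk y t ∈ (halfSpace d : Set (Full d))) ↔ t ∈ Ioi (0 : ℝ) := by
    change 0 < normal d (mk y t) ↔ 0 < t
    rw [normal_mk]
  by_cases h : t ∈ Ioi (0 : ℝ)
  · rw [indicator_of_mem h, powMulFun, indicator_of_mem (h1.2 h)]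
    simp
  · rw [indicator_of_notMem h, powMulFun, indicator_of_notMem (fun h2 => h (h1.1 h2))]

theorem integrable_powMulFun (ha : 0 < a) (ha1 : a < 1) (w : 𝓢(Full d, ℂ)) :
    Integrable (powMulFun (a - 1) w) := by
  obtain ⟨C, hC, h⟩ := exists_norm_mk_le w (r := Module.finrank ℝ (Bdry d) + 1) (s := 1)
    (by positivity) (by norm_num)
  have h1 : Integrable fun y : Bdry d => C * (1 + ‖y‖) ^ (-((Module.finrank ℝ (Bdry d) : ℝ) + 1)) :=
    (integrable_one_add_norm (by linarith)).const_mul C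
  have h2 : Integrable ((Ioi (0 : ℝ)).indicator
      fun x : ℝ => x ^ (a - 1) * (1 + x) ^ (-1 : ℝ)) :=
    (integrable_indicator_iff measurableSet_Ioi).2 (integrableOn_rpow_mul_one_add ha ha1)
  refine (integrable_mul_mk h1 h2).mono' (measurable_powMulFun _ w).aestronglyMeasurable
    (ae_of_all _ fun z => ?_)
  rw [← mk_tang_normal z, powMulFun_mk, tang_mk, normal_mk]
  by_cases hz : normal d z ∈ Ioi (0 : ℝ)
  · have hz' : (0 : ℝ) < normal d z := hz
    rw [indicator_of_mem hz, indicator_of_mem hz, norm_mul, Complex.norm_real,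
      Real.norm_of_nonneg (Real.rpow_nonneg hz'.le _)]
    have := h (tang d z) (normal d z)
    rw [abs_of_pos hz'] at this
    calc _ ≤ normal d z ^ (a - 1) * (C * ((1 + ‖tang d z‖) ^
          (-((Module.finrank ℝ (Bdry d) : ℝ) + 1)) * (1 + normal d z) ^ (-1 : ℝ))) := by gcongr
      _ = _ := by ring
  · rw [indicator_of_notMem hz, indicator_of_notMem hz]
    simp

/-- By Fubini: the weight depends on x_n alone, so the tangential transform acts directly on w. -/
theorem fourier_powMulFun (ha : 0 < a) (ha1 : a < 1) (w : 𝓢(Full d, ℂ)) (ξ : Full d) :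
    𝓕 (powMulFun (a - 1) w) ξ = halfFT a (partialFourier w) ξ := by
  have hint := integrable_powMulFun ha ha1 w
  have hi : Integrable fun x => Complex.exp (((-2 * Real.pi * inner ℝ x ξ : ℝ) : ℂ) * Complex.I) •
      powMulFun (a - 1) w x := by
    refine hint.mono ?_ (ae_of_all _ fun x => ?_)
    · have hc : Continuous fun x : Full d =>
          Complex.exp (((-2 * Real.pi * inner ℝ x ξ : ℝ) : ℂ) * Complex.I) := by fun_prop
      exact hc.aestronglyMeasurable.smul hint.1
    · rw [norm_smul, Complex.norm_exp_ofReal_mul_I, one_mul]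
  rw [Real.fourier_eq', integral_eq_integral_mk hi, integral_integral_swap (integrable_iff_mk.1 hi),
    halfFT, ← integral_indicator measurableSet_Ioi]
  refine integral_congr_ae (ae_of_all _ fun t => ?_)
  by_cases ht : t ∈ Ioi (0 : ℝ)
  · simp only [powMulFun_mk, indicator_of_mem ht]
    rw [partialFourier_mk, SchwartzMap.fourier_coe, Real.fourier_eq', ← integral_const_mul,
      ← integral_const_mul]
    refine integral_congr_ae (ae_of_all _ fun y => ?_)
    simp only [slice_apply, smul_eq_mul, inner_eq_tang_normal, tang_mk, normal_mk]
    have h1 : Complex.exp (((-2 * Real.pi * (inner ℝ y (tang d ξ) + t * normal d ξ) : ℝ) : ℂ) *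
        Complex.I) = Complex.exp (((-(t * (2 * Real.pi * normal d ξ)) : ℝ) : ℂ) * Complex.I) *
        Complex.exp (((-2 * Real.pi * inner ℝ y (tang d ξ) : ℝ) : ℂ) * Complex.I) := by
      rw [← Complex.exp_add]
      congr 1
      push_cast
      ring
    rw [h1]
    ring
  · simp only [powMulFun_mk, indicator_of_notMem ht]
    simp

theorem powMul_apply (ha : 0 < a) (ha1 : a < 1) (w Θ : 𝓢(Full d, ℂ)) :
    powMul (a - 1) w Θ = ∫ x, Θ x * powMulFun (a - 1) w x := by
  have hint := integrable_powMulFun ha ha1 w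
  rw [powMul, dif_pos hint, Lp.toTemperedDistribution_apply]
  refine integral_congr_ae ?_
  filter_upwards [hint.coeFn_toL1] with x hx
  rw [hx, smul_eq_mul]

/-- The function is integrable but need not be square-integrable (when a ≤ 1/2), so the L₁-theory is
used: its transform is a bounded function and can be moved across the pairing. -/
theorem hasFT_powMul (ha : 0 < a) (ha1 : a < 1) (w : 𝓢(Full d, ℂ)) :
    HasFT (powMul (a - 1) w) (halfFT a (partialFourier w)) := by
  have hint := integrable_powMulFun ha ha1 w
  have hb : ∀ ξ, ‖halfFT a (partialFourier w) ξ‖ ≤ ∫ x, ‖powMulFun (a - 1) w x‖ := fun ξ => by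
    rw [← fourier_powMulFun ha ha1]
    exact VectorFourier.norm_fourierIntegral_le_integral_norm _ _ _ _ _
  refine ⟨fun Θ => ?_, fun Θ => ?_⟩
  · exact (Θ.integrable (μ := volume)).mul_bdd (measurable_halfFT a _).aestronglyMeasurable
      (ae_of_all _ hb)
  · rw [powMul_apply ha ha1]
    have h := VectorFourier.integral_fourierIntegral_smul_eq_flip (L := innerₗ (Full d))
      Real.continuous_fourierChar continuous_inner (Θ.integrable (μ := volume)) hint
    simp only [smul_eq_mul] at h
    rw [flip_innerₗ] at h
    refine Eq.trans ?_ (h.trans ?_)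
    · rfl
    · refine integral_congr_ae (ae_of_all _ fun ξ => ?_)
      simp only [← fourier_powMulFun ha ha1]
      rfl

/-- The `x_n`-derivative of a Schwartz function. -/
def normalDeriv (B : 𝓢(Full d, ℂ)) : 𝓢(Full d, ℂ) := ∂_{(mk 0 1 : Full d)} B

theorem hasDerivAt_normal (B : 𝓢(Full d, ℂ)) (y : Bdry d) (t : ℝ) :
    HasDerivAt (fun t => B (mk y t)) (normalDeriv B (mk y t)) t := by
  have h1 : HasDerivAt (fun t : ℝ => (mk y t : Full d)) (mk 0 1) t := by
    have h2 : HasDerivAt (fun t : ℝ => vertEmb d t) (vertEmb d 1) t :=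
      (vertEmb d).hasDerivAt
    have h3 := h2.const_add (horEmb d y)
    simp only [← mk_eq_add] at h3
    convert! h3 using 1
  have h4 := (B.hasFDerivAt (mk y t)).comp_hasDerivAt t h1
  rw [normalDeriv, SchwartzMap.lineDerivOp_apply_eq_fderiv]
  exact h4

/-- If `B` vanishes to second order at `x_n = 0`, then `Ξ₊^a` maps the corresponding function
`e⁺ x_n^{a-1} w` into `L₂`. -/
theorem memLp_lam_mul_halfFT (ha : 0 < a) (ha1 : a < 1) {B : 𝓢(Full d, ℂ)}
    (h0 : slice 0 B = 0) (h1 : slice 0 (normalDeriv B) = 0) :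
    MemLp (fun ξ => lam 1 a ξ * halfFT a B ξ) 2 := by
  set D : ℝ := Module.finrank ℝ (Bdry d) + 1 with hD
  have hD0 : 0 ≤ D := by positivity
  -- Of the D + 2 tangential powers, two pay for passing from 1 + (2πξ_n)² to ⟨ξ⟩²; the remaining D
  -- make the bound square-integrable in ξ'.
  obtain ⟨C0, hC0, b0⟩ := exists_norm_mk_le B (r := D + 2) (s := 1) (by positivity) zero_le_one
  obtain ⟨C1, hC1, b1⟩ := exists_norm_mk_le (normalDeriv B) (r := D + 2) (s := 1) (by positivity)
    zero_le_one
  obtain ⟨C2, hC2, b2⟩ := exists_norm_mk_le (normalDeriv (normalDeriv B)) (r := D + 2) (s := 1)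
    (by positivity) zero_le_one
  set C := C0 + C1 + C2
  have hW := weightMass_nonneg a
  have key : ∀ ξ : Full d, ‖halfFT a B ξ‖ ≤
      400 * C * weightMass a * (1 + ‖tang d ξ‖) ^ (-D) * fjap ξ ^ (-2 : ℝ) := by
    intro ξ
    set y := tang d ξ
    set p := (1 + ‖y‖) ^ (-(D + 2)) with hp
    have hp0 : 0 ≤ p := by positivity
    have hle : ∀ {c : ℝ} {t : ℝ} (z : ℂ), 0 ≤ c → c ≤ C → 0 ≤ t →
        ‖z‖ ≤ c * (p * (1 + |t|) ^ (-1 : ℝ)) → ‖z‖ ≤ C * p * (1 + t) ^ (-1 : ℝ) := by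
      intro c t z _ hcC ht hz
      rw [abs_of_nonneg ht] at hz
      refine hz.trans ?_
      rw [← mul_assoc]
      gcongr
    have h := sq_mul_norm_integral_le (K := C * p) (f := fun t => B (mk y t))
      (f' := fun t => normalDeriv B (mk y t))
      (f'' := fun t => normalDeriv (normalDeriv B) (mk y t)) ha ha1 (by positivity)
      (fun x => hasDerivAt_normal B y x) (fun x => hasDerivAt_normal (normalDeriv B) y x)
      (by
        have := (normalDeriv (normalDeriv B)).continuous
        exact Continuous.measurable (by fun_prop))
      (by simpa using DFunLike.congr_fun h0 y) (by simpa using DFunLike.congr_fun h1 y)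
      (fun x hx => hle _ hC0 (by simp only [C]; linarith) hx (b0 y x))
      (fun x hx => (hle _ hC1 (by simp only [C]; linarith) hx (b1 y x)).trans
        (mul_le_of_le_one_right (by positivity)
          (Real.rpow_le_one_of_one_le_of_nonpos (by linarith) (by norm_num))))
      (fun x hx => hle _ hC2 (by simp only [C]; linarith) hx (b2 y x))
      (2 * Real.pi * normal d ξ)
    change (1 + (2 * Real.pi * normal d ξ) ^ 2) * ‖halfFT a B ξ‖ ≤ _ at h
    have hF := fjap_pos ξ
    -- Here 40 is a numerical bound for (2π)²; multiplied by the constant 10 of the one-dimensional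
    -- estimate it gives 400.
    have hj : fjap ξ ^ 2 ≤ 40 * (1 + ‖y‖) ^ 2 * (1 + (2 * Real.pi * normal d ξ) ^ 2) := by
      have hjy : jap y ^ 2 ≤ 40 * (1 + ‖y‖) ^ 2 := by
        rw [jap_sq, norm_smul, Real.norm_of_nonneg (by positivity)]
        have hpi := Real.pi_lt_d2
        have hpi0 := Real.pi_pos
        have : (2 * Real.pi) ^ 2 ≤ 40 := by nlinarith
        rw [mul_pow]
        nlinarith [norm_nonneg y, mul_le_mul_of_nonneg_right this (sq_nonneg ‖y‖)]
      have hj1 : 1 ≤ 40 * (1 + ‖y‖) ^ 2 := by nlinarith [norm_nonneg y]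
      rw [fjap_sq]
      nlinarith [sq_nonneg (2 * Real.pi * normal d ξ), mul_le_mul_of_nonneg_right hj1
        (sq_nonneg (2 * Real.pi * normal d ξ))]
    have hpp : (1 + ‖y‖) ^ 2 * p = (1 + ‖y‖) ^ (-D) := by
      rw [hp, ← Real.rpow_natCast, ← Real.rpow_add (by positivity)]
      congr 1
      push_cast
      ring
    have hneg : fjap ξ ^ (-2 : ℝ) = (fjap ξ ^ 2)⁻¹ := by
      rw [Real.rpow_neg hF.le]
      norm_cast
    rw [hneg, ← div_eq_mul_inv, le_div_iff₀ (by positivity)]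
    calc _ ≤ ‖halfFT a B ξ‖ * (40 * (1 + ‖y‖) ^ 2 * (1 + (2 * Real.pi * normal d ξ) ^ 2)) := by
          gcongr
      _ = 40 * (1 + ‖y‖) ^ 2 * ((1 + (2 * Real.pi * normal d ξ) ^ 2) * ‖halfFT a B ξ‖) := by ring
      _ ≤ 40 * (1 + ‖y‖) ^ 2 * (10 * (C * p) * weightMass a) := by gcongr
      _ = 400 * C * weightMass a * ((1 + ‖y‖) ^ 2 * p) := by ring
      _ = _ := by rw [hpp]
  have hg : MemLp (fun y : Bdry d => ((1 + ‖y‖) ^ (-D) : ℝ)) 2 := memLp_one_add_norm_rpow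
  have hw := (memLp_layer_weight hg.ofReal).1
  refine memLp_of_norm_le_mul (C := 400 * C * weightMass a) hw
    ((temperate_lam_one a).1.continuous.measurable.mul
      (measurable_halfFT a B)).aestronglyMeasurable fun ξ => ?_
  have hF := fjap_pos ξ
  have hJ := jap_pos (tang d ξ)
  rw [norm_mul, norm_lam (by norm_num), norm_mul, norm_mul, norm_ofReal_rpow hJ,
    norm_ofReal_rpow hF]
  have h2 : ‖((((1 + ‖tang d ξ‖) ^ (-D) : ℝ)) : ℂ)‖ = (1 + ‖tang d ξ‖) ^ (-D) :=
    norm_ofReal_rpow (by positivity) _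
  have h3 : fjap ξ ^ a * fjap ξ ^ (-2 : ℝ) ≤ fjap ξ ^ (-1 : ℝ) := by
    rw [← Real.rpow_add hF]
    exact Real.rpow_le_rpow_of_exponent_le (one_le_fjap ξ) (by linarith)
  have h4 : 1 ≤ jap (tang d ξ) ^ (1 / 2 : ℝ) := Real.one_le_rpow (one_le_jap _) (by norm_num)
  have hC : 0 ≤ C := by positivity
  calc _ ≤ fjap ξ ^ a * (400 * C * weightMass a * (1 + ‖tang d ξ‖) ^ (-D) * fjap ξ ^ (-2 : ℝ)) := by
        gcongr
        exact key ξ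
    _ = 400 * C * weightMass a * (1 + ‖tang d ξ‖) ^ (-D) * (fjap ξ ^ a * fjap ξ ^ (-2 : ℝ)) := by
      ring
    _ ≤ 400 * C * weightMass a * (1 + ‖tang d ξ‖) ^ (-D) *
        (jap (tang d ξ) ^ (1 / 2 : ℝ) * fjap ξ ^ (-1 : ℝ)) := by
      exact mul_le_mul_of_nonneg_left (h3.trans (le_mul_of_one_le_left (by positivity) h4))
        (by positivity)
    _ = 400 * C * weightMass a * (jap (tang d ξ) ^ (1 / 2 : ℝ) * fjap ξ ^ (-1 : ℝ) *
        (1 + ‖tang d ξ‖) ^ (-D)) := by ring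
    _ = _ := by
      congr 2
      exact h2.symm

end PowMul


/-! ### Model functions `x_n^j e^{-⟨ξ'⟩ x_n} ψ(ξ')` -/

section ExpDecay

open Set

/-- A smooth cutoff equal to `1` on `[-1, ∞)` and to `0` on `(-∞, -2]`. -/
def cutoff (x : ℝ) : ℂ := (Real.smoothTransition (x + 2) : ℝ)

theorem contDiff_cutoff {n : ℕ∞} : ContDiff ℝ n cutoff :=
  Complex.ofRealCLM.contDiff.comp (Real.smoothTransition.contDiff.comp (contDiff_id.add contDiff_const))

theorem cutoff_eq_one {x : ℝ} (hx : -1 ≤ x) : cutoff x = 1 := by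
  rw [cutoff, Real.smoothTransition.one_of_one_le (by linarith)]; rfl

theorem cutoff_eq_zero {x : ℝ} (hx : x ≤ -2) : cutoff x = 0 := by
  rw [cutoff, Real.smoothTransition.zero_of_nonpos (by linarith)]; rfl

theorem norm_cutoff_le (x : ℝ) : ‖cutoff x‖ ≤ 1 := by
  rw [cutoff, Complex.norm_real, Real.norm_of_nonneg (Real.smoothTransition.nonneg _)]
  exact Real.smoothTransition.le_one _

theorem contDiff_cexp_neg {n : ℕ∞} : ContDiff ℝ n fun x : ℝ => Complex.exp (-(x : ℂ)) :=
  (Complex.ofRealCLM.contDiff.neg).cexp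

theorem contDiff_deriv_cutoff {n : ℕ∞} : ContDiff ℝ n (deriv cutoff) :=
  ((contDiff_infty_iff_deriv.1 contDiff_cutoff).2).of_le (mod_cast le_top)

/-- The compactly supported function `χ' e^{-x}`. -/
def cutoffDerivExp : 𝓢(ℝ, ℂ) :=
  HasCompactSupport.toSchwartzMap (f := fun x : ℝ => deriv cutoff x * Complex.exp (-(x : ℂ)))
    (by
      refine HasCompactSupport.intro (isCompact_Icc (a := (-2 : ℝ)) (b := -1)) fun x hx => ?_
      have h : deriv cutoff x = 0 := by
        rcases lt_or_ge x (-2) with h1 | h1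
        · have : cutoff =ᶠ[𝓝 x] fun _ => 0 := by
            filter_upwards [Iio_mem_nhds h1] with y hy using cutoff_eq_zero (le_of_lt hy)
          rw [this.deriv_eq, deriv_const]
        · have h2 : -1 < x := by
            by_contra h3
            exact hx ⟨h1, by linarith⟩
          have : cutoff =ᶠ[𝓝 x] fun _ => 1 := by
            filter_upwards [Ioi_mem_nhds h2] with y hy using cutoff_eq_one (le_of_lt hy)
          rw [this.deriv_eq, deriv_const]
      rw [h, zero_mul])
    (contDiff_deriv_cutoff.mul contDiff_cexp_neg)

/-- The derivative of χe^{-x} is χ'e^{-x} minus the function itself, and χ'e^{-x} has compact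
support; so the bounds propagate by induction on the order. -/
theorem exists_pow_mul_iteratedDeriv_cutoff_le (n : ℕ) : ∀ k : ℕ, ∃ C, ∀ x : ℝ,
    ‖x‖ ^ k * ‖iteratedDeriv n (fun x : ℝ => cutoff x * Complex.exp (-(x : ℂ))) x‖ ≤ C := by
  induction n with
  | zero =>
    intro k
    -- The first summand covers -2 < x ≤ 0; the second comes from x^k e^{-x} ≤ k! for x > 0.
    refine ⟨2 ^ k * Real.exp 2 + k.factorial, fun x => ?_⟩
    rw [iteratedDeriv_zero, norm_mul, Complex.norm_exp]
    simp only [Complex.neg_re, Complex.ofReal_re, Real.norm_eq_abs]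
    have hf : (0 : ℝ) ≤ k.factorial := by positivity
    rcases le_or_gt x (-2) with h | h
    · rw [cutoff_eq_zero h]
      simp only [norm_zero, zero_mul, mul_zero]
      positivity
    rcases le_or_gt x 0 with h0 | h0
    · have h1 : |x| ≤ 2 := by rw [abs_le]; constructor <;> linarith
      have h2 : Real.exp (-x) ≤ Real.exp 2 := Real.exp_le_exp.2 (by linarith)
      calc |x| ^ k * (‖cutoff x‖ * Real.exp (-x)) ≤ 2 ^ k * (1 * Real.exp 2) := by
            gcongr
            exact norm_cutoff_le x
        _ ≤ _ := by rw [one_mul]; linarith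
    · have h1 := Real.pow_div_factorial_le_exp x h0.le k
      rw [div_le_iff₀ (by positivity)] at h1
      have h2 : Real.exp x * Real.exp (-x) = 1 := by rw [← Real.exp_add]; simp
      rw [abs_of_pos h0]
      calc x ^ k * (‖cutoff x‖ * Real.exp (-x)) ≤
            (Real.exp x * k.factorial) * (1 * Real.exp (-x)) := by
            gcongr
            exact norm_cutoff_le x
        _ = k.factorial * (Real.exp x * Real.exp (-x)) := by ring
        _ ≤ _ := by
          rw [h2, mul_one]
          have : 0 ≤ (2 : ℝ) ^ k * Real.exp 2 := by positivity
          linarith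
  | succ n ih =>
    intro k
    obtain ⟨C, hC⟩ := ih k
    have hs : ContDiff ℝ (n : ℕ∞) fun x : ℝ => cutoff x * Complex.exp (-(x : ℂ)) :=
      contDiff_cutoff.mul contDiff_cexp_neg
    have hd : deriv (fun x : ℝ => cutoff x * Complex.exp (-(x : ℂ))) =
        (cutoffDerivExp : ℝ → ℂ) - fun x : ℝ => cutoff x * Complex.exp (-(x : ℂ)) := by
      ext x
      have h1 : HasDerivAt cutoff (deriv cutoff x) x :=
        ((contDiff_cutoff (n := 1)).differentiable (by norm_num) x).hasDerivAt
      have h2 : HasDerivAt (fun x : ℝ => Complex.exp (-(x : ℂ))) (Complex.exp (-(x : ℂ)) * -1) x :=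
        ((hasDerivAt_id (x : ℝ)).ofReal_comp.neg).cexp
      have h3 : HasDerivAt (fun x : ℝ => cutoff x * Complex.exp (-(x : ℂ))) _ x := h1.mul h2
      rw [h3.deriv, Pi.sub_apply]
      change _ = deriv cutoff x * Complex.exp (-(x : ℂ)) - _
      ring
    refine ⟨SchwartzMap.seminorm ℝ k n cutoffDerivExp + C, fun x => ?_⟩
    rw [iteratedDeriv_succ', hd, iteratedDeriv_sub
      ((cutoffDerivExp.smooth n).contDiffAt) hs.contDiffAt]
    refine (mul_le_mul_of_nonneg_left (norm_sub_le _ _) (by positivity)).trans ?_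
    rw [mul_add]
    exact add_le_add (SchwartzMap.le_seminorm' ℝ k n cutoffDerivExp x) (hC x)

/-- A Schwartz function equal to `e^{-x}` for `x ≥ -1`. -/
def expDecay : 𝓢(ℝ, ℂ) where
  toFun x := cutoff x * Complex.exp (-(x : ℂ))
  smooth' := contDiff_cutoff.mul contDiff_cexp_neg
  decay' k n := by
    obtain ⟨C, hC⟩ := exists_pow_mul_iteratedDeriv_cutoff_le n k
    refine ⟨C, fun x => ?_⟩
    rw [norm_iteratedFDeriv_eq_norm_iteratedDeriv]
    exact hC x

theorem expDecay_apply {x : ℝ} (hx : -1 ≤ x) : expDecay x = Complex.exp (-(x : ℂ)) := by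
  change cutoff x * _ = _
  rw [cutoff_eq_one hx, one_mul]

end ExpDecay

section Tensor

variable {d : ℕ}

theorem norm_iteratedFDeriv_comp_le {V W : Type*} [NormedAddCommGroup V] [NormedSpace ℝ V]
    [NormedAddCommGroup W] [NormedSpace ℝ W] (L : V →L[ℝ] W) (hL : ‖L‖ ≤ 1) (f : 𝓢(W, ℂ)) (n : ℕ)
    (x : V) : ‖iteratedFDeriv ℝ n (fun x => f (L x)) x‖ ≤ ‖iteratedFDeriv ℝ n f (L x)‖ := by
  have h1 : (fun x => f (L x)) = f ∘ L := rfl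
  rw [h1, ContinuousLinearMap.iteratedFDeriv_comp_right (n := n) L (f.smooth n) x le_rfl]
  refine (ContinuousMultilinearMap.norm_compContinuousLinearMap_le _ _).trans ?_
  exact mul_le_of_le_one_right (norm_nonneg _)
    (Finset.prod_le_one (fun _ _ => norm_nonneg _) fun _ _ => hL)

theorem exists_one_add_pow_mul_le {V : Type*} [NormedAddCommGroup V] [NormedSpace ℝ V]
    (f : 𝓢(V, ℂ)) (k n : ℕ) : ∃ C, 0 ≤ C ∧
      ∀ x, (1 + ‖x‖) ^ k * ‖iteratedFDeriv ℝ n f x‖ ≤ C :=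
  ⟨_, by positivity, fun x => SchwartzMap.one_add_le_sup_seminorm_apply (𝕜 := ℝ) (m := (k, n))
    le_rfl le_rfl f x⟩

/-- The Schwartz function `ψ(x') ρ(x_n)`. -/
def tensor (ψ : 𝓢(Bdry d, ℂ)) (ρ : 𝓢(ℝ, ℂ)) : 𝓢(Full d, ℂ) where
  toFun z := ψ (tang d z) * ρ (normal d z)
  smooth' := ((ψ.smooth _).comp (tang d).contDiff).mul ((ρ.smooth _).comp (normal d).contDiff)
  decay' k n := by
    have ht : ‖tang d‖ ≤ 1 := ContinuousLinearMap.opNorm_le_bound _ zero_le_one fun x => by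
      rw [one_mul]; exact norm_tang_le x
    have hn : ‖normal d‖ ≤ 1 := ContinuousLinearMap.opNorm_le_bound _ zero_le_one fun x => by
      rw [one_mul]; exact abs_normal_le x
    choose C hC0 hC using fun i => exists_one_add_pow_mul_le ψ k i
    choose D hD0 hD using fun i => exists_one_add_pow_mul_le ρ k i
    refine ⟨∑ i ∈ Finset.range (n + 1), (n.choose i : ℝ) * C i * D (n - i), fun z => ?_⟩
    have h1 := norm_iteratedFDeriv_mul_le (𝕜 := ℝ) (N := (n : ℕ∞))
      ((ψ.smooth n).comp (tang d).contDiff) ((ρ.smooth n).comp (normal d).contDiff) z le_rfl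
    have hz : ‖z‖ ≤ (1 + ‖tang d z‖) * (1 + ‖normal d z‖) := by
      have h2 := norm_sq_eq_tang_normal z
      refine (pow_le_pow_iff_left₀ (norm_nonneg _) (by positivity) two_ne_zero).1 ?_
      rw [h2, mul_pow, ← sq_abs (normal d z), ← Real.norm_eq_abs]
      have h3 : ‖tang d z‖ ^ 2 ≤ (1 + ‖tang d z‖) ^ 2 - 1 := by nlinarith [norm_nonneg (tang d z)]
      have h4 : ‖normal d z‖ ^ 2 ≤ (1 + ‖normal d z‖) ^ 2 - 1 := by
        nlinarith [norm_nonneg (normal d z)]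
      nlinarith [sq_nonneg ‖tang d z‖, sq_nonneg ‖normal d z‖]
    refine (mul_le_mul (pow_le_pow_left₀ (norm_nonneg z) hz k) h1 (norm_nonneg _)
      (by positivity)).trans ?_
    rw [Finset.mul_sum]
    refine Finset.sum_le_sum fun i _ => ?_
    have e1 := norm_iteratedFDeriv_comp_le (tang d) ht ψ i z
    have e2 := norm_iteratedFDeriv_comp_le (normal d) hn ρ (n - i) z
    have e3 := hC i (tang d z)
    have e4 := hD (n - i) (normal d z)
    calc _ ≤ ((1 + ‖tang d z‖) * (1 + ‖normal d z‖)) ^ k * ((n.choose i : ℝ) *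
          ‖iteratedFDeriv ℝ i ψ (tang d z)‖ * ‖iteratedFDeriv ℝ (n - i) ρ (normal d z)‖) := by
          refine mul_le_mul_of_nonneg_left ?_ (by positivity)
          exact mul_le_mul (mul_le_mul_of_nonneg_left e1 (by positivity)) e2 (norm_nonneg _)
            (by positivity)
      _ = (n.choose i : ℝ) * ((1 + ‖tang d z‖) ^ k * ‖iteratedFDeriv ℝ i ψ (tang d z)‖) *
          ((1 + ‖normal d z‖) ^ k * ‖iteratedFDeriv ℝ (n - i) ρ (normal d z)‖) := by
          rw [mul_pow]; ring
      _ ≤ _ := by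
        refine mul_le_mul (mul_le_mul_of_nonneg_left e3 (by positivity)) e4 (by positivity) ?_
        exact mul_nonneg (by positivity) (hC0 i)

/-- The map `(x', x_n) ↦ (x', ⟨x'⟩ x_n)`. -/
def stretch (z : Full d) : Full d := mk (tang d z) (jap (tang d z) * normal d z)

theorem hasTemperateGrowth_stretch : (stretch (d := d)).HasTemperateGrowth := by
  have h1 := hasTemperateGrowth_comp_tang (hasTemperateGrowth_jap_rpow (d := d) 1)
  simp only [Real.rpow_one] at h1
  have h2 : stretch (d := d) = fun z => (horEmb d).comp (tang d) z +
      vertEmb d (jap (tang d z) * normal d z) := by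
    ext1 z
    rw [stretch, mk_eq_add]
    rfl
  rw [h2]
  exact ((horEmb d).comp (tang d)).hasTemperateGrowth.add
    ((vertEmb d).hasTemperateGrowth.comp (h1.mul (normal d).hasTemperateGrowth))

/-- Stretching by ⟨x'⟩ ≥ 1 only increases the norm, which is the growth condition that keeps
composition with it inside Schwartz space. -/
theorem norm_le_norm_stretch (z : Full d) : ‖z‖ ≤ ‖stretch z‖ := by
  refine (pow_le_pow_iff_left₀ (norm_nonneg _) (norm_nonneg _) two_ne_zero).1 ?_
  rw [norm_sq_eq_tang_normal z, stretch, norm_mk_sq, mul_pow]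
  have h1 := one_le_jap (tang d z)
  have h2 : 1 ≤ jap (tang d z) ^ 2 := by nlinarith
  nlinarith [mul_le_mul_of_nonneg_right h2 (sq_nonneg (normal d z))]

/-- The Schwartz function equal to `x_n^j e^{-⟨ξ'⟩ x_n} ψ(ξ')` for `x_n ≥ 0`. -/
def expTensor (j : ℕ) (ψ : 𝓢(Bdry d, ℂ)) : 𝓢(Full d, ℂ) :=
  SchwartzMap.smulLeftCLM ℂ (fun z => ((normal d z : ℝ) : ℂ) ^ j)
    (SchwartzMap.compCLM ℂ hasTemperateGrowth_stretch ⟨1, 1, fun z => by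
      have := norm_le_norm_stretch z
      linarith⟩ (tensor ψ expDecay))

theorem expTensor_mk (j : ℕ) (ψ : 𝓢(Bdry d, ℂ)) (y : Bdry d) (t : ℝ) :
    expTensor j ψ (mk y t) = (t : ℂ) ^ j * (ψ y * expDecay (jap y * t)) := by
  have h : (fun z : Full d => ((normal d z : ℝ) : ℂ) ^ j).HasTemperateGrowth :=
    (hasTemperateGrowth_ofReal (normal d).hasTemperateGrowth).pow j
  rw [expTensor, SchwartzMap.smulLeftCLM_apply_apply h, normal_mk, smul_eq_mul]
  congr 1
  change ψ (tang d (stretch (mk y t))) * expDecay (normal d (stretch (mk y t))) = _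
  simp [stretch]

theorem slice_expTensor_zero (ψ : 𝓢(Bdry d, ℂ)) : slice 0 (expTensor 0 ψ) = ψ := by
  ext y
  rw [slice_apply, expTensor_mk, expDecay_apply (by simp)]
  simp

theorem slice_expTensor_succ (j : ℕ) (ψ : 𝓢(Bdry d, ℂ)) : slice 0 (expTensor (j + 1) ψ) = 0 := by
  ext y
  rw [slice_apply, expTensor_mk]
  simp

/-- The cutoff equals 1 on a full neighbourhood of 0, so the two-sided derivative at 0 is that of
the exponential. -/
theorem hasDerivAt_expDecay_mul (s : ℝ) :
    HasDerivAt (fun t : ℝ => expDecay (s * t)) (-(s : ℂ)) 0 := by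
  have h1 : HasDerivAt (fun t : ℝ => Complex.exp (-((s * t : ℝ) : ℂ)))
      (Complex.exp (-((s * 0 : ℝ) : ℂ)) * -((s * 1 : ℝ) : ℂ)) 0 :=
    (((hasDerivAt_id (0 : ℝ)).const_mul s).ofReal_comp.neg).cexp
  have h2 : (fun t : ℝ => expDecay (s * t)) =ᶠ[𝓝 0] fun t : ℝ => Complex.exp (-((s * t : ℝ) : ℂ)) := by
    have h3 : {t : ℝ | -1 < s * t} ∈ 𝓝 (0 : ℝ) :=
      (isOpen_lt continuous_const (by fun_prop)).mem_nhds (by simp)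
    filter_upwards [h3] with t ht using expDecay_apply (le_of_lt ht)
  convert! h1.congr_of_eventuallyEq h2 using 1
  simp

theorem normalDeriv_expTensor_zero (ψ : 𝓢(Bdry d, ℂ)) (y : Bdry d) :
    normalDeriv (expTensor 0 ψ) (mk y 0) = -(jap y : ℂ) * ψ y := by
  have h1 := hasDerivAt_normal (expTensor 0 ψ) y 0
  simp only [expTensor_mk, pow_zero, one_mul] at h1
  rw [h1.unique ((hasDerivAt_expDecay_mul (jap y)).const_mul (ψ y))]
  ring

theorem normalDeriv_expTensor_one (ψ : 𝓢(Bdry d, ℂ)) (y : Bdry d) :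
    normalDeriv (expTensor 1 ψ) (mk y 0) = ψ y := by
  have h1 := hasDerivAt_normal (expTensor 1 ψ) y 0
  simp only [expTensor_mk, pow_one] at h1
  have h2 := ((hasDerivAt_id (0 : ℝ)).ofReal_comp).mul
    ((hasDerivAt_expDecay_mul (jap y)).const_mul (ψ y))
  rw [h1.unique h2, mul_zero, expDecay_apply (by norm_num)]
  simp

/-- The Gamma integral with exponent a + j and rate ⟨ξ'⟩ + iξ_n. After multiplication by the symbol
of Ξ₊^a, the model j = 0 becomes exactly Γ(a)ψ(ξ'), a layer, and each further power of x_n yields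
one factor (⟨ξ'⟩ + iξ_n)^{-1}. -/
theorem halfFT_expTensor {a : ℝ} (ha : 0 < a) (j : ℕ) (ψ : 𝓢(Bdry d, ℂ)) (ξ : Full d) :
    halfFT a (expTensor j ψ) ξ =
      (Real.Gamma (a + j) : ℂ) * (lam 1 (-(a + j)) ξ * ψ (tang d ξ)) := by
  have h := integral_rpow_mul_cexp (a := a + j) (z := base 1 ξ) (by positivity) (base_re_pos 1 ξ)
  have h2 : lam 1 (-(a + j)) ξ = base 1 ξ ^ (-((a + j : ℝ) : ℂ)) := by
    rw [lam]; push_cast; rfl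
  rw [h2, ← mul_assoc, ← h, ← integral_mul_const, halfFT]
  refine setIntegral_congr_fun measurableSet_Ioi fun x hx => ?_
  have hx' : (0 : ℝ) < x := hx
  simp only [expTensor_mk]
  rw [expDecay_apply (by nlinarith [mul_pos (jap_pos (tang d ξ)) hx'])]
  have h3 : x ^ (a + j - 1) = x ^ (a - 1) * x ^ j := by
    rw [← Real.rpow_natCast, ← Real.rpow_add hx']
    congr 1; ring
  have h4 : Complex.exp (-base 1 ξ * x) =
      Complex.exp (((-(x * (2 * Real.pi * normal d ξ)) : ℝ) : ℂ) * Complex.I) *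
        Complex.exp (-((jap (tang d ξ) * x : ℝ) : ℂ)) := by
    rw [← Complex.exp_add, base]
    congr 1
    push_cast
    ring
  rw [h3, h4]
  push_cast
  ring

end Tensor

/-! ### The leading singularity of Ξ₊^a e⁺ x_n^{a-1} w -/

section Leading

open FourierTransform Set

variable {d : ℕ} {a : ℝ}

theorem integrableOn_halfFT (ha : 0 < a) (ha1 : a < 1) (B : 𝓢(Full d, ℂ)) (ξ : Full d) :
    IntegrableOn (fun x : ℝ => ((x ^ (a - 1) : ℝ) : ℂ) *
      (Complex.exp (((-(x * (2 * Real.pi * normal d ξ)) : ℝ) : ℂ) * Complex.I) *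
        B (mk (tang d ξ) x))) (Ioi 0) := by
  obtain ⟨C, hC, h⟩ := exists_norm_mk_le B (r := 0) (s := 1) le_rfl zero_le_one
  have hB := B.continuous
  refine (integrableOn_of_le_weight (K := C) ha ha1 ((measurable_ofReal_rpow _).mul
    (Continuous.measurable (by fun_prop))) fun x hx => ?_).1
  rw [Pi.mul_apply, norm_mul, norm_ofReal_rpow hx, norm_cexp_mul_I, mul_left_comm]
  have := h (tang d ξ) x
  rw [abs_of_pos hx, neg_zero, Real.rpow_zero, one_mul] at this
  gcongr

theorem halfFT_add (ha : 0 < a) (ha1 : a < 1) (A B : 𝓢(Full d, ℂ)) (ξ : Full d) :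
    halfFT a (A + B) ξ = halfFT a A ξ + halfFT a B ξ := by
  rw [halfFT, halfFT, halfFT, ← integral_add (integrableOn_halfFT ha ha1 A ξ)
    (integrableOn_halfFT ha ha1 B ξ)]
  refine integral_congr_ae (ae_of_all _ fun x => ?_)
  simp only [add_apply]
  ring

theorem hasFT_schwartz {V : Type*} [NormedAddCommGroup V] [InnerProductSpace ℝ V]
    [FiniteDimensional ℝ V] [MeasurableSpace V] [BorelSpace V] (g : 𝓢(V, ℂ)) :
    HasFT (g : 𝓢'(V, ℂ)) ⇑(𝓕 g : 𝓢(V, ℂ)) where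
  integrable Θ := MemLp.integrable_mul (p := 2) (q := 2) (Θ.memLp 2 volume) ((𝓕 g : 𝓢(V, ℂ)).memLp 2 volume)
  eq Θ := by
    rw [← TemperedDistribution.fourier_apply, TemperedDistribution.fourier_toTemperedDistributionCLM_eq]
    rfl

/-- The leading term of `Ξ₊^a e⁺ x_n^{a-1} w` is `Γ(a) γ₀w ⊗ δ`; the remainder is in `L₂`. -/
theorem isL2_xi_powMul_sub (ha : 0 < a) (ha1 : a < 1) (w : 𝓢(Full d, ℂ)) :
    IsL2 (fourierMultiplierCLM ℂ (lam 1 a) (powMul (a - 1) w) -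
      (Real.Gamma a : ℂ) • layer (boundaryValue w : 𝓢'(Bdry d, ℂ))) := by
  set B := partialFourier w with hB
  set b0 := slice 0 B with hb0
  have htj : (fun y : Bdry d => (jap y : ℂ)).HasTemperateGrowth := by
    have h := hasTemperateGrowth_jap_rpow (d := d) 1
    simp only [Real.rpow_one] at h
    exact hasTemperateGrowth_ofReal h
  -- At x_n = 0 the model j = 0 has normal derivative -⟨ξ'⟩b0 and the model j = 1 has normal
  -- derivative b1. This choice of b1 makes B0 vanish to second order.
  set b1 := slice 0 (normalDeriv B) + SchwartzMap.smulLeftCLM ℂ (fun y => (jap y : ℂ)) b0 with hb1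
  set B0 := B - expTensor 0 b0 - expTensor 1 b1 with hB0
  have hz0 : slice 0 B0 = 0 := by
    rw [hB0, map_sub, map_sub, slice_expTensor_zero, slice_expTensor_succ, sub_zero, sub_self]
  have hz1 : slice 0 (normalDeriv B0) = 0 := by
    have h1 : normalDeriv B0 =
        normalDeriv B - normalDeriv (expTensor 0 b0) - normalDeriv (expTensor 1 b1) := by
      have hs : ∀ A B : 𝓢(Full d, ℂ), normalDeriv (A - B) = normalDeriv A - normalDeriv B :=
        fun A B => by
          ext z
          rw [← mk_tang_normal z, sub_apply]
          refine (hasDerivAt_normal (A - B) (tang d z) (normal d z)).unique ?_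
          exact (hasDerivAt_normal A (tang d z) (normal d z)).sub
            (hasDerivAt_normal B (tang d z) (normal d z))
      rw [hB0, hs, hs]
    ext y
    rw [h1, slice_apply, sub_apply, sub_apply, normalDeriv_expTensor_zero,
      normalDeriv_expTensor_one, hb1, add_apply, slice_apply,
      SchwartzMap.smulLeftCLM_apply_apply htj, smul_eq_mul, hb0, slice_apply]
    simp
  have hL := memLp_lam_mul_halfFT ha ha1 hz0 hz1
  have hFT := ((hasFT_powMul ha ha1 w).mult (temperate_lam_one a)).sub
    (((hasFT_schwartz (boundaryValue w)).layer ((𝓕 (boundaryValue w) : 𝓢(Bdry d, ℂ)).memLp 2 volume)).smul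
      (Real.Gamma a : ℂ))
  refine hFT.isL2 ?_
  have hb : ∀ ξ : Full d, 𝓕 (boundaryValue w) (tang d ξ) = b0 (tang d ξ) := fun ξ => by
    rw [hb0, slice_apply, hB, partialFourier_mk, boundaryValue_eq]
  -- The model j = 0 cancels the layer exactly. The model j = 1 leaves Γ(a+1)(⟨ξ'⟩ +
  -- iξ_n)^{-1}b1(ξ'), which decays like ⟨ξ⟩^{-1} and is therefore square-integrable.
  have hfun : (fun ξ => lam 1 a ξ * halfFT a (partialFourier w) ξ -
      (Real.Gamma a : ℂ) * 𝓕 (boundaryValue w) (tang d ξ)) =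
      fun ξ => lam 1 a ξ * halfFT a B0 ξ +
        (Real.Gamma (a + 1) : ℂ) * (lam 1 (-1) ξ * b1 (tang d ξ)) := by
    ext ξ
    have hsum : B = B0 + (expTensor 0 b0 + expTensor 1 b1) := by rw [hB0]; abel
    have e0 : lam 1 a ξ * lam 1 (-(a + (0 : ℕ))) ξ = 1 := by
      rw [← lam_add]; simp
    have e1 : lam 1 a ξ * lam 1 (-(a + (1 : ℕ))) ξ = lam 1 (-1) ξ := by
      rw [← lam_add]; congr 1; push_cast; ring
    rw [hb, ← hB, hsum, halfFT_add ha ha1, halfFT_add ha ha1, halfFT_expTensor ha,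
      halfFT_expTensor ha, ← e1]
    push_cast at e0 ⊢
    rw [add_zero] at e0 ⊢
    linear_combination ((Real.Gamma a : ℂ) * b0 (tang d ξ)) * e0
  rw [hfun]
  refine hL.add (MemLp.const_mul ?_ _)
  refine memLp_of_norm_le_mul (C := 1) (memLp_layer_weight (b1.memLp 2 volume)).1
    ((temperate_lam_one (-1)).1.continuous.mul
      (b1.continuous.comp (tang d).continuous)).aestronglyMeasurable fun ξ => ?_
  rw [one_mul, norm_mul, norm_lam (by norm_num), norm_mul, norm_mul, norm_ofReal_rpow (jap_pos _),
    norm_ofReal_rpow (fjap_pos _)]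
  have h4 : 1 ≤ jap (tang d ξ) ^ (1 / 2 : ℝ) := Real.one_le_rpow (one_le_jap _) (by norm_num)
  have := fjap_pos ξ
  exact mul_le_mul_of_nonneg_right (le_mul_of_one_le_left (by positivity) h4) (norm_nonneg _)

theorem van_powMul (ha : 0 < a) (ha1 : a < 1) (w : 𝓢(Full d, ℂ)) : Van (-1) (powMul (a - 1) w) := by
  intro Θ hΘ
  rw [powMul_apply ha ha1]
  refine integral_eq_zero_of_ae (ae_of_all _ fun x => ?_)
  simp only [Pi.zero_apply]
  by_cases hx : 0 < normal d x
  · rw [hΘ x (by linarith), zero_mul]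
  · have h1 : x ∉ (halfSpace d : Set (Full d)) := hx
    rw [powMulFun, indicator_of_notMem h1, mul_zero]

end Leading


open Set

/-! ### Elementary functions whose truncations are explicit -/

section Atom

open FourierTransform

variable {d : ℕ}

theorem lam_neg_natCast (ε : ℝ) (j : ℕ) (ξ : Full d) : lam ε (-(j : ℝ)) ξ = (base ε ξ)⁻¹ ^ j := by
  rw [lam_neg, lam, Complex.ofReal_natCast, Complex.cpow_natCast, inv_pow]

/-- The function `ψ(ξ') (⟨ξ'⟩ + iξ_n)^{-j} (⟨ξ'⟩ - iξ_n)^{-l}`. -/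
def atom (j l : ℕ) (ψ : 𝓢(Bdry d, ℂ)) (ξ : Full d) : ℂ :=
  (base 1 ξ)⁻¹ ^ j * (base (-1) ξ)⁻¹ ^ l * ψ (tang d ξ)

theorem continuous_base (ε : ℝ) : Continuous (base (d := d) ε) := by
  have := continuous_jap (d := d)
  unfold base
  fun_prop

theorem continuous_base_inv (ε : ℝ) : Continuous fun ξ : Full d => (base ε ξ)⁻¹ :=
  (continuous_base ε).inv₀ (base_ne_zero ε)

theorem continuous_atom (j l : ℕ) (ψ : 𝓢(Bdry d, ℂ)) : Continuous (atom j l ψ) :=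
  (((continuous_base_inv 1).pow j).mul ((continuous_base_inv (-1)).pow l)).mul
    (ψ.continuous.comp (tang d).continuous)

theorem norm_base_inv {ε : ℝ} (hε : ε ^ 2 = 1) (ξ : Full d) : ‖(base ε ξ)⁻¹‖ = (fjap ξ)⁻¹ := by
  rw [norm_inv, norm_base_eq hε]

theorem norm_atom (j l : ℕ) (ψ : 𝓢(Bdry d, ℂ)) (ξ : Full d) :
    ‖atom j l ψ ξ‖ = fjap ξ ^ (-((j : ℝ) + l)) * ‖ψ (tang d ξ)‖ := by
  rw [atom, norm_mul, norm_mul, norm_pow, norm_pow, norm_base_inv (by norm_num),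
    norm_base_inv (by norm_num), ← pow_add, Real.rpow_neg (fjap_pos ξ).le, ← Nat.cast_add,
    Real.rpow_natCast, inv_pow]

theorem memLp_fjap_mul_atom {m : ℝ} {j l : ℕ} (hjl : m + 1 ≤ j + l) (ψ : 𝓢(Bdry d, ℂ)) :
    MemLp (fun ξ => ((fjap ξ ^ m : ℝ) : ℂ) * atom j l ψ ξ) 2 := by
  refine memLp_of_norm_le_mul (C := 1) (memLp_layer_weight (ψ.memLp 2 volume)).1
    ((continuous_fjap_rpow m).mul (continuous_atom j l ψ)).aestronglyMeasurable fun ξ => ?_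
  rw [one_mul, norm_mul, norm_mul, norm_mul, norm_ofReal_rpow (jap_pos _),
    norm_ofReal_rpow (fjap_pos _), norm_ofReal_rpow (fjap_pos _), norm_atom, ← mul_assoc,
    ← Real.rpow_add (fjap_pos ξ)]
  have h1 : fjap ξ ^ (m + -((j : ℝ) + l)) ≤ fjap ξ ^ (-1 : ℝ) :=
    Real.rpow_le_rpow_of_exponent_le (one_le_fjap ξ) (by linarith)
  have h2 : 1 ≤ jap (tang d ξ) ^ (1 / 2 : ℝ) := Real.one_le_rpow (one_le_jap _) (by norm_num)
  have h3 : 0 ≤ fjap ξ ^ (-1 : ℝ) := Real.rpow_nonneg (fjap_pos ξ).le _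
  exact mul_le_mul_of_nonneg_right (h1.trans (le_mul_of_one_le_left h3 h2)) (norm_nonneg _)

theorem memLp_atom {j l : ℕ} (hjl : 1 ≤ j + l) (ψ : 𝓢(Bdry d, ℂ)) : MemLp (atom j l ψ) 2 := by
  have h := memLp_fjap_mul_atom (m := 0) (j := j) (l := l)
    (by rw [zero_add]; exact_mod_cast hjl) ψ
  simpa using h

/-- Partial fractions. -/
theorem atom_succ_succ (j l : ℕ) (ψ : 𝓢(Bdry d, ℂ)) (ξ : Full d) :
    atom (j + 1) (l + 1) ψ ξ =
      atom (j + 1) l ((1 / 2 : ℂ) • SchwartzMap.smulLeftCLM ℂ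
        (fun y => ((jap y ^ (-1 : ℝ) : ℝ) : ℂ)) ψ) ξ +
      atom j (l + 1) ((1 / 2 : ℂ) • SchwartzMap.smulLeftCLM ℂ
        (fun y => ((jap y ^ (-1 : ℝ) : ℝ) : ℂ)) ψ) ξ := by
  have h1 := base_ne_zero 1 ξ
  have h2 := base_ne_zero (-1) ξ
  have h3 := base_add_base ξ
  have h4 : (jap (tang d ξ) : ℂ) ≠ 0 := Complex.ofReal_ne_zero.2 (jap_pos _).ne'
  have h5 : (base 1 ξ)⁻¹ * (base (-1) ξ)⁻¹ =
      (1 / 2) * (jap (tang d ξ) : ℂ)⁻¹ * ((base 1 ξ)⁻¹ + (base (-1) ξ)⁻¹) := by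
    field_simp
    rw [← h3]; ring
  simp only [atom, smul_apply, smul_eq_mul, SchwartzMap.smulLeftCLM_apply_apply
    (hasTemperateGrowth_ofReal (hasTemperateGrowth_jap_rpow (d := d) (-1)))]
  rw [Real.rpow_neg_one, Complex.ofReal_inv]
  linear_combination ((base 1 ξ)⁻¹ ^ j * (base (-1) ξ)⁻¹ ^ l * ψ (tang d ξ)) * h5

/-- `h` is the Fourier transform of some `X ∈ L₂` such that `e⁺ r⁺ X = Ξ₊^a e⁺ x_n^{a-1} w` with
`w` vanishing at the boundary. -/
def HasFlatCut (a : ℝ) (h : Full d → ℂ) : Prop :=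
  ∃ B : 𝓢(Full d, ℂ), ∃ X Y, slice 0 B = 0 ∧ HasFT X h ∧
    HasFT Y (fun ξ => lam 1 a ξ * halfFT a B ξ) ∧ IsCut X Y

theorem IsL2.smul {U : 𝓢'(Full d, ℂ)} (hU : IsL2 U) (c : ℂ) : IsL2 (c • U) := by
  obtain ⟨f, rfl⟩ := hU
  exact ⟨c • f, (map_smul (Lp.toTemperedDistributionCLM ℂ volume 2) c f).symm⟩

theorem IsL2.zero : IsL2 (0 : 𝓢'(Full d, ℂ)) :=
  ⟨0, (map_zero (Lp.toTemperedDistributionCLM ℂ volume 2)).symm⟩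

theorem IsL2.add {U W : 𝓢'(Full d, ℂ)} (hU : IsL2 U) (hW : IsL2 W) : IsL2 (U + W) := by
  obtain ⟨f, rfl⟩ := hU
  obtain ⟨g, rfl⟩ := hW
  exact ⟨f + g, (map_add (Lp.toTemperedDistributionCLM ℂ volume 2) f g).symm⟩

theorem IsCut.smul {X Y : 𝓢'(Full d, ℂ)} (h : IsCut X Y) (c : ℂ) : IsCut (c • X) (c • Y) where
  isL2 := h.isL2.smul c
  isL2_cut := h.isL2_cut.smul c
  van_neg := h.van_neg.smul c
  van_sub := by
    have : c • X - c • Y = c • (X - Y) := by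
      ext Θ
      simp only [sub_apply, smul_apply, smul_sub]
    rw [this]
    exact h.van_sub.smul c

theorem IsCut.add {X X' Y Y' : 𝓢'(Full d, ℂ)} (h : IsCut X Y) (h' : IsCut X' Y') :
    IsCut (X + X') (Y + Y') where
  isL2 := h.isL2.add h'.isL2
  isL2_cut := h.isL2_cut.add h'.isL2_cut
  van_neg := h.van_neg.add h'.van_neg
  van_sub := by
    rw [add_sub_add_comm]
    exact h.van_sub.add h'.van_sub

theorem halfFT_smul (a : ℝ) (c : ℂ) (B : 𝓢(Full d, ℂ)) (ξ : Full d) :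
    halfFT a (c • B) ξ = c * halfFT a B ξ := by
  rw [halfFT, halfFT, ← integral_const_mul]
  refine integral_congr_ae (ae_of_all _ fun x => ?_)
  simp only [smul_apply, smul_eq_mul]
  ring

variable {a : ℝ}

theorem HasFlatCut.add (ha : 0 < a) (ha1 : a < 1) {h h' : Full d → ℂ} (H : HasFlatCut a h)
    (H' : HasFlatCut a h') : HasFlatCut a (fun ξ => h ξ + h' ξ) := by
  obtain ⟨B, X, Y, h0, hX, hY, hc⟩ := H
  obtain ⟨B', X', Y', h0', hX', hY', hc'⟩ := H'
  refine ⟨B + B', X + X', Y + Y', by rw [map_add, h0, h0', add_zero], hX.add hX',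
    (hY.add hY').congr ?_, hc.add hc'⟩
  ext ξ
  rw [halfFT_add ha ha1, mul_add]

theorem HasFlatCut.smul {h : Full d → ℂ} (H : HasFlatCut a h) (c : ℂ) :
    HasFlatCut a (fun ξ => c * h ξ) := by
  obtain ⟨B, X, Y, h0, hX, hY, hc⟩ := H
  refine ⟨c • B, c • X, c • Y, by rw [map_smul, h0, smul_zero], hX.smul c,
    (hY.smul c).congr ?_, hc.smul c⟩
  ext ξ
  rw [halfFT_smul, mul_left_comm]

theorem hasFT_mult_layer {ε : ℝ} (hε : ε ^ 2 = 1) (j : ℕ) (ψ : 𝓢(Bdry d, ℂ)) :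
    HasFT (fourierMultiplierCLM ℂ (lam ε (-(j : ℝ)))
      (layer ((𝓕⁻ ψ : 𝓢(Bdry d, ℂ)) : 𝓢'(Bdry d, ℂ)))) (fun ξ => (base ε ξ)⁻¹ ^ j * ψ (tang d ξ)) := by
  have h1 := hasFT_schwartz (𝓕⁻ ψ : 𝓢(Bdry d, ℂ))
  rw [fourier_fourierInv_eq] at h1
  refine ((h1.layer (ψ.memLp 2 volume)).mult (hasTemperateGrowth_lam hε (-(j : ℝ)))).congr ?_
  ext ξ
  rw [lam_neg_natCast]

/-- Partial fractions lower j + l until only one kind of factor is left. A pure minus power belongs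
to a function vanishing on x_n > 0, with truncation 0. A pure plus power belongs to a function
supported in x_n ≥ 0; it is its own truncation and the image of the model x_n^j
e^{-⟨ξ'⟩x_n}ψ/Γ(a+j), which vanishes at the boundary because j ≥ 1. -/
theorem hasFlatCut_atom (ha : 0 < a) (N : ℕ) (ha1 : a < 1) : ∀ (j l : ℕ) (ψ : 𝓢(Bdry d, ℂ)),
    1 ≤ j + l → j + l ≤ N → HasFlatCut a (atom j l ψ) := by
  induction N with
  | zero => intro j l ψ h1 h2; omega
  | succ N ih =>
    intro j l ψ h1 h2
    rcases j with - | j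
    · have h3 : HasFT _ (atom 0 l ψ) :=
        (hasFT_mult_layer (ε := -1) (by norm_num) l ψ).congr (by ext ξ; rw [atom, pow_zero, one_mul])
      refine ⟨0, _, 0, map_zero _, h3, HasFT.zero.congr ?_, h3.isL2 (memLp_atom h1 ψ), IsL2.zero,
        Van.zero, ?_⟩
      · ext ξ
        simp [halfFT]
      · rw [sub_zero]
        exact (van_layer 1 _).mult_lam_neg_one _
    rcases l with - | l
    · have h3 : HasFT _ (atom (j + 1) 0 ψ) :=
        (hasFT_mult_layer (ε := 1) (by norm_num) (j + 1) ψ).congr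
          (by ext ξ; rw [atom, pow_zero, mul_one])
      have hG : (Real.Gamma (a + (j + 1 : ℕ)) : ℂ) ≠ 0 :=
        Complex.ofReal_ne_zero.2 (Real.Gamma_pos_of_pos (by positivity)).ne'
      have h4 := h3.isL2 (memLp_atom h1 ψ)
      refine ⟨(Real.Gamma (a + (j + 1 : ℕ)) : ℂ)⁻¹ • expTensor (j + 1) ψ, _, _,
        by rw [map_smul, slice_expTensor_succ, smul_zero], h3, h3.congr ?_, h4, h4,
        (van_layer (-1) _).mult_lam_one _, by rw [sub_self]; exact Van.zero⟩
      ext ξ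
      have h5 : lam 1 a ξ * lam 1 (-(a + (j + 1 : ℕ))) ξ = (base 1 ξ)⁻¹ ^ (j + 1) := by
        rw [← lam_add, ← lam_neg_natCast]; congr 1; ring
      rw [halfFT_smul, halfFT_expTensor ha, inv_mul_cancel_left₀ hG, ← mul_assoc, h5, atom,
        pow_zero, mul_one]
    · rw [funext (atom_succ_succ j l ψ)]
      exact (ih (j + 1) l _ (by omega) (by omega)).add ha ha1
        (ih j (l + 1) _ (by omega) (by omega))

end Atom


open Set

/-! ### Density of the span of the elementary functions -/

section Determining

open BoundedContinuousFunction

variable {E : Type*} [MeasurableSpace E] [PseudoEMetricSpace E] [BorelSpace E] [CompleteSpace E]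
  [SecondCountableTopology E] {μ : Measure E} {A : StarSubalgebra ℂ (E →ᵇ ℂ)}

/-- The positive and negative parts of R are densities of two finite measures with the same
integrals against the algebra. A separating star-subalgebra determines a finite measure, so the
densities agree, and they have disjoint supports. -/
theorem ae_eq_zero_of_integral_subalgebra_real
    (hA : (A.map (toContinuousMapStarₐ ℂ)).SeparatesPoints) {R : E → ℝ} (hR : Integrable R μ)
    (h : ∀ g ∈ A, ∫ x, g x * (R x : ℂ) ∂μ = 0) : R =ᵐ[μ] 0 := by
  have hf := isFiniteMeasure_withDensity_ofReal hR.2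
  have hf' := isFiniteMeasure_withDensity_ofReal hR.neg.2
  have hm := hR.1.aemeasurable.ennreal_ofReal
  have hm' := hR.neg.1.aemeasurable.ennreal_ofReal
  have hP : μ.withDensity (fun x => ENNReal.ofReal (R x)) =
      μ.withDensity (fun x => ENNReal.ofReal ((-R) x)) := by
    refine ext_of_forall_mem_subalgebra_integral_eq_of_pseudoEMetric_complete_countable hA
      fun g hg => ?_
    rw [integral_withDensity_eq_integral_toReal_smul₀ hm (ae_of_all _ fun _ => ENNReal.ofReal_lt_top),
      integral_withDensity_eq_integral_toReal_smul₀ hm' (ae_of_all _ fun _ => ENNReal.ofReal_lt_top),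
      ← sub_eq_zero, ← integral_sub, ← h g hg]
    · refine integral_congr_ae (ae_of_all _ fun x => ?_)
      simp only [ENNReal.toReal_ofReal', Pi.neg_apply, Complex.real_smul]
      rw [← sub_mul, ← Complex.ofReal_sub, max_zero_sub_max_neg_zero_eq_self, mul_comm]
    · simp only [ENNReal.toReal_ofReal']
      exact hR.pos_part.smul_of_top_left ((memLp_top_of_bound
        g.continuous.aestronglyMeasurable ‖g‖ (ae_of_all _ g.norm_coe_le_norm)))
    · simp only [ENNReal.toReal_ofReal']
      exact hR.neg.pos_part.smul_of_top_left ((memLp_top_of_bound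
        g.continuous.aestronglyMeasurable ‖g‖ (ae_of_all _ g.norm_coe_le_norm)))
  rw [withDensity_eq_iff hm hm' hR.lintegral_lt_top.ne] at hP
  filter_upwards [hP] with x hx
  simp only [Pi.neg_apply] at hx
  rcases lt_trichotomy (R x) 0 with h1 | h1 | h1
  · rw [ENNReal.ofReal_of_nonpos h1.le, eq_comm, ENNReal.ofReal_eq_zero] at hx
    linarith
  · exact h1
  · rw [ENNReal.ofReal_of_nonpos (p := -R x) (by linarith), ENNReal.ofReal_eq_zero] at hx
    linarith

/-- An integrable function annihilated by a separating star-subalgebra of bounded continuous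
functions vanishes almost everywhere. -/
theorem ae_eq_zero_of_integral_subalgebra
    (hA : (A.map (toContinuousMapStarₐ ℂ)).SeparatesPoints) {H : E → ℂ} (hH : Integrable H μ)
    (h : ∀ g ∈ A, ∫ x, g x * H x ∂μ = 0) : H =ᵐ[μ] 0 := by
  have hint : ∀ g : E →ᵇ ℂ, Integrable (fun x => g x * H x) μ := fun g =>
    hH.bdd_mul (c := ‖g‖) g.continuous.aestronglyMeasurable (ae_of_all _ g.norm_coe_le_norm)
  have hH' : Integrable (fun x => (starRingEnd ℂ) (H x)) μ :=
    (Complex.conjCLE : ℂ →L[ℝ] ℂ).integrable_comp hH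
  have hint' : ∀ g : E →ᵇ ℂ, Integrable (fun x => g x * (starRingEnd ℂ) (H x)) μ := fun g =>
    hH'.bdd_mul (c := ‖g‖) g.continuous.aestronglyMeasurable (ae_of_all _ g.norm_coe_le_norm)
  -- Closure of the algebra under conjugation shows that the conjugate of H is annihilated as well,
  -- hence its real and imaginary parts separately.
  have h' : ∀ g ∈ A, ∫ x, g x * (starRingEnd ℂ) (H x) ∂μ = 0 := fun g hg => by
    have h1 := h (star g) (star_mem hg)
    rw [← map_eq_zero (starRingEnd ℂ), ← integral_conj] at h1
    rw [← h1]
    refine integral_congr_ae (ae_of_all _ fun x => ?_)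
    simp
  have hre := ae_eq_zero_of_integral_subalgebra_real (R := fun x => (H x).re) hA hH.re fun g hg => by
    have h1 : ∫ x, (g x * H x + g x * (starRingEnd ℂ) (H x)) ∂μ = 0 := by
      rw [integral_add (hint g) (hint' g), h g hg, h' g hg, add_zero]
    have h2 : ∀ x, g x * ((H x).re : ℂ) = (1 / 2) * (g x * H x + g x * (starRingEnd ℂ) (H x)) :=
      fun x => by
        rw [← mul_add, Complex.add_conj]; push_cast; ring
    simp only [h2]
    rw [integral_const_mul, h1, mul_zero]
  have him := ae_eq_zero_of_integral_subalgebra_real (R := fun x => (H x).im) hA hH.im fun g hg => by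
    have h1 : ∫ x, (g x * H x - g x * (starRingEnd ℂ) (H x)) ∂μ = 0 := by
      rw [integral_sub (hint g) (hint' g), h g hg, h' g hg, sub_zero]
    have h2 : ∀ x, g x * ((H x).im : ℂ) =
        (-Complex.I / 2) * (g x * H x - g x * (starRingEnd ℂ) (H x)) := fun x => by
      rw [← mul_sub, Complex.sub_conj]
      push_cast
      linear_combination (g x * (H x).im) * Complex.I_sq
    simp only [h2]
    rw [integral_const_mul, h1, mul_zero]
  filter_upwards [hre, him] with x h1 h2
  exact Complex.ext h1 h2

end Determining

/-! ### The elementary functions and their multipliers -/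

section Density

open BoundedContinuousFunction

variable {d : ℕ}

/-- The span of the elementary functions of order at most `-N`. -/
def atomSpan (d N : ℕ) : Submodule ℂ (Full d → ℂ) :=
  Submodule.span ℂ {h | ∃ j l ψ, N ≤ j + l ∧ h = atom j l ψ}

theorem atom_mem_atomSpan {N j l : ℕ} (h : N ≤ j + l) (ψ : 𝓢(Bdry d, ℂ)) :
    atom j l ψ ∈ atomSpan d N := Submodule.subset_span ⟨j, l, ψ, h, rfl⟩

theorem mul_mem_atomSpan {N : ℕ} {p : Full d → ℂ}
    (hp : ∀ j l ψ, N ≤ j + l → p * atom j l ψ ∈ atomSpan d N) {h : Full d → ℂ}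
    (hh : h ∈ atomSpan d N) : p * h ∈ atomSpan d N := by
  induction hh using Submodule.span_induction with
  | mem x hx =>
    obtain ⟨j, l, ψ, h1, rfl⟩ := hx
    exact hp j l ψ h1
  | zero => rw [mul_zero]; exact zero_mem _
  | add x y _ _ hx hy => rw [mul_add]; exact add_mem hx hy
  | smul c x _ hx => rw [mul_smul_comm]; exact Submodule.smul_mem _ c hx

/-- The bounded continuous multipliers of `atomSpan`. -/
def multiplierAlgebra (d N : ℕ) : StarSubalgebra ℂ (Full d →ᵇ ℂ) where
  -- Asking for both g and its conjugate makes the set closed under the star operation by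
  -- construction.
  carrier := {g | ∀ h ∈ atomSpan d N, ⇑g * h ∈ atomSpan d N ∧ ⇑(star g) * h ∈ atomSpan d N}
  mul_mem' {f g} hf hg h hh := by
    refine ⟨?_, ?_⟩
    · have := (hf _ (hg h hh).1).1
      rwa [← mul_assoc] at this
    · have := (hg _ (hf h hh).2).2
      rw [← mul_assoc] at this
      have e : ⇑(star (f * g)) = ⇑(star g) * ⇑(star f) := by
        ext ξ
        simp [mul_comm]
      rw [e]
      exact this
  add_mem' {f g} hf hg h hh := by
    refine ⟨?_, ?_⟩
    · have := add_mem (hf h hh).1 (hg h hh).1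
      rwa [← add_mul] at this
    · have := add_mem (hf h hh).2 (hg h hh).2
      rw [← add_mul] at this
      rw [star_add]; exact this
  algebraMap_mem' r h hh := by
    refine ⟨Submodule.smul_mem _ r hh, ?_⟩
    rw [← algebraMap_star_comm]
    exact Submodule.smul_mem _ (star r) hh
  star_mem' {f} hf h hh := by
    rw [star_star]
    exact (hf h hh).symm

theorem norm_base_inv_le_one {ε : ℝ} (hε : ε ^ 2 = 1) (ξ : Full d) : ‖(base ε ξ)⁻¹‖ ≤ 1 := by
  rw [norm_base_inv hε]
  exact inv_le_one_of_one_le₀ (one_le_fjap ξ)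

/-- The bounded function `(⟨ξ'⟩ + iξ_n)^{-1}`. -/
def baseInv (d : ℕ) : Full d →ᵇ ℂ :=
  BoundedContinuousFunction.ofNormedAddCommGroup (fun ξ => (base 1 ξ)⁻¹) (continuous_base_inv 1) 1
    (norm_base_inv_le_one (by norm_num))

/-- Multiplication raises j by one, and multiplication by the conjugate raises l by one; both
preserve j + l ≥ N. -/
theorem baseInv_mem (N : ℕ) : baseInv d ∈ multiplierAlgebra d N := by
  refine fun h hh => ⟨mul_mem_atomSpan (fun j l ψ hN => ?_) hh,
    mul_mem_atomSpan (fun j l ψ hN => ?_) hh⟩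
  · have : ⇑(baseInv d) * atom j l ψ = atom (j + 1) l ψ := by
      ext ξ
      change (base 1 ξ)⁻¹ * ((base 1 ξ)⁻¹ ^ j * _ * _) = (base 1 ξ)⁻¹ ^ (j + 1) * _ * _
      ring
    rw [this]
    exact atom_mem_atomSpan (by omega) ψ
  · have : ⇑(star (baseInv d)) * atom j l ψ = atom j (l + 1) ψ := by
      ext ξ
      change (starRingEnd ℂ) (base 1 ξ)⁻¹ * (_ * (base (-1) ξ)⁻¹ ^ l * _) =
        _ * (base (-1) ξ)⁻¹ ^ (l + 1) * _
      rw [map_inv₀, ← base_neg_eq_conj]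
      ring
    rw [this]
    exact atom_mem_atomSpan (by omega) ψ

theorem norm_inner_mul_jap_le (e y : Bdry d) :
    ‖((inner ℝ e y * jap y ^ (-1 : ℝ) : ℝ) : ℂ)‖ ≤ ‖e‖ := by
  rw [Complex.norm_real, norm_mul, Real.rpow_neg_one, norm_inv, Real.norm_of_nonneg (jap_pos y).le,
    ← div_eq_mul_inv, div_le_iff₀ (jap_pos y)]
  refine (norm_inner_le_norm e y).trans (mul_le_mul_of_nonneg_left ?_ (norm_nonneg e))
  refine abs_le_of_sq_le_sq' ?_ (jap_pos y).le |>.2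
  rw [jap_sq, norm_smul, mul_pow, Real.norm_eq_abs, sq_abs]
  nlinarith [four_le_two_pi_sq, sq_nonneg ‖y‖]

theorem temperate_inner_mul_jap (e : Bdry d) :
    (fun y : Bdry d => ((inner ℝ e y * jap y ^ (-1 : ℝ) : ℝ) : ℂ)).HasTemperateGrowth :=
  hasTemperateGrowth_ofReal
    ((innerSL ℝ e).hasTemperateGrowth.mul (hasTemperateGrowth_jap_rpow (-1)))

/-- The bounded function `(e · ξ') ⟨ξ'⟩^{-1}`. -/
def direction (e : Bdry d) : Full d →ᵇ ℂ :=
  BoundedContinuousFunction.ofNormedAddCommGroup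
    (fun ξ => ((inner ℝ e (tang d ξ) * jap (tang d ξ) ^ (-1 : ℝ) : ℝ) : ℂ))
    ((temperate_inner_mul_jap e).1.continuous.comp (tang d).continuous) ‖e‖
    (fun ξ => norm_inner_mul_jap_le e (tang d ξ))

theorem direction_mem (N : ℕ) (e : Bdry d) : direction e ∈ multiplierAlgebra d N := by
  have key : ∀ j l ψ, N ≤ j + l → ⇑(direction e) * atom j l ψ ∈ atomSpan d N := by
    intro j l ψ hN
    have : ⇑(direction e) * atom j l ψ = atom j l (SchwartzMap.smulLeftCLM ℂ
        (fun y : Bdry d => ((inner ℝ e y * jap y ^ (-1 : ℝ) : ℝ) : ℂ)) ψ) := by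
      ext ξ
      rw [atom, SchwartzMap.smulLeftCLM_apply_apply (temperate_inner_mul_jap e), smul_eq_mul]
      change ((inner ℝ e (tang d ξ) * jap (tang d ξ) ^ (-1 : ℝ) : ℝ) : ℂ) * (_ * _ * _) = _
      ring
    rw [this]
    exact atom_mem_atomSpan hN _
  have hs : star (direction e) = direction e := by
    ext ξ
    exact Complex.conj_ofReal _
  exact fun h hh => ⟨mul_mem_atomSpan key hh, by rw [hs]; exact mul_mem_atomSpan key hh⟩

/-- The inverse of ⟨ξ'⟩ + iξ_n determines ⟨ξ'⟩ and ξ_n. Once ⟨ξ'⟩ is known, the functions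
(e·ξ')⟨ξ'⟩^{-1} determine ξ'; it suffices to take e to be the difference of the two tangential
parts. -/
theorem separatesPoints_multiplierAlgebra (N : ℕ) :
    ((multiplierAlgebra d N).map (toContinuousMapStarₐ ℂ)).SeparatesPoints := by
  intro x y hxy
  by_contra! hc
  have hval : ∀ g ∈ multiplierAlgebra d N, g x = g y := fun g hg =>
    hc g ⟨toContinuousMapStarₐ ℂ g, ⟨g, hg, rfl⟩, rfl⟩
  have h1 : base 1 x = base 1 y := inv_injective (hval _ (baseInv_mem N))
  have h2 : jap (tang d x) = jap (tang d y) := by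
    rw [← base_re 1, ← base_re 1, h1]
  have h3 : normal d x = normal d y := by
    have h4 := congrArg Complex.im h1
    rw [base_im, base_im, one_mul, one_mul] at h4
    exact mul_left_cancel₀ (by positivity) h4
  have h5 : inner ℝ (tang d x - tang d y) (tang d x - tang d y) = 0 := by
    have h6 := Complex.ofReal_injective (hval _ (direction_mem N (tang d x - tang d y)))
    rw [h2] at h6
    rw [inner_sub_right, sub_eq_zero]
    exact mul_right_cancel₀ (Real.rpow_pos_of_pos (jap_pos _) _).ne' h6
  have h7 : tang d x = tang d y := sub_eq_zero.1 (inner_self_eq_zero.1 h5)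
  exact hxy (by rw [← mk_tang_normal x, ← mk_tang_normal y, h7, h3])

theorem memLp_of_mem_atomSpan {m : ℝ} {N : ℕ} (hN : m + 1 ≤ N) {h : Full d → ℂ}
    (hh : h ∈ atomSpan d N) : MemLp (fun ξ => ((fjap ξ ^ m : ℝ) : ℂ) * h ξ) 2 := by
  induction hh using Submodule.span_induction with
  | mem x hx =>
    obtain ⟨j, l, ψ, h1, rfl⟩ := hx
    refine memLp_fjap_mul_atom (hN.trans ?_) ψ
    exact_mod_cast h1
  | zero => simp
  | add x y _ _ hx hy => simpa only [Pi.add_apply, mul_add] using! hx.add hy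
  | smul c x _ hx =>
    simpa only [Pi.smul_apply, smul_eq_mul, mul_left_comm] using! hx.const_mul c

/-- Multiplying q by one weighted elementary function gives an integrable function annihilated by
the multiplier algebra, hence zero. With ψ = 1 on a large ball that elementary function has no zeros
over the ball, so q vanishes there. -/
theorem ae_eq_zero_of_orthogonal {m : ℝ} {N : ℕ} (hN : m + 1 ≤ N) {q : Full d → ℂ}
    (hq : MemLp q 2)
    (h0 : ∀ h ∈ atomSpan d N, ∫ ξ, ((fjap ξ ^ m : ℝ) : ℂ) * h ξ * q ξ = 0) : q =ᵐ[volume] 0 := by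
  have key : ∀ n : ℕ, ∀ᵐ ξ, ‖tang d ξ‖ < n → q ξ = 0 := by
    intro n
    rcases Nat.eq_zero_or_pos n with rfl | hn
    · filter_upwards with ξ hξ
      have := norm_nonneg (tang d ξ)
      norm_num at hξ
      linarith
    have hn' : (0 : ℝ) < n := by exact_mod_cast hn
    let χ : ContDiffBump (0 : Bdry d) := ⟨n, n + 1, hn', by linarith⟩
    let ψ : 𝓢(Bdry d, ℂ) := HasCompactSupport.toSchwartzMap (f := fun y => (χ y : ℂ))
      (χ.hasCompactSupport.comp_left (g := fun r : ℝ => (r : ℂ)) Complex.ofReal_zero)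
      (Complex.ofRealCLM.contDiff.comp χ.contDiff)
    have hψ := atom_mem_atomSpan (N := N) (j := N) (l := 0) (by omega) ψ
    have hH : Integrable fun ξ => ((fjap ξ ^ m : ℝ) : ℂ) * atom N 0 ψ ξ * q ξ :=
      MemLp.integrable_mul (p := 2) (q := 2) (memLp_of_mem_atomSpan hN hψ) hq
    have hz := ae_eq_zero_of_integral_subalgebra (separatesPoints_multiplierAlgebra N) hH
      fun g hg => by
        rw [← h0 _ (hg _ hψ).1]
        refine integral_congr_ae (ae_of_all _ fun ξ => ?_)
        simp only [Pi.mul_apply]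
        ring
    filter_upwards [hz] with ξ h1 h2
    have h3 : ψ (tang d ξ) = 1 := by
      change ((χ (tang d ξ) : ℝ) : ℂ) = 1
      rw [χ.one_of_mem_closedBall (by simpa using h2.le)]
      rfl
    have h4 : ((fjap ξ ^ m : ℝ) : ℂ) ≠ 0 :=
      Complex.ofReal_ne_zero.2 (Real.rpow_pos_of_pos (fjap_pos ξ) m).ne'
    simpa [atom, h3, h4, base_ne_zero] using h1
  filter_upwards [ae_all_iff.2 key] with ξ hξ
  obtain ⟨n, hn⟩ := exists_nat_gt ‖tang d ξ‖
  exact hξ n hn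

/-- `atomSpan` is dense in the weighted `L₂`-space. -/
theorem exists_mem_atomSpan_eLpNorm_lt {m : ℝ} {N : ℕ} (hN : m + 1 ≤ N) {k : Full d → ℂ}
    (hk : MemLp (fun ξ => ((fjap ξ ^ m : ℝ) : ℂ) * k ξ) 2) {r : ℝ≥0∞} (hr : 0 < r) :
    ∃ h ∈ atomSpan d N, eLpNorm (fun ξ => ((fjap ξ ^ m : ℝ) : ℂ) * (k ξ - h ξ)) 2 < r := by
  let K : Submodule ℂ (Lp ℂ 2 (volume : Measure (Full d))) :=
    { carrier := {f | ∃ (h : Full d → ℂ) (hh : h ∈ atomSpan d N),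
        (memLp_of_mem_atomSpan hN hh).toLp _ = f}
      zero_mem' := ⟨0, zero_mem _, by
        rw [Lp.eq_zero_iff_ae_eq_zero]
        filter_upwards [MemLp.coeFn_toLp (memLp_of_mem_atomSpan hN (zero_mem (atomSpan d N)))]
          with ξ hξ
        simpa using hξ⟩
      add_mem' := by
        rintro _ _ ⟨f, hf, rfl⟩ ⟨g, hg, rfl⟩
        refine ⟨f + g, add_mem hf hg, ?_⟩
        rw [← MemLp.toLp_add, MemLp.toLp_eq_toLp_iff]
        exact ae_of_all _ fun ξ => by simp [mul_add]
      smul_mem' := by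
        rintro c _ ⟨f, hf, rfl⟩
        refine ⟨c • f, Submodule.smul_mem _ c hf, ?_⟩
        rw [← MemLp.toLp_const_smul, MemLp.toLp_eq_toLp_iff]
        exact ae_of_all _ fun ξ => by simp [mul_left_comm] }
  -- Density in the Hilbert space is triviality of the orthogonal complement; the inner product is
  -- sesquilinear, so the orthogonality criterion is applied to the conjugate of q.
  have hK : K.topologicalClosure = ⊤ := by
    rw [Submodule.topologicalClosure_eq_top_iff, Submodule.eq_bot_iff]
    intro q hq
    have h1 : (fun ξ => (starRingEnd ℂ) (q ξ)) =ᵐ[volume] 0 := by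
      refine ae_eq_zero_of_orthogonal hN (Lp.memLp q).star fun h hh => ?_
      have h2 := (Submodule.mem_orthogonal' K q).1 hq _ ⟨h, hh, rfl⟩
      rw [L2.inner_def] at h2
      rw [← h2]
      refine integral_congr_ae ?_
      filter_upwards [(memLp_of_mem_atomSpan hN hh).coeFn_toLp] with ξ hξ
      rw [hξ, RCLike.inner_apply]
    rw [Lp.eq_zero_iff_ae_eq_zero]
    filter_upwards [h1] with ξ hξ
    simpa using hξ
  have h1 : hk.toLp _ ∈ closure (K : Set (Lp ℂ 2 (volume : Measure (Full d)))) := by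
    rw [← Submodule.topologicalClosure_coe, hK]
    trivial
  obtain ⟨_, ⟨h, hh, rfl⟩, h2⟩ := EMetric.mem_closure_iff.1 h1 r hr
  refine ⟨h, hh, ?_⟩
  rw [Lp.edist_toLp_toLp] at h2
  refine lt_of_eq_of_lt ?_ h2
  congr 1
  ext ξ
  simp only [Pi.sub_apply, mul_sub]

theorem hasFlatCut_of_mem_atomSpan {a : ℝ} (ha : 0 < a) (ha1 : a < 1) {N : ℕ} (hN : 1 ≤ N)
    {h : Full d → ℂ} (hh : h ∈ atomSpan d N) : HasFlatCut a h := by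
  induction hh using Submodule.span_induction with
  | mem x hx =>
    obtain ⟨j, l, ψ, h1, rfl⟩ := hx
    exact hasFlatCut_atom ha (j + l) ha1 j l ψ (hN.trans h1) le_rfl
  | zero => simpa using! (hasFlatCut_atom ha N ha1 N 0 (0 : 𝓢(Bdry d, ℂ)) hN le_rfl).smul 0
  | add x y _ _ hx hy => exact hx.add ha ha1 hy
  | smul c x _ hx => exact hx.smul c

end Density


open Set

/-! ### Uniqueness -/

section Uniqueness

open FourierTransform

variable {d : ℕ}

theorem one_le_bessel {V : Type*} [NormedAddCommGroup V] {s : ℝ} (hs : 0 ≤ s) (ξ : V) :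
    1 ≤ bessel s ξ :=
  Real.one_le_rpow (by nlinarith [sq_nonneg ‖ξ‖]) (by linarith)

theorem continuous_bessel {V : Type*} [NormedAddCommGroup V] (s : ℝ) :
    Continuous fun ξ : V => (bessel s ξ : ℂ) := by
  refine Complex.continuous_ofReal.comp (Continuous.rpow_const (by fun_prop) fun ξ => Or.inl ?_)
  positivity

/-- Comparison of the weights `(1 + |ξ|²)^{s/2}` and `(1 + |2πξ|²)^{r/2}`. -/
theorem memLp_fjap_of_bessel {r s : ℝ} (hr : 0 ≤ r) (hrs : r ≤ s) {k : Full d → ℂ}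
    (hk : MemLp (fun ξ => (bessel s ξ : ℂ) * k ξ) 2) :
    MemLp (fun ξ => ((fjap ξ ^ r : ℝ) : ℂ) * k ξ) 2 ∧
    eLpNorm (fun ξ => ((fjap ξ ^ r : ℝ) : ℂ) * k ξ) 2 ≤
      ENNReal.ofReal ((2 * Real.pi) ^ s) * eLpNorm (fun ξ => (bessel s ξ : ℂ) * k ξ) 2 := by
  have hkm : AEStronglyMeasurable k volume := aestronglyMeasurable_of_weight
    (continuous_bessel s) (fun ξ => Complex.ofReal_ne_zero.2 (bessel_pos s ξ).ne') hk.1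
  have hle : ∀ ξ, ‖((fjap ξ ^ r : ℝ) : ℂ) * k ξ‖ ≤
      (2 * Real.pi) ^ s * ‖(bessel s ξ : ℂ) * k ξ‖ := fun ξ => by
    rw [norm_mul, norm_mul, norm_ofReal_rpow (fjap_pos ξ), Complex.norm_real,
      Real.norm_of_nonneg (bessel_pos s ξ).le, ← mul_assoc]
    exact mul_le_mul_of_nonneg_right ((Real.rpow_le_rpow_of_exponent_le (one_le_fjap ξ) hrs).trans
      (fjap_le_bessel (hr.trans hrs) ξ)) (norm_nonneg _)
  exact ⟨memLp_of_norm_le_mul hk ((continuous_fjap_rpow r).aestronglyMeasurable.mul hkm) hle,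
    eLpNorm_le_of_norm_le_mul hle⟩

theorem memLp_of_bessel {V : Type*} [NormedAddCommGroup V] [MeasurableSpace V] [BorelSpace V]
    {μ : Measure V} {s : ℝ} (hs : 0 ≤ s) {k : V → ℂ}
    (hk : MemLp (fun ξ => (bessel s ξ : ℂ) * k ξ) 2 μ) :
    MemLp k 2 μ ∧ eLpNorm k 2 μ ≤ eLpNorm (fun ξ => (bessel s ξ : ℂ) * k ξ) 2 μ := by
  have hkm : AEStronglyMeasurable k μ := aestronglyMeasurable_of_weight
    (continuous_bessel s) (fun ξ => Complex.ofReal_ne_zero.2 (bessel_pos s ξ).ne') hk.1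
  have hle : ∀ ξ, ‖k ξ‖ ≤ ‖(bessel s ξ : ℂ) * k ξ‖ := fun ξ => by
    rw [norm_mul, Complex.norm_real, Real.norm_of_nonneg (bessel_pos s ξ).le]
    exact le_mul_of_one_le_left (norm_nonneg _) (one_le_bessel hs ξ)
  exact ⟨hk.of_le hkm (ae_of_all _ hle), eLpNorm_mono hle⟩

theorem HasFT.enorm_apply_le {V : Type*} [NormedAddCommGroup V] [InnerProductSpace ℝ V]
    [FiniteDimensional ℝ V] [MeasurableSpace V] [BorelSpace V] {U : 𝓢'(V, ℂ)} {k : V → ℂ}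
    (h : HasFT U k) (hk : MemLp k 2) (Θ : 𝓢(V, ℂ)) :
    ‖U Θ‖ₑ ≤ eLpNorm (𝓕⁻ Θ : 𝓢(V, ℂ)) 2 * eLpNorm k 2 := by
  have h1 := h.eq (𝓕⁻ Θ)
  rw [fourier_fourierInv_eq] at h1
  rw [h1]
  generalize (𝓕⁻ Θ : 𝓢(V, ℂ)) = ψ
  refine (enorm_integral_le_lintegral_enorm _).trans ?_
  rw [← eLpNorm_one_eq_lintegral_enorm]
  have h2 : eLpNorm (⇑ψ • k) 1 ≤ eLpNorm ψ 2 * eLpNorm k 2 :=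
    eLpNorm_smul_le_mul_eLpNorm hk.1 ψ.continuous.aestronglyMeasurable
  exact h2

/-- `Ξ₊` is a differential operator in `x_n`. -/
theorem Van.mult_lam_one_one {U : 𝓢'(Full d, ℂ)} (hU : Van 1 U) :
    Van 1 (fourierMultiplierCLM ℂ (lam 1 1) U) := by
  -- Ξ₊ = 2⟨D'⟩ - Ξ₋, and both terms preserve vanishing on x_n > 0.
  have h1 := hU.mult_tang temperate_two_mul_jap
  have h2 := hU.mult_lam_neg_one 1
  have h3 := mult_add (temperate_lam_one (d := d) 1) (temperate_lam_neg_one 1) U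
  have h4 : (fun ξ : Full d => lam 1 1 ξ + lam (-1) 1 ξ) =
      fun ξ => ((2 * jap (tang d ξ) : ℝ) : ℂ) := by
    ext ξ
    rw [lam_one, lam_one, base_add_base]
    push_cast; rfl
  rw [h4] at h3
  rw [eq_sub_of_add_eq h3.symm]
  exact h1.sub h2

theorem mult_lam_lam {ε : ℝ} (hε : ε ^ 2 = 1) (τ τ' : ℝ) (U : 𝓢'(Full d, ℂ)) :
    fourierMultiplierCLM ℂ (lam ε τ) (fourierMultiplierCLM ℂ (lam ε τ') U) =
      fourierMultiplierCLM ℂ (lam ε (τ + τ')) U := by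
  rw [mult_mult (hasTemperateGrowth_lam hε τ) (hasTemperateGrowth_lam hε τ')]
  congr 1
  rw [← funext (lam_add ε τ τ')]

theorem mult_lam_zero (ε : ℝ) (U : 𝓢'(Full d, ℂ)) : fourierMultiplierCLM ℂ (lam ε 0) U = U := by
  have : lam (d := d) ε 0 = fun _ => 1 := funext (lam_zero ε)
  rw [this, TemperedDistribution.fourierMultiplierCLM_const, one_smul]
  rfl

/-- `Ξ₊^{a-1} e⁺ x_n^{a-1} w` is in `L₂`. -/
theorem isL2_lam_powMul {a : ℝ} (ha : 0 < a) (ha1 : a < 1) (w : 𝓢(Full d, ℂ)) :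
    IsL2 (fourierMultiplierCLM ℂ (lam 1 (a - 1)) (powMul (a - 1) w)) := by
  set Z := fourierMultiplierCLM ℂ (lam 1 a) (powMul (a - 1) w) -
    (Real.Gamma a : ℂ) • layer (boundaryValue w : 𝓢'(Bdry d, ℂ)) with hZ
  have hL2 : IsL2 Z := isL2_xi_powMul_sub ha ha1 w
  have hv : Van (-1) Z := ((van_powMul ha ha1 w).mult_lam_one a).sub ((van_layer _ _).smul _)
  obtain ⟨f, hf⟩ := id hL2
  obtain ⟨p, hp, hp2, -⟩ := exists_hasFT_toLp f
  rw [← hf] at hp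
  obtain ⟨C, -, hC⟩ := exists_resolvent_extension (d := d) (m := 0) le_rfl
  -- Z is square-integrable and supported in x_n ≥ 0, so it is its own truncation, and the case m =
  -- 0 of `exists_resolvent_extension` applies to Z plus the layer.
  have hc : IsCut Z Z := ⟨hL2, hL2, hv, by rw [sub_self]; exact Van.zero⟩
  have hb : MemLp (fun y : Bdry d => ((jap y ^ ((0 : ℝ) + 1 / 2) : ℝ) : ℂ) *
      ((Real.Gamma a : ℂ) * (𝓕 (boundaryValue w) : 𝓢(Bdry d, ℂ)) y)) 2 := by
    have h1 := (SchwartzMap.smulLeftCLM ℂ (fun y : Bdry d => ((jap y ^ ((0 : ℝ) + 1 / 2) : ℝ) : ℂ))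
      ((Real.Gamma a : ℂ) • (𝓕 (boundaryValue w) : 𝓢(Bdry d, ℂ)))).memLp 2 volume
    refine (memLp_congr_ae (ae_of_all _ fun y => ?_)).1 h1
    rw [SchwartzMap.smulLeftCLM_apply_apply
      (hasTemperateGrowth_ofReal (hasTemperateGrowth_jap_rpow _))]
    rfl
  have h1 := (hC hp (by simpa using hp2) hc ((hasFT_schwartz (boundaryValue w)).smul _) hb).1
  have h2 : Z + layer ((Real.Gamma a : ℂ) • (boundaryValue w : 𝓢'(Bdry d, ℂ))) =
      fourierMultiplierCLM ℂ (lam 1 a) (powMul (a - 1) w) := by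
    rw [map_smul, hZ, sub_add_cancel]
  rw [h2, mult_lam_lam (by norm_num), neg_add_eq_sub] at h1
  exact h1

theorem memLp_fjap_mult_lam {ε : ℝ} (hε : ε ^ 2 = 1) {r τ t : ℝ} (ht : t = r + τ)
    {k : Full d → ℂ} (hk : MemLp (fun ξ => ((fjap ξ ^ t : ℝ) : ℂ) * k ξ) 2) :
    MemLp (fun ξ => ((fjap ξ ^ r : ℝ) : ℂ) * (lam ε τ ξ * k ξ)) 2 ∧
    eLpNorm (fun ξ => ((fjap ξ ^ r : ℝ) : ℂ) * (lam ε τ ξ * k ξ)) 2 =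
      eLpNorm (fun ξ => ((fjap ξ ^ t : ℝ) : ℂ) * k ξ) 2 := by
  subst ht
  have hkm : AEStronglyMeasurable k volume := aestronglyMeasurable_of_weight
    (continuous_fjap_rpow (r + τ)) (fun ξ => Complex.ofReal_ne_zero.2
      (Real.rpow_pos_of_pos (fjap_pos ξ) (r + τ)).ne') hk.1
  have heq : ∀ ξ, ‖((fjap ξ ^ r : ℝ) : ℂ) * (lam ε τ ξ * k ξ)‖ =
      ‖((fjap ξ ^ (r + τ) : ℝ) : ℂ) * k ξ‖ := fun ξ => by
    rw [norm_mul, norm_mul, norm_mul, norm_ofReal_rpow (fjap_pos ξ), norm_ofReal_rpow (fjap_pos ξ),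
      norm_lam hε, Real.rpow_add (fjap_pos ξ), mul_assoc]
  exact ⟨hk.of_le ((continuous_fjap_rpow r).aestronglyMeasurable.mul
    ((hasTemperateGrowth_lam hε τ).1.continuous.aestronglyMeasurable.mul hkm))
    (ae_of_all _ fun ξ => (heq ξ).le), eLpNorm_congr_norm_ae (ae_of_all _ heq)⟩

theorem IsCut.exists_hasFT_zero {X Y : 𝓢'(Full d, ℂ)} {k : Full d → ℂ} (hc : IsCut X Y)
    (h : HasFT X k) (hk : MemLp k 2) :
    ∃ l, HasFT Y l ∧ MemLp l 2 ∧ eLpNorm l 2 ≤ eLpNorm k 2 := by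
  have := hc.exists_hasFT (m := 0) le_rfl h (by simpa using hk)
  simpa using this

/-- The explicit form of a solution. -/
theorem eq_of_isSolution {a s : ℝ} (ha : 0 < a) (ha1 : a < 1) (hs : 0 ≤ s)
    {F X Y u : 𝓢'(Full d, ℂ)} {φ : 𝓢'(Bdry d, ℂ)} (hF : IsL2 F)
    (hX : X = fourierMultiplierCLM ℂ (lam (-1) (-a)) F) (hc : IsCut X Y)
    (hu : u ∈ transmissionSpace d (a - 1) (s + 2 * a))
    (he : restr (halfSpace d) (oneSubLaplacianPow a u) = restr (halfSpace d) F)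
    (ht : HasWeightedTrace d (a - 1) (s + 2 * a) u φ) :
    u = fourierMultiplierCLM ℂ (lam 1 (-a)) (Y + (Real.Gamma a : ℂ) • layer φ) := by
  obtain ⟨g, v, ⟨G, hG, hGg⟩, hv, rfl⟩ := hu
  rw [isZeroExtension_iff] at hv
  obtain ⟨hv2, hvv, hvg⟩ := hv
  rw [xiPlus_eq] at he ht ⊢
  rw [oneSubLaplacianPow_eq] at he
  obtain ⟨w, hw1, hw2⟩ := ht
  have hm : s + 2 * a - (a - 1) = s + a + 1 := by ring
  rw [hm] at hG
  simp only [transmissionENorm, xiPlus_eq, hm] at hw1 hw2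
  obtain ⟨γ, hGγ, hγ⟩ := exists_hasFT_of_memSobolev hG
  set W := fourierMultiplierCLM ℂ (lam 1 1) v with hW
  -- `W` agrees with `X` in the half-space
  have hvG : Van 1 (v - G) := van_of_restr_eq hv2 (hGγ.isL2 (memLp_of_bessel (by linarith) hγ).1)
    (hvg.trans hGg.symm)
  have hWG : Van 1 (W - fourierMultiplierCLM ℂ (lam 1 1) G) := by
    rw [hW, ← map_sub]
    exact hvG.mult_lam_one_one
  -- On x_n > 0 this says Ξ₋^a W = (1-Δ)^a u = F. It is first shown with the Sobolev extension G in
  -- place of v, since comparing restrictions requires square integrability, which W may lack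
  -- because of a layer.
  have hGF : Van 1 (fourierMultiplierCLM ℂ (lam (-1) a) (fourierMultiplierCLM ℂ (lam 1 1) G) - F) := by
    refine van_of_restr_eq ?_ hF ?_
    · refine ((hGγ.mult (temperate_lam_one 1)).mult (temperate_lam_neg_one a)).isL2 ?_
      have h1 := (memLp_fjap_of_bessel (r := a + 1) (by linarith) (by linarith) hγ).1
      have h2 := (memLp_fjap_mult_lam (ε := -1) (τ := a) (r := 0) (by norm_num) (zero_add a).symm
        (memLp_fjap_mult_lam (ε := 1) (τ := 1) (r := a) (by norm_num) rfl h1).1).1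
      simpa using h2
    · rw [← he]
      refine (Van.restr_eq ?_).symm
      have h1 : fourierMultiplierCLM ℂ (fun ξ => lam 1 a ξ * lam (-1) a ξ)
          (fourierMultiplierCLM ℂ (lam 1 (-(a - 1))) v) = fourierMultiplierCLM ℂ (lam (-1) a) W := by
        have ht : (fun ξ : Full d => lam 1 a ξ * lam (-1) a ξ).HasTemperateGrowth :=
          (temperate_lam_one a).mul (temperate_lam_neg_one a)
        rw [hW, mult_mult ht (temperate_lam_one _), mult_mult (temperate_lam_neg_one a) (temperate_lam_one _)]
        congr 2
        ext ξ
        rw [mul_right_comm, ← lam_add, mul_comm]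
        congr 2; ring
      rw [h1, ← map_sub]
      exact hWG.mult_lam_neg_one a
  have hWX : Van 1 (W - X) := by
    have h1 := hGF.mult_lam_neg_one (-a)
    rw [map_sub, ← hX, mult_lam_lam (by norm_num), neg_add_cancel, mult_lam_zero] at h1
    have h2 := hWG.add h1
    rwa [sub_add_sub_cancel] at h2
  have hvW : fourierMultiplierCLM ℂ (lam 1 (-(a - 1))) v = fourierMultiplierCLM ℂ (lam 1 (-a)) W := by
    rw [hW, mult_lam_lam (by norm_num), neg_sub, neg_add_eq_sub]
  rw [hvW]
  congr 1
  -- approximation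
  ext Θ
  -- The three summands belong to the three terms of the decomposition `hsplit` below, each
  -- estimated by Cauchy–Schwarz on the Fourier side.
  set C := eLpNorm (𝓕⁻ (𝓕 (SchwartzMap.smulLeftCLM ℂ (lam 1 1) (𝓕⁻ Θ)) : 𝓢(Full d, ℂ)) : 𝓢(Full d, ℂ)) 2 +
    eLpNorm (𝓕⁻ Θ : 𝓢(Full d, ℂ)) 2 * ENNReal.ofReal ((2 * Real.pi) ^ (s + a + 1)) +
    ‖(Real.Gamma a : ℂ)‖ₑ * eLpNorm (𝓕⁻ (slice 0 Θ) : 𝓢(Bdry d, ℂ)) 2 with hC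
  have hCt : C ≠ ⊤ := by
    have h1 := ((𝓕⁻ (𝓕 (SchwartzMap.smulLeftCLM ℂ (lam 1 1) (𝓕⁻ Θ)) : 𝓢(Full d, ℂ)) :
      𝓢(Full d, ℂ)).memLp 2 volume).2.ne
    have h2 := ((𝓕⁻ Θ : 𝓢(Full d, ℂ)).memLp 2 volume).2.ne
    have h3 := ((𝓕⁻ (slice 0 Θ) : 𝓢(Bdry d, ℂ)).memLp 2 volume).2.ne
    exact ENNReal.add_ne_top.2 ⟨ENNReal.add_ne_top.2 ⟨h1, ENNReal.mul_ne_top h2 ENNReal.ofReal_ne_top⟩,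
      ENNReal.mul_ne_top enorm_ne_top h3⟩
  have key : ∀ r : ℝ≥0∞, 0 < r →
      ‖(W - (Y + (Real.Gamma a : ℂ) • layer φ)) Θ‖ₑ ≤ C * r := by
    intro r hr
    obtain ⟨n, hn1, hn2⟩ := ((hw1.eventually (gt_mem_nhds hr)).and
      (hw2.eventually (gt_mem_nhds hr))).exists
    obtain ⟨E, e, hEr, hEe, he2, her⟩ := exists_hasFT_of_sobolevRestrENorm_lt hn1
    obtain ⟨κ, hκ, hκ2, hκr⟩ := exists_hasFT_of_sobolevENorm_lt hn2
    have hv' := isL2_lam_powMul ha ha1 (w n)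
    set Z := fourierMultiplierCLM ℂ (lam 1 a) (powMul (a - 1) (w n)) -
      (Real.Gamma a : ℂ) • layer (boundaryValue (w n) : 𝓢'(Bdry d, ℂ)) with hZ
    have hZ2 : IsL2 Z := isL2_xi_powMul_sub ha ha1 (w n)
    have hZv : Van (-1) Z :=
      ((van_powMul ha ha1 (w n)).mult_lam_one a).sub ((van_layer _ _).smul _)
    set v' := fourierMultiplierCLM ℂ (lam 1 (a - 1)) (powMul (a - 1) (w n)) with hv'_def
    rw [map_sub, mult_lam_lam (by norm_num), add_neg_cancel, mult_lam_zero] at hEr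
    have heL := memLp_of_bessel (by linarith) he2
    -- v - v' is square-integrable, supported in x_n ≥ 0, and agrees with the small H^{s+a+1}
    -- function E on x_n > 0; so it is the truncation of E and is small in L₂.
    have hcE : IsCut E (v - v') := by
      refine ⟨hEe.isL2 heL.1, hv2.sub hv', hvv.sub ((van_powMul ha ha1 (w n)).mult_lam_one _), ?_⟩
      exact van_of_restr_eq (hEe.isL2 heL.1) (hv2.sub hv') hEr
    have hXv' : fourierMultiplierCLM ℂ (lam 1 1) v' =
        Z + (Real.Gamma a : ℂ) • layer (boundaryValue (w n) : 𝓢'(Bdry d, ℂ)) := by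
      rw [hZ, sub_add_cancel, hv'_def, mult_lam_lam (by norm_num), add_sub_cancel]
    have hXE := memLp_fjap_mult_lam (ε := 1) (τ := 1) (r := 0) (by norm_num) (zero_add 1).symm
      (memLp_fjap_of_bessel (r := 1) zero_le_one (by linarith) he2).1
    have hXE' : eLpNorm (fun ξ => lam 1 1 ξ * e ξ) 2 ≤
        ENNReal.ofReal ((2 * Real.pi) ^ (s + a + 1)) *
          eLpNorm (fun ξ => (bessel (s + a + 1) ξ : ℂ) * e ξ) 2 := by
      have h1 := hXE.2
      have h2 := (memLp_fjap_of_bessel (r := 1) zero_le_one (by linarith) he2).2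
      simp only [Real.rpow_zero, Complex.ofReal_one, one_mul] at h1
      rw [h1]; exact h2
    have hXE2 : MemLp (fun ξ => lam 1 1 ξ * e ξ) 2 := by simpa using hXE.1
    -- On x_n > 0 layers are invisible: there Y = X = W = Ξ₊v and Z = Ξ₊v', so Y - Z is the
    -- truncation of Ξ₊E. This bounds Y - Z in L₂ without using the boundary values.
    have hcZ : IsCut (fourierMultiplierCLM ℂ (lam 1 1) E) (Y - Z) := by
      refine ⟨(hEe.mult (temperate_lam_one 1)).isL2 hXE2, hc.isL2_cut.sub hZ2, hc.van_neg.sub hZv, ?_⟩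
      have h1 := hcE.van_sub.mult_lam_one_one
      rw [map_sub, map_sub, hXv'] at h1
      have h2 := ((h1.add hWX).add hc.van_sub).sub ((van_layer 1 (boundaryValue (w n) :
        𝓢'(Bdry d, ℂ))).smul (Real.Gamma a : ℂ))
      convert! h2 using 1
      rw [hW]
      abel
    obtain ⟨l1, hl1, hl1m, hl1n⟩ := hcE.exists_hasFT_zero hEe heL.1
    obtain ⟨l2, hl2, hl2m, hl2n⟩ := hcZ.exists_hasFT_zero (hEe.mult (temperate_lam_one 1)) hXE2
    have hsplit : (W - (Y + (Real.Gamma a : ℂ) • layer φ)) Θ =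
        (v - v') (𝓕 (SchwartzMap.smulLeftCLM ℂ (lam 1 1) (𝓕⁻ Θ))) - (Y - Z) Θ -
        (Real.Gamma a : ℂ) * (φ - (boundaryValue (w n) : 𝓢'(Bdry d, ℂ))) (slice 0 Θ) := by
      rw [← fourierMultiplierCLM_apply_apply, map_sub, hXv', ← hW]
      simp only [sub_apply, add_apply, smul_apply, layer_apply, smul_eq_mul]
      ring
    rw [hsplit]
    refine (enorm_sub_le.trans (add_le_add_left enorm_sub_le _)).trans ?_
    rw [hC, add_mul, add_mul, enorm_mul]
    refine add_le_add (add_le_add ?_ ?_) ?_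
    · exact (hl1.enorm_apply_le hl1m _).trans
        (mul_le_mul_right (hl1n.trans (heL.2.trans her.le)) _)
    · rw [mul_assoc]
      exact (hl2.enorm_apply_le hl2m _).trans
        (mul_le_mul_right (hl2n.trans (hXE'.trans (mul_le_mul_right her.le _))) _)
    · have hκL := memLp_of_bessel (by linarith) hκ2
      rw [mul_assoc]
      exact mul_le_mul_right ((hκ.enorm_apply_le hκL.1 _).trans
        (mul_le_mul_right (hκL.2.trans hκr.le) _)) _
  have h0 : ‖(W - (Y + (Real.Gamma a : ℂ) • layer φ)) Θ‖ₑ = 0 := by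
    have h1 : Tendsto (fun n : ℕ => C * (n : ℝ≥0∞)⁻¹) atTop (𝓝 (C * 0)) :=
      ENNReal.Tendsto.const_mul ENNReal.tendsto_inv_nat_nhds_zero (Or.inr hCt)
    rw [mul_zero] at h1
    refine le_antisymm (ge_of_tendsto' h1 fun n => key _ ?_) zero_le
    exact ENNReal.inv_pos.2 (ENNReal.natCast_ne_top n)
  rw [enorm_eq_zero, sub_apply, sub_eq_zero] at h0
  exact h0

end Uniqueness


open Set

/-! ### Existence -/

section Existence

open FourierTransform

variable {d : ℕ}

/-- Schwartz functions are dense in the weighted `L₂`-space on the boundary. -/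
theorem exists_schwartz_eLpNorm_lt {r : ℝ} {κ : Bdry d → ℂ}
    (hκ : MemLp (fun y => ((jap y ^ r : ℝ) : ℂ) * κ y) 2) {ε : ℝ≥0∞} (hε : 0 < ε) :
    ∃ ψ : 𝓢(Bdry d, ℂ), MemLp (fun y => ((jap y ^ r : ℝ) : ℂ) * (κ y - ψ y)) 2 ∧
      eLpNorm (fun y => ((jap y ^ r : ℝ) : ℂ) * (κ y - ψ y)) 2 < ε := by
  have hd := SchwartzMap.denseRange_toLpCLM (E := Bdry d) (F := ℂ) (p := 2)
    (μ := volume) (by norm_num)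
  obtain ⟨_, ⟨g, rfl⟩, h2⟩ := EMetric.mem_closure_iff.1 (hd (hκ.toLp _)) ε hε
  have h3 : edist (hκ.toLp _) ((g.memLp 2 volume).toLp g) < ε := h2
  rw [Lp.edist_toLp_toLp] at h3
  have h4 : (fun y => ((jap y ^ r : ℝ) : ℂ) * (κ y - SchwartzMap.smulLeftCLM ℂ
      (fun y : Bdry d => ((jap y ^ (-r) : ℝ) : ℂ)) g y)) =
      (fun y => ((jap y ^ r : ℝ) : ℂ) * κ y) - ⇑g := by
    ext y
    have h5 : ((jap y ^ r : ℝ) : ℂ) * ((jap y ^ (-r) : ℝ) : ℂ) = 1 := by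
      rw [← Complex.ofReal_mul, ← Real.rpow_add (jap_pos y), add_neg_cancel, Real.rpow_zero,
        Complex.ofReal_one]
    rw [SchwartzMap.smulLeftCLM_apply_apply
      (hasTemperateGrowth_ofReal (hasTemperateGrowth_jap_rpow (-r))), smul_eq_mul, Pi.sub_apply]
    linear_combination (-g y) * h5
  refine ⟨SchwartzMap.smulLeftCLM ℂ (fun y : Bdry d => ((jap y ^ (-r) : ℝ) : ℂ)) g, ?_, ?_⟩
  · rw [h4]
    exact hκ.sub (g.memLp 2 volume)
  · rw [h4]
    exact h3

theorem memLp_bessel_of_jap {r : ℝ} (hr : 0 ≤ r) {κ : Bdry d → ℂ}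
    (hκ : MemLp (fun y => ((jap y ^ r : ℝ) : ℂ) * κ y) 2) :
    MemLp (fun y => (bessel r y : ℂ) * κ y) 2 ∧
    eLpNorm (fun y => (bessel r y : ℂ) * κ y) 2 ≤
      eLpNorm (fun y => ((jap y ^ r : ℝ) : ℂ) * κ y) 2 := by
  have hc : Continuous fun y : Bdry d => ((jap y ^ r : ℝ) : ℂ) :=
    Complex.continuous_ofReal.comp (continuous_jap.rpow_const fun _ => Or.inl (jap_pos _).ne')
  have hm := aestronglyMeasurable_of_weight hc (fun y => Complex.ofReal_ne_zero.2
      (Real.rpow_pos_of_pos (jap_pos y) r).ne') hκ.1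
  have hle : ∀ y, ‖(bessel r y : ℂ) * κ y‖ ≤ ‖((jap y ^ r : ℝ) : ℂ) * κ y‖ := fun y => by
    rw [norm_mul, norm_mul, norm_ofReal_rpow (jap_pos y), Complex.norm_real,
      Real.norm_of_nonneg (bessel_pos r y).le]
    exact mul_le_mul_of_nonneg_right (bessel_le_jap hr y) (norm_nonneg _)
  exact ⟨hκ.of_le ((continuous_bessel r).aestronglyMeasurable.mul hm) (ae_of_all _ hle),
    eLpNorm_mono hle⟩

theorem memLp_jap_of_bessel {r : ℝ} (hr : 0 ≤ r) {κ : Bdry d → ℂ}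
    (hκ : MemLp (fun y => (bessel r y : ℂ) * κ y) 2) :
    MemLp (fun y => ((jap y ^ r : ℝ) : ℂ) * κ y) 2 := by
  have hc : Continuous fun y : Bdry d => ((jap y ^ r : ℝ) : ℂ) :=
    Complex.continuous_ofReal.comp (continuous_jap.rpow_const fun _ => Or.inl (jap_pos _).ne')
  refine memLp_of_norm_le_mul (C := (2 * Real.pi) ^ r) hκ
    (hc.aestronglyMeasurable.mul (memLp_of_bessel hr hκ).1.1) fun y => ?_
  rw [norm_mul, norm_mul, norm_ofReal_rpow (jap_pos y), Complex.norm_real,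
    Real.norm_of_nonneg (bessel_pos r y).le, ← mul_assoc]
  exact mul_le_mul_of_nonneg_right (jap_le_bessel hr y) (norm_nonneg _)

/-- Approximation of `Ξ₊^{-a}(Y + Γ(a) φ ⊗ δ)` by functions `e⁺ x_n^{a-1} w`. -/
theorem exists_approximant {a m : ℝ} (ha : 0 < a) (ha1 : a < 1) (hm : 0 ≤ m) :
    ∃ C : ℝ≥0∞, C ≠ ⊤ ∧ ∀ {X Y : 𝓢'(Full d, ℂ)} {φ : 𝓢'(Bdry d, ℂ)} {k : Full d → ℂ}
    {κ : Bdry d → ℂ}, HasFT X k → MemLp (fun ξ => ((fjap ξ ^ m : ℝ) : ℂ) * k ξ) 2 → IsCut X Y →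
    HasFT φ κ → MemLp (fun y => ((jap y ^ (m + 1 / 2) : ℝ) : ℂ) * κ y) 2 → ∀ r : ℝ≥0∞, 0 < r →
    ∃ w : 𝓢(Full d, ℂ),
      sobolevRestrENorm (halfSpace d) (m + 1) (restr (halfSpace d)
        (fourierMultiplierCLM ℂ (lam 1 (a - 1)) (fourierMultiplierCLM ℂ (lam 1 (-a))
          (Y + layer ((Real.Gamma a : ℂ) • φ)) - powMul (a - 1) w))) ≤ C * r ∧
      sobolevENorm (m + 1 / 2) (φ - (boundaryValue w : 𝓢'(Bdry d, ℂ))) ≤ r := by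
  obtain ⟨C, hCt, hC⟩ := exists_resolvent_extension (d := d) hm
  refine ⟨C * (1 + ‖(Real.Gamma a : ℂ)‖ₑ), ENNReal.mul_ne_top hCt
    (ENNReal.add_ne_top.2 ⟨ENNReal.one_ne_top, enorm_ne_top⟩), ?_⟩
  intro X Y φ k κ hX hk hc hφ hκ r hr
  obtain ⟨N, hN⟩ := exists_nat_ge (m + 1)
  -- X is approximated by X' whose truncation Y' is explicit, and the transform of φ by a Schwartz
  -- function ψ.
  obtain ⟨h, hh, hhr⟩ := exists_mem_atomSpan_eLpNorm_lt hN hk hr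
  obtain ⟨B, X', Y', hB, hX', hY', hc'⟩ := hasFlatCut_of_mem_atomSpan ha ha1
    (by have : (1 : ℝ) ≤ N := by linarith
        exact_mod_cast this) hh
  obtain ⟨ψ, hψ, hψr⟩ := exists_schwartz_eLpNorm_lt hκ hr
  have hψFT : HasFT ((𝓕⁻ ψ : 𝓢(Bdry d, ℂ)) : 𝓢'(Bdry d, ℂ)) ψ := by
    have h1 := hasFT_schwartz (𝓕⁻ ψ : 𝓢(Bdry d, ℂ))
    rwa [fourier_fourierInv_eq] at h1
  -- The summand B vanishes at x_n = 0 and produces Y'; the exponential model carries the boundary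
  -- value ψ and produces the layer, with no remainder.
  set w := partialFourierInv (B + expTensor 0 ψ) with hw
  have hbv : boundaryValue w = 𝓕⁻ ψ := by
    rw [boundaryValue_eq, hw, slice_partialFourierInv, map_add, hB, zero_add, slice_expTensor_zero]
  have hG : (Real.Gamma a : ℂ) ≠ 0 := Complex.ofReal_ne_zero.2 (Real.Gamma_pos_of_pos ha).ne'
  have hpm : fourierMultiplierCLM ℂ (lam 1 a) (powMul (a - 1) w) =
      Y' + layer ((Real.Gamma a : ℂ) • ((𝓕⁻ ψ : 𝓢(Bdry d, ℂ)) : 𝓢'(Bdry d, ℂ))) := by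
    have h1 := (hasFT_powMul ha ha1 w).mult (temperate_lam_one a)
    rw [hw, partialFourier_partialFourierInv] at h1
    have h2 := hY'.add ((hψFT.smul (Real.Gamma a : ℂ)).layer ((ψ.memLp 2 volume).const_mul _))
    refine h1.unique (h2.congr ?_)
    ext ξ
    have h3 : lam 1 a ξ * lam 1 (-(a + (0 : ℕ))) ξ = 1 := by
      rw [← lam_add]; simp
    have h4 := halfFT_expTensor ha 0 ψ ξ
    rw [halfFT_add ha ha1, h4]
    push_cast at h3 ⊢
    rw [add_zero] at h3 ⊢
    linear_combination (-(Real.Gamma a : ℂ) * ψ (tang d ξ)) * h3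
  -- The error again has the form Ξ₊^{-1}(truncation + layer), now with the small data X - X' and
  -- Γ(a) times the boundary error, so the resolvent estimate makes it small.
  have hdiff : fourierMultiplierCLM ℂ (lam 1 (a - 1)) (fourierMultiplierCLM ℂ (lam 1 (-a))
      (Y + layer ((Real.Gamma a : ℂ) • φ)) - powMul (a - 1) w) =
      fourierMultiplierCLM ℂ (lam 1 (-1)) ((Y - Y') + layer ((Real.Gamma a : ℂ) •
        (φ - ((𝓕⁻ ψ : 𝓢(Bdry d, ℂ)) : 𝓢'(Bdry d, ℂ))))) := by
    have h1 : (Y - Y') + layer ((Real.Gamma a : ℂ) •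
        (φ - ((𝓕⁻ ψ : 𝓢(Bdry d, ℂ)) : 𝓢'(Bdry d, ℂ)))) =
        (Y + layer ((Real.Gamma a : ℂ) • φ)) -
          fourierMultiplierCLM ℂ (lam 1 a) (powMul (a - 1) w) := by
      rw [hpm]
      simp only [map_smul, map_sub]
      module
    rw [h1, map_sub, map_sub, mult_lam_lam (by norm_num), mult_lam_lam (by norm_num)]
    congr 3 <;> ring_nf
  have hgm : MemLp (fun y => ((jap y ^ (m + 1 / 2) : ℝ) : ℂ) * ((Real.Gamma a : ℂ) * (κ y - ψ y))) 2 ∧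
      eLpNorm (fun y => ((jap y ^ (m + 1 / 2) : ℝ) : ℂ) * ((Real.Gamma a : ℂ) * (κ y - ψ y))) 2 ≤
        ‖(Real.Gamma a : ℂ)‖ₑ * r := by
    have h1 : (fun y => ((jap y ^ (m + 1 / 2) : ℝ) : ℂ) * ((Real.Gamma a : ℂ) * (κ y - ψ y))) =
        (Real.Gamma a : ℂ) • fun y => ((jap y ^ (m + 1 / 2) : ℝ) : ℂ) * (κ y - ψ y) := by
      ext y
      simp only [Pi.smul_apply, smul_eq_mul]
      ring
    rw [h1, eLpNorm_const_smul]
    exact ⟨hψ.const_smul _, mul_le_mul_right hψr.le _⟩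
  have hXm : MemLp (fun ξ => ((fjap ξ ^ m : ℝ) : ℂ) * (k ξ - h ξ)) 2 := by
    have h1 := hk.sub (memLp_of_mem_atomSpan hN hh)
    refine (memLp_congr_ae (ae_of_all _ fun ξ => ?_)).1 h1
    simp only [Pi.sub_apply, mul_sub]
  obtain ⟨-, -, G, g, hGg, hg, hgn, hGr⟩ := hC (hX.sub hX') hXm (hc.sub hc')
    ((hφ.sub hψFT).smul (Real.Gamma a : ℂ)) hgm.1
  refine ⟨w, ?_, ?_⟩
  · rw [hdiff, ← hGr]
    have h1 : sobolevRestrENorm (halfSpace d) (m + 1) (restr (halfSpace d) G) ≤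
        sobolevENorm (m + 1) G :=
      iInf₂_le (f := fun G' (_ : restr (halfSpace d) G' = restr (halfSpace d) G) =>
        sobolevENorm (m + 1) G') G rfl
    refine h1.trans ((hGg.sobolevENorm_le hg).trans (hgn.trans ?_))
    rw [mul_assoc, add_mul, one_mul]
    exact mul_le_mul_right (add_le_add hhr.le hgm.2) _
  · rw [hbv]
    have h1 := memLp_bessel_of_jap (by linarith) hψ
    exact ((hφ.sub hψFT).sobolevENorm_le h1.1).trans (h1.2.trans hψr.le)

/-- The explicit distribution is a solution. -/
theorem isSolution {a s : ℝ} (ha : 0 < a) (ha1 : a < 1) (hs : 0 ≤ s)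
    {F X Y : 𝓢'(Full d, ℂ)} {φ : 𝓢'(Bdry d, ℂ)} {k : Full d → ℂ} {κ : Bdry d → ℂ}
    (hX : X = fourierMultiplierCLM ℂ (lam (-1) (-a)) F) (hk : HasFT X k)
    (hkm : MemLp (fun ξ => ((fjap ξ ^ (s + a) : ℝ) : ℂ) * k ξ) 2) (hc : IsCut X Y)
    (hκ : HasFT φ κ) (hκm : MemLp (fun y => ((jap y ^ (s + a + 1 / 2) : ℝ) : ℂ) * κ y) 2) :
    fourierMultiplierCLM ℂ (lam 1 (-a)) (Y + (Real.Gamma a : ℂ) • layer φ) ∈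
      transmissionSpace d (a - 1) (s + 2 * a) ∧
    restr (halfSpace d) (oneSubLaplacianPow a
      (fourierMultiplierCLM ℂ (lam 1 (-a)) (Y + (Real.Gamma a : ℂ) • layer φ))) =
        restr (halfSpace d) F ∧
    HasWeightedTrace d (a - 1) (s + 2 * a)
      (fourierMultiplierCLM ℂ (lam 1 (-a)) (Y + (Real.Gamma a : ℂ) • layer φ)) φ ∧
    Distribution.dsupport (fourierMultiplierCLM ℂ (lam 1 (-a))
      (Y + (Real.Gamma a : ℂ) • layer φ)) ⊆ {x | 0 ≤ x (Fin.last d)} := by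
  have hm : s + 2 * a - (a - 1) = s + a + 1 := by ring
  refine ⟨?_, ?_, ?_, ?_⟩
  -- Membership concerns Ξ₊^{a-1}u = Ξ₊^{-1}(Y + Γ(a)φ⊗δ), and m = s + a gives the required order s
  -- + a + 1.
  · obtain ⟨C, -, hC⟩ := exists_resolvent_extension (d := d) (m := s + a) (by linarith)
    have hκm' : MemLp (fun y => ((jap y ^ (s + a + 1 / 2) : ℝ) : ℂ) *
        ((Real.Gamma a : ℂ) * κ y)) 2 := by
      refine (memLp_congr_ae (ae_of_all _ fun y => ?_)).1 (hκm.const_mul (Real.Gamma a : ℂ))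
      ring
    obtain ⟨h1, h2, G, g, hG, hg, -, hGr⟩ := hC hk hkm hc (hκ.smul (Real.Gamma a : ℂ)) hκm'
    rw [map_smul] at h1 h2 hGr
    refine ⟨_, _, ⟨G, by rw [hm]; exact hG.memSobolev hg, hGr⟩, isZeroExtension_iff.2 ⟨h1, h2, rfl⟩, ?_⟩
    rw [xiPlus_eq, mult_lam_lam (by norm_num), neg_sub, show 1 - a + -1 = -a by ring]
  · rw [oneSubLaplacianPow_eq]
    have ht : (fun ξ : Full d => lam 1 a ξ * lam (-1) a ξ).HasTemperateGrowth :=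
      (temperate_lam_one a).mul (temperate_lam_neg_one a)
    have h1 : (fun ξ : Full d => lam 1 a ξ * lam (-1) a ξ * lam 1 (-a) ξ) = lam (-1) a := by
      ext ξ
      rw [mul_right_comm, ← lam_add, add_neg_cancel, lam_zero, one_mul]
    rw [mult_mult ht (temperate_lam_one _), h1]
    refine (Van.restr_eq ?_).symm
    have h2 : F = fourierMultiplierCLM ℂ (lam (-1) a) X := by
      rw [hX, mult_lam_lam (by norm_num), add_neg_cancel, mult_lam_zero]
    rw [h2, ← map_sub, ← sub_sub]
    -- X - Y - Γ(a)φ⊗δ vanishes on x_n > 0, and Ξ₋^a preserves this.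
    exact (hc.van_sub.sub ((van_layer 1 φ).smul _)).mult_lam_neg_one a
  · obtain ⟨C, hCt, hC⟩ := exists_approximant (d := d) (m := s + a) ha ha1 (by linarith)
    choose w hw1 hw2 using fun n : ℕ => hC hk hkm hc hκ hκm ((n : ℝ≥0∞)⁻¹)
      (ENNReal.inv_pos.2 (ENNReal.natCast_ne_top n))
    rw [map_smul] at hw1
    refine ⟨w, ?_, ?_⟩
    · simp only [transmissionENorm, xiPlus_eq, hm]
      have h1 : Tendsto (fun n : ℕ => C * (n : ℝ≥0∞)⁻¹) atTop (𝓝 (C * 0)) :=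
        ENNReal.Tendsto.const_mul ENNReal.tendsto_inv_nat_nhds_zero (Or.inr hCt)
      rw [mul_zero] at h1
      exact tendsto_of_tendsto_of_tendsto_of_le_of_le tendsto_const_nhds h1 (fun _ => zero_le) hw1
    · have hm' : s + 2 * a - (a - 1) - 1 / 2 = s + a + 1 / 2 := by ring
      rw [hm']
      exact tendsto_of_tendsto_of_tendsto_of_le_of_le tendsto_const_nhds
        ENNReal.tendsto_inv_nat_nhds_zero (fun _ => zero_le) hw2
  · exact ((hc.van_neg.add ((van_layer _ φ).smul _)).mult_lam_one (-a)).dsupport_subset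

end Existence

end HalfSpaceDirichlet

end

/-! ### The existence and uniqueness theorem -/

theorem theorem2p2 (d : ℕ) (a : ℝ) (ha0 : 0 < a) (ha1 : a < 1) (s : ℝ) (hs : 0 ≤ s)
    (f : 𝓓'(HalfSpaceDirichlet.halfSpace d, ℂ))
    (hf : HalfSpaceDirichlet.MemSobolevRestr (HalfSpaceDirichlet.halfSpace d) s f)
    (φ : 𝓢'(EuclideanSpace ℝ (Fin d), ℂ)) (hφ : MemSobolev (s + a + 1 / 2) 2 φ) :
    ∃! u : 𝓢'(EuclideanSpace ℝ (Fin (d + 1)), ℂ),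
      u ∈ HalfSpaceDirichlet.transmissionSpace d (a - 1) (s + 2 * a) ∧
      HalfSpaceDirichlet.restr (HalfSpaceDirichlet.halfSpace d)
        (HalfSpaceDirichlet.oneSubLaplacianPow a u) = f ∧
      HalfSpaceDirichlet.HasWeightedTrace d (a - 1) (s + 2 * a) u φ ∧
      Distribution.dsupport u ⊆ {x | 0 ≤ x (Fin.last d)} := by
  obtain ⟨F, hF, rfl⟩ := hf
  obtain ⟨γ, hγ, hγm⟩ := HalfSpaceDirichlet.exists_hasFT_of_memSobolev hF
  obtain ⟨κ, hκ, hκm⟩ := HalfSpaceDirichlet.exists_hasFT_of_memSobolev hφ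
  -- X = Ξ₋^{-a}F lies in H^{s+a}. One fixed extension F of f and its truncation Y serve both
  -- existence and uniqueness.
  have hX := hγ.mult (HalfSpaceDirichlet.temperate_lam_neg_one (-a))
  have hXm := (HalfSpaceDirichlet.memLp_fjap_mult_lam (ε := -1) (τ := -a) (r := s + a) (by norm_num)
    (add_neg_cancel_right s a).symm (HalfSpaceDirichlet.memLp_fjap_of_bessel hs le_rfl hγm).1).1
  obtain ⟨Y, -, -, hc, -⟩ := hX.exists_isCut (by linarith)
    (HalfSpaceDirichlet.jap_mul_le_fjap_mul (by linarith) hXm).1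
  have hsol := HalfSpaceDirichlet.isSolution ha0 ha1 hs rfl hX hXm hc hκ
    (HalfSpaceDirichlet.memLp_jap_of_bessel (by linarith) hκm)
  exact ⟨_, hsol, fun u hu => HalfSpaceDirichlet.eq_of_isSolution ha0 ha1 hs
    (hγ.isL2 (HalfSpaceDirichlet.memLp_of_bessel hs hγm).1) rfl hc hu.1 hu.2.1 hu.2.2.1⟩
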